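/- Let $n\ge 0$ be an integer and $\alpha,\beta\in\mathbb R$. Consider the Fermi-Pasta-Ulam lattice with fixed endpoints and $n$ moving particles, i.e. the Hamiltonian $$H(q,p)=\sum_{j=1}^{n}\frac{p_j^2}{2}+\sum_{j=0}^{n}W(q_{j+1}-q_j),\qquad q_0=q_{n+1}=0,\qquad W(x)=\frac{x^2}{2!}+\frac{\alpha x^3}{3!}+\frac{\beta x^4}{4!},$$ on $T^*\mathbb R^n$ with the symplectic form $dq\wedge dp=\sum_j dq_j\wedge dp_j$ and the Poisson bracket $\{F,G\}=\sum_j \frac{\partial F}{\partial q_j}\frac{\partial G}{\partial p_j}-\frac{\partial F}{\partial p_j}\frac{\partial G}{\partial q_j}$, and write $H=H_2+H_3+H_4$ with $H_r$ homogeneous of degree $r$. A quartic Birkhoff normal form of $H$ is a polynomial $\overline H=H_2+\overline H_3+\overline H_4$, with $\overline H_r$ homogeneous of degree $r$ and $\{H_2,\overline H_3\}=\{H_2,\overline H_4\}=0$, for which there is a smooth symplectic diffeomorphism $\Phi$ from an open neighbourhood of $0$ onto an open subset of $T^*\mathbb R^n$ with $\Phi(0)=0$, $D\Phi(0)=\mathrm{Id}$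 and $$H\circ\Phi=\overline H+\mathcal O(\|(q,p)\|^5)\quad\text{near }0 .$$ For $1\le k\le n$ let $\Omega_k=2\sin\frac{k\pi}{2n+2}$, let $$Q_k=\sqrt{\tfrac{2}{n+1}}\sum_{j=1}^n\sin\Bigl(\frac{jk\pi}{n+1}\Bigr)q_j,\qquad P_k=\sqrt{\tfrac{2}{n+1}}\sum_{j=1}^n\sin\Bigl(\frac{jk\pi}{n+1}\Bigr)p_j,$$ and let $E_k=\frac12(P_k^2+\Omega_k^2Q_k^2)$ be the linear energy of the $k$-th Fourier mode. Then, for all $n$, $\alpha$ and $\beta$, $H$ has exactly one quartic Birkhoff normal form $\overline H$. It has $\overline H_3=0$, so $\overline H=H_2+\overline H_4$, and it is completely integrable with integrals $E_1,\dots,E_n$: $\{\overline H,E_k\}=0$ and $\{E_k,E_l\}=0$ for all $1\le k,l\le n$, and the differentials $dE_1,\dots,dE_n$ are linearly independent on an open dense subset of $T^*\mathbb R^n$. -/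

import Mathlib

open scoped ContDiff
open MvPolynomial Asymptotics Topology

noncomputable section

namespace FPU

/-- The phase space `T*ℝⁿ`.  The coordinates `Sum.inl i` are the positions, the coordinates
`Sum.inr i` are the conjugate momenta; `i : Fin n` stands for the particle number `i + 1`. -/
abbrev Phase (n : ℕ) : Type := Fin n ⊕ Fin n → ℝ

/-- Polynomial functions on `T*ℝⁿ`. -/
abbrev Poly (n : ℕ) : Type := MvPolynomial (Fin n ⊕ Fin n) ℝ

/-- The position `q_j` of the `j`-th particle, `0 ≤ j ≤ n + 1`, as a polynomial function on the
phase space.  The two endpoint particles are at rest: `q_0 = q_{n+1} = 0`. -/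
def position (n : ℕ) (j : ℕ) : Poly n :=
  if h : 1 ≤ j ∧ j ≤ n then X (Sum.inl ⟨j - 1, by omega⟩) else 0

/-- The potential energy density `W(x) = x²/2! + α x³/3! + β x⁴/4!`, at a polynomial `x`. -/
def potential {n : ℕ} (α β : ℝ) (x : Poly n) : Poly n :=
  C (1 / 2) * x ^ 2 + C (α / 6) * x ^ 3 + C (β / 24) * x ^ 4

/-- The Hamiltonian of the FPU lattice with fixed endpoints and `n` moving particles,
`H = ∑_{j=1}^{n} p_j² / 2 + ∑_{j=0}^{n} W(q_{j+1} - q_j)`. -/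
def hamiltonian (n : ℕ) (α β : ℝ) : Poly n :=
  (∑ i : Fin n, C (1 / 2) * X (Sum.inr i) ^ 2) +
    ∑ j ∈ Finset.range (n + 1), potential α β (position n (j + 1) - position n j)

/-- The canonical Poisson bracket
`{F, G} = ∑_j (∂F/∂q_j) (∂G/∂p_j) - (∂F/∂p_j) (∂G/∂q_j)`. -/
def poisson {n : ℕ} (F G : Poly n) : Poly n :=
  ∑ i : Fin n, (pderiv (Sum.inl i) F * pderiv (Sum.inr i) G -
    pderiv (Sum.inr i) F * pderiv (Sum.inl i) G)

/-- The canonical symplectic form `dq ∧ dp` on `T*ℝⁿ`. -/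
def symplecticForm {n : ℕ} (u v : Phase n) : ℝ :=
  ∑ i : Fin n, (u (Sum.inl i) * v (Sum.inr i) - u (Sum.inr i) * v (Sum.inl i))

/-- `Φ` is a smooth symplectic diffeomorphism from the open set `Φ.source` onto the open
set `Φ.target`. -/
structure IsSymplecticDiffeo {n : ℕ} (Φ : OpenPartialHomeomorph (Phase n) (Phase n)) : Prop where
  contDiffOn : ContDiffOn ℝ ∞ Φ Φ.source
  contDiffOn_symm : ContDiffOn ℝ ∞ Φ.symm Φ.target
  symplectic : ∀ x ∈ Φ.source, ∀ u v : Phase n,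
    symplecticForm (fderiv ℝ Φ x u) (fderiv ℝ Φ x v) = symplecticForm u v

/-- `K = H₂ + K₃ + ⋯ + K_s` is a Birkhoff normal form of order `s` of the polynomial Hamiltonian
`H = H₂ + H₃ + ⋯` (subscripts denote homogeneous parts): every `K_r` with `3 ≤ r ≤ s` Poisson
commutes with `H₂`, and `H ∘ Φ = K + O(‖x‖^{s+1})` for some symplectic diffeomorphism `Φ` of an
open neighbourhood of `0` onto its image with `Φ(0) = 0` and `DΦ(0) = Id`. -/
structure IsBirkhoffNormalForm {n : ℕ} (H : Poly n) (s : ℕ) (K : Poly n) : Prop where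
  component_lt_two : ∀ r < 2, homogeneousComponent r K = 0
  component_two : homogeneousComponent 2 K = homogeneousComponent 2 H
  totalDegree_le : K.totalDegree ≤ s
  commutes : ∀ r, 3 ≤ r → r ≤ s →
    poisson (homogeneousComponent 2 H) (homogeneousComponent r K) = 0
  transformed : ∃ Φ : OpenPartialHomeomorph (Phase n) (Phase n),
    IsSymplecticDiffeo Φ ∧ 0 ∈ Φ.source ∧ Φ 0 = 0 ∧
    fderiv ℝ Φ 0 = ContinuousLinearMap.id ℝ (Phase n) ∧
    (fun x : Phase n => eval (Φ x) H - eval x K) =O[𝓝 0] fun x => ‖x‖ ^ (s + 1)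

/-- The linear frequency `Ω_k = 2 sin (k π / (2n + 2))` of the mode number `k = i + 1`. -/
def frequency (n : ℕ) (i : Fin n) : ℝ :=
  2 * Real.sin (((i : ℝ) + 1) * Real.pi / (2 * n + 2))

/-- The matrix `√(2/(n+1)) sin (j k π / (n+1))`, with `j = i' + 1` and `k = i + 1`, of the
discrete sine transform. -/
def sineCoeff (n : ℕ) (i i' : Fin n) : ℝ :=
  √(2 / ((n : ℝ) + 1)) *
    Real.sin (((i' : ℝ) + 1) * ((i : ℝ) + 1) * Real.pi / ((n : ℝ) + 1))

/-- The position of the Fourier mode `k = i + 1`,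
`Q_k = √(2/(n+1)) ∑_{j=1}^{n} sin (j k π / (n+1)) q_j`. -/
def modePosition (n : ℕ) (i : Fin n) : Poly n :=
  ∑ i' : Fin n, C (sineCoeff n i i') * X (Sum.inl i')

/-- The momentum of the Fourier mode `k = i + 1`,
`P_k = √(2/(n+1)) ∑_{j=1}^{n} sin (j k π / (n+1)) p_j`. -/
def modeMomentum (n : ℕ) (i : Fin n) : Poly n :=
  ∑ i' : Fin n, C (sineCoeff n i i') * X (Sum.inr i')

/-- The linear energy `E_k = (P_k² + Ω_k² Q_k²) / 2` of the Fourier mode `k = i + 1`. -/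
def modeEnergy (n : ℕ) (i : Fin n) : Poly n :=
  C (1 / 2) * (modeMomentum n i ^ 2 + C (frequency n i ^ 2) * modePosition n i ^ 2)

/-- The Hamiltonian `K` on `T*ℝⁿ` is (completely, Liouville) integrable with the integrals
`E_1, …, E_n`: they are constants of motion of `K`, they are in involution, and their
differentials are linearly independent on an open dense subset of the phase space. -/
structure IsIntegrableWith {n : ℕ} (K : Poly n) (E : Fin n → Poly n) : Prop where
  constant_of_motion : ∀ k, poisson K (E k) = 0
  involution : ∀ k l, poisson (E k) (E l) = 0
  independent : ∃ V : Set (Phase n), IsOpen V ∧ Dense V ∧ ∀ x ∈ V,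
    LinearIndependent ℝ fun (k : Fin n) (c : Fin n ⊕ Fin n) => eval x (pderiv c (E k))

end FPU

end

/-! The sine transform diagonalises H₂. In the complex coordinates z_k = P_k + iΩ_kQ_k and their
conjugates, {H₂, ·} is diagonal on monomials, with eigenvalue i times the sum of the signed
frequencies. Everything depends on which monomials of degree three and four are resonant. The
frequencies alone do not decide this: cos(π/7) − cos(2π/7) + cos(3π/7) = 1/2 is a relation between
four sines no two of which cancel. The lattice supplies a second condition. H₃ and H₄ are sums over
bonds, so they contain only "balanced" monomials, whose wave numbers with suitable signs add up to a
multiple of 2n + 2 (`exists_waveBalanced`). Balance survives Poisson brackets (`normalBracket_mem`),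
hence holds for the terms that normalisation creates. Balanced cubic resonances are excluded by a
strict triangle inequality (`sin_lt_sin_add_sin`), so the cubic part can be removed. For quartic
ones, `SineRelation.pair` writes the frequencies as imaginary parts of powers of a root of unity ζ
of order M. An integral relation survives Galois conjugation, and averaging over the conjugates ζ ↦
ζ^(1 + jM/p) splits it into residue classes modulo p. A vanishing subrelation of four nonzero terms
forces two to cancel. Primes p ≥ 5 dividing M once, where the splitting may fail, are handled by
balance, and M ∣ 12 by the irrationality of √3. So in a balanced quartic resonance z_k and its
conjugate occur equally often, and such a monomial commutes with every E_k. On the analytic side,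
symplecticity makes the Taylor jet of an admissible Φ Hamiltonian, with a cubic generator F and a
quartic generator G (`IsNearIdentity.exists_flowJet`). Conversely generating functions realise
prescribed generators (`exists_isNearIdentity`). Existence is then the solution of two homological
equations. Uniqueness holds because kernel and image of {H₂, ·} meet only in 0
(`poisson_totalEnergy_eq_zero`), while the Jacobi identity confines the effect of changing F to that
image. -/

namespace FPU

/-! ### Vanishing signed sums of four sines at rational angles. -/

/-- A linear relation with integral coefficients between powers of a primitive root of unity
persists for every other primitive root of unity of the same order. -/
theorem sum_zpow_eq_zero_of_isPrimitiveRoot {ι : Type*} [Fintype ι] {M : ℕ} (hM : 0 < M) {ζ ξ : ℂ}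
    (hζ : IsPrimitiveRoot ζ M) (hξ : IsPrimitiveRoot ξ M) (η a : ι → ℤ)
    (h : ∑ i, (η i : ℂ) * ζ ^ a i = 0) : ∑ i, (η i : ℂ) * ξ ^ a i = 0 := by
  -- Reducing exponents modulo M turns the relation into a rational polynomial vanishing at ζ. It is
  -- divisible by the cyclotomic polynomial, which is also the minimal polynomial of ξ.
  have key : ∀ μ : ℂ, IsPrimitiveRoot μ M →
      Polynomial.aeval μ (∑ i, Polynomial.C (η i : ℚ) * Polynomial.X ^ (a i % M).toNat) =
        ∑ i, (η i : ℂ) * μ ^ a i := by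
    intro μ hμ
    rw [map_sum]
    refine Finset.sum_congr rfl fun i _ => ?_
    have hM' : (M : ℤ) ≠ 0 := by exact_mod_cast hM.ne'
    have h1 : μ ^ a i = μ ^ (a i % M) := by
      conv_lhs => rw [← Int.mul_ediv_add_emod (a i) M]
      rw [zpow_add₀ (hμ.ne_zero hM.ne'), zpow_mul, zpow_natCast, hμ.pow_eq_one, one_zpow, one_mul]
    have h2 : μ ^ (a i % M) = μ ^ (a i % M).toNat := by
      rw [← zpow_natCast, Int.toNat_of_nonneg (Int.emod_nonneg _ hM')]
    rw [h1, h2]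
    simp
  rw [← key ξ hξ]
  rw [← key ζ hζ] at h
  have h3 := minpoly.dvd ℚ ζ h
  rw [← Polynomial.cyclotomic_eq_minpoly_rat hζ hM,
    Polynomial.cyclotomic_eq_minpoly_rat hξ hM] at h3
  exact Polynomial.aeval_eq_zero_of_dvd_aeval_eq_zero h3 (minpoly.aeval ℚ ξ)

/-- Conjugation inverts unit vectors, so the first and the third elementary symmetric functions both
vanish; (z₁ + z₂)(z₁ + z₃)(z₁ + z₄) is z₁² times the first plus the third. -/
theorem eq_neg_of_four_unit_sum_eq_zero {z₁ z₂ z₃ z₄ : ℂ} (h₁ : ‖z₁‖ = 1) (h₂ : ‖z₂‖ = 1)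
    (h₃ : ‖z₃‖ = 1) (h₄ : ‖z₄‖ = 1) (h : z₁ + z₂ + z₃ + z₄ = 0) :
    z₁ + z₂ = 0 ∨ z₁ + z₃ = 0 ∨ z₁ + z₄ = 0 := by
  have hc : z₁⁻¹ + z₂⁻¹ + z₃⁻¹ + z₄⁻¹ = 0 := by
    rw [Complex.inv_eq_conj h₁, Complex.inv_eq_conj h₂, Complex.inv_eq_conj h₃,
      Complex.inv_eq_conj h₄, ← map_add, ← map_add, ← map_add, h, map_zero]
  have n₁ : z₁ ≠ 0 := by rintro rfl; simp at h₁
  have n₂ : z₂ ≠ 0 := by rintro rfl; simp at h₂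
  have n₃ : z₃ ≠ 0 := by rintro rfl; simp at h₃
  have n₄ : z₄ ≠ 0 := by rintro rfl; simp at h₄
  field_simp at hc
  have : (z₁ + z₂) * ((z₁ + z₃) * (z₁ + z₄)) = 0 := by
    linear_combination z₁ ^ 2 * h + hc
  simpa [mul_eq_zero] using this

/-- A vanishing subsum of four unit vectors with nonzero imaginary parts of total sum zero produces
two opposite imaginary parts. -/
theorem exists_im_add_im_eq_zero (z : Fin 4 → ℂ) (hz : ∀ i, ‖z i‖ = 1) (hi : ∀ i, (z i).im ≠ 0)
    (hs : ∑ i, (z i).im = 0) (S : Finset (Fin 4)) (hS : S.Nonempty) (h : ∑ i ∈ S, (z i).im = 0)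
    (h' : S = Finset.univ → ∑ i, z i = 0) : ∃ i j, i ≠ j ∧ (z i).im + (z j).im = 0 := by
  have hcard : S.card ≤ 4 := by simpa using S.card_le_univ
  have hpos := hS.card_pos
  have hco : S.card + Sᶜ.card = 4 := by simp [S.card_add_card_compl]
  have hsc : ∑ i ∈ Sᶜ, (z i).im = 0 := by
    have := S.sum_add_sum_compl fun i => (z i).im
    linarith
  -- A subsum of one term, or of three with one term left over, contradicts the nonvanishing; two
  -- terms are the pair sought; only four terms need the full complex relation.
  interval_cases hc : S.card
  · obtain ⟨i, rfl⟩ := Finset.card_eq_one.1 hc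
    exact absurd (by simpa using h) (hi i)
  · obtain ⟨i, j, hij, rfl⟩ := Finset.card_eq_two.1 hc
    exact ⟨i, j, hij, by simpa [Finset.sum_pair hij] using h⟩
  · obtain ⟨i, hiS⟩ := Finset.card_eq_one.1 (show Sᶜ.card = 1 by omega)
    rw [hiS] at hsc
    exact absurd (by simpa using hsc) (hi i)
  · have hu : S = Finset.univ := (Finset.card_eq_iff_eq_univ S).1 (by simpa using hc)
    have h4 := h' hu
    rw [Fin.sum_univ_four] at h4
    rcases eq_neg_of_four_unit_sum_eq_zero (hz 0) (hz 1) (hz 2) (hz 3) h4 with h5 | h5 | h5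
    · exact ⟨0, 1, by decide, by simpa using congrArg Complex.im h5⟩
    · exact ⟨0, 2, by decide, by simpa using congrArg Complex.im h5⟩
    · exact ⟨0, 3, by decide, by simpa using congrArg Complex.im h5⟩

theorem sum_range_zpow_mul {p : ℕ} (hp : p.Prime) {w : ℂ} (hw : IsPrimitiveRoot w p) (d : ℤ) :
    ∑ j ∈ Finset.range p, w ^ ((j : ℤ) * d) = if (p : ℤ) ∣ d then (p : ℂ) else 0 := by
  have h0 := hw.ne_zero hp.ne_zero
  split_ifs with h
  · have : w ^ d = 1 := (hw.zpow_eq_one_iff_dvd d).2 h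
    simp [mul_comm _ d, zpow_mul, this]
  · have h1 : w ^ d ≠ 1 := fun h1 => h ((hw.zpow_eq_one_iff_dvd d).1 h1)
    have h2 : ∀ j ∈ Finset.range p, w ^ ((j : ℤ) * d) = (w ^ d) ^ j := by
      intro j _
      rw [mul_comm, zpow_mul, zpow_natCast]
    rw [Finset.sum_congr rfl h2, geom_sum_eq h1, ← zpow_natCast, ← zpow_mul, mul_comm, zpow_mul,
      zpow_natCast, hw.pow_eq_one, one_zpow, sub_self, zero_div]

/-- The part of the sum `∑ ηᵢ (xᵢ - xᵢ⁻¹)` that lies in the residue class of `c` modulo `p`. -/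
noncomputable def residueSum (p : ℕ) (η a : Fin 4 → ℤ) (x : Fin 4 → ℂ) (c : ℤ) : ℂ :=
  ∑ i, (η i : ℂ) * ((if (p : ℤ) ∣ a i - c then x i else 0) -
    if (p : ℤ) ∣ a i + c then (x i)⁻¹ else 0)

/-- Orthogonality of the characters of ℤ/p: the average against w^(−jc) keeps precisely the powers
whose exponent, `a i` or `-a i`, is congruent to c. -/
theorem mul_residueSum {p : ℕ} (hp : p.Prime) {w : ℂ} (hw : IsPrimitiveRoot w p) (η a : Fin 4 → ℤ)
    (x : Fin 4 → ℂ) (c : ℤ) : p * residueSum p η a x c =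
      ∑ j ∈ Finset.range p, w ^ (-((j : ℤ) * c)) *
        ∑ i, (η i : ℂ) * (x i * w ^ ((j : ℤ) * a i) - (x i * w ^ ((j : ℤ) * a i))⁻¹) := by
  have h0 := hw.ne_zero hp.ne_zero
  simp_rw [residueSum, Finset.mul_sum]
  rw [Finset.sum_comm]
  refine Finset.sum_congr rfl fun i _ => ?_
  have h1 : ∀ j ∈ Finset.range p, w ^ (-((j : ℤ) * c)) *
      ((η i : ℂ) * (x i * w ^ ((j : ℤ) * a i) - (x i * w ^ ((j : ℤ) * a i))⁻¹)) =
      (η i : ℂ) * (x i * w ^ ((j : ℤ) * (a i - c)) - (x i)⁻¹ * w ^ ((j : ℤ) * (-(a i + c)))) := by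
    intro j _
    rw [mul_inv, ← zpow_neg, show (j : ℤ) * (a i - c) = -(j * c) + j * a i by ring,
      show (j : ℤ) * (-(a i + c)) = -(j * c) + -(j * a i) by ring, zpow_add₀ h0, zpow_add₀ h0]
    ring
  rw [Finset.sum_congr rfl h1, ← Finset.mul_sum, Finset.sum_sub_distrib, ← Finset.mul_sum,
    ← Finset.mul_sum, sum_range_zpow_mul hp hw, sum_range_zpow_mul hp hw]
  simp only [dvd_neg]
  split_ifs <;> ring

/-- Since p is odd and does not divide `a i₀`, the classes of `a i₀` and `-a i₀` differ, and each
index contributes at most one term. For a unit vector, −x⁻¹ has the imaginary part of x, so the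
residue sum is a vanishing subsum of unit vectors with the original imaginary parts. -/
theorem exists_im_add_im_eq_zero_of_residueSum {p : ℕ} (hp : p.Prime) (hp2 : p ≠ 2)
    {η a : Fin 4 → ℤ} {x : Fin 4 → ℂ} (hη : ∀ i, η i = 1 ∨ η i = -1) (hx : ∀ i, ‖x i‖ = 1)
    (hi : ∀ i, (x i).im ≠ 0) (hs : ∑ i, (η i : ℝ) * (x i).im = 0) {i₀ : Fin 4}
    (hi₀ : ¬ (p : ℤ) ∣ a i₀) (h : residueSum p η a x (a i₀) = 0) :
    ∃ i j, i ≠ j ∧ (η i : ℝ) * (x i).im + η j * (x j).im = 0 := by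
  classical
  have hdis : ∀ i, (p : ℤ) ∣ a i - a i₀ → ¬ (p : ℤ) ∣ a i + a i₀ := by
    intro i h1 h2
    have h3 : (p : ℤ) ∣ 2 * a i₀ := by
      have := dvd_sub h2 h1
      rwa [show a i + a i₀ - (a i - a i₀) = 2 * a i₀ by ring] at this
    rcases (Nat.prime_iff_prime_int.1 hp).dvd_or_dvd h3 with h4 | h4
    · have h5 : p ∣ 2 := by exact_mod_cast h4
      exact hp2 ((Nat.prime_dvd_prime_iff_eq hp Nat.prime_two).1 h5)
    · exact hi₀ h4
  let z : Fin 4 → ℂ := fun i =>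
    if (p : ℤ) ∣ a i + a i₀ then -((η i : ℂ) * (x i)⁻¹) else (η i : ℂ) * x i
  have him : ∀ i, (z i).im = (η i : ℝ) * (x i).im := by
    intro i
    simp only [z]
    split_ifs
    · rw [Complex.inv_eq_conj (hx i)]
      rcases hη i with h1 | h1 <;> simp [h1]
    · rcases hη i with h1 | h1 <;> simp [h1]
  have hnorm : ∀ i, ‖z i‖ = 1 := by
    intro i
    simp only [z]
    split_ifs <;> rcases hη i with h1 | h1 <;> simp [h1, hx i]
  have hη0 : ∀ i, (η i : ℝ) ≠ 0 := by
    intro i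
    rcases hη i with h1 | h1 <;> simp [h1]
  let S : Finset (Fin 4) := {i | (p : ℤ) ∣ a i - a i₀ ∨ (p : ℤ) ∣ a i + a i₀}
  have hS : ∑ i ∈ S, z i = 0 := by
    rw [← h, residueSum, Finset.sum_filter]
    refine Finset.sum_congr rfl fun i _ => ?_
    by_cases h1 : (p : ℤ) ∣ a i - a i₀
    · simp [z, h1, hdis i h1]
    · by_cases h2 : (p : ℤ) ∣ a i + a i₀ <;> simp [z, h1, h2]
  have := exists_im_add_im_eq_zero z hnorm (fun i => by rw [him]; exact mul_ne_zero (hη0 i) (hi i))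
    (by simpa [him] using hs) S ⟨i₀, by simp [S]⟩
    (by rw [← Complex.im_sum, hS, Complex.zero_im]) (fun hu => by rw [← hu, hS])
  simpa only [him] using this

/-- Norms decide: y₁² = −1 gives y₁⁻¹ = −y₁, so one side has length two and the other length one. -/
theorem false_of_unit_relation {η₁ η₃ y₁ y₃ : ℂ} (e₁ : ‖η₁‖ = 1) (e₃ : ‖η₃‖ = 1)
    (n₁ : ‖y₁‖ = 1) (n₃ : ‖y₃‖ = 1) (h : η₁ * (y₁ - y₁⁻¹) = η₃ * y₃) (hy : y₁ ^ 2 = -1) :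
    False := by
  have h0 : y₁ ≠ 0 := by rintro rfl; simp at n₁
  have h1 : y₁⁻¹ = -y₁ := by
    field_simp
    linear_combination hy
  have h2 : ‖η₁ * (y₁ - y₁⁻¹)‖ = 2 := by
    rw [h1, sub_neg_eq_add, ← two_mul, norm_mul, norm_mul, e₁, n₁]
    norm_num
  rw [h, norm_mul, e₃, n₃] at h2
  norm_num at h2

theorem sq_eq_neg_one_of_conj {R η y : ℂ} (hR : (starRingEnd ℂ) R = -R) (hη : η ^ 2 = 1)
    (hη' : (starRingEnd ℂ) η = η) (n : ‖y‖ = 1) (h : η * y = R) : y ^ 2 = -1 := by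
  have h0 : y ≠ 0 := by rintro rfl; simp at n
  have h1 := congrArg (starRingEnd ℂ) h
  rw [map_mul, hη', ← Complex.inv_eq_conj n, hR, ← h] at h1
  have h2 : η ≠ 0 := by rintro rfl; norm_num at hη
  field_simp at h1
  linear_combination h1

/-- Conjugating the relation and multiplying by y y' reproduces the left side up to the sign η η',
which gives R (η η' + y y') = 0. -/
theorem mul_eq_neg_of_conj {R η η' y y' : ℂ} (hR : (starRingEnd ℂ) R = -R) (hR0 : R ≠ 0)
    (hη : η ^ 2 = 1) (hη' : η' ^ 2 = 1) (c : (starRingEnd ℂ) η = η) (c' : (starRingEnd ℂ) η' = η')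
    (n : ‖y‖ = 1) (n' : ‖y'‖ = 1) (h : η * y + η' * y' = R) : (y * y') ^ 2 = 1 := by
  have h0 : y ≠ 0 := by rintro rfl; simp at n
  have h0' : y' ≠ 0 := by rintro rfl; simp at n'
  have h1 := congrArg (starRingEnd ℂ) h
  rw [map_add, map_mul, map_mul, c, c', ← Complex.inv_eq_conj n, ← Complex.inv_eq_conj n', hR]
    at h1
  field_simp at h1
  have h2 : R * (η * η' + y * y') = 0 := by
    rw [← h] at h1 ⊢
    linear_combination h1 + y * η' * hη + y' * η * hη'
  have h3 : y * y' = -(η * η') := by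
    rcases mul_eq_zero.1 h2 with h3 | h3
    · exact absurd h3 hR0
    · linear_combination h3
  rw [h3]
  linear_combination hη * η' ^ 2 + hη'

theorem residue_ne_zero {K : Type*} [Field K] (n2 : (2 : K) ≠ 0) (n3 : (3 : K) ≠ 0) {B C : K}
    (hB : B - 1 = 0 ∨ B + 1 = 0) (hC : C - 2 = 0 ∨ C + 2 = 0) :
    B ≠ 0 ∧ C ≠ 0 ∧ B + B ≠ 0 ∧ C + C ≠ 0 ∧ B + C ≠ 0 ∧ B - C ≠ 0 ∧ C - B ≠ 0 := by
  have n4 : (2 : K) * 2 ≠ 0 := mul_ne_zero n2 n2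
  grind

/-- The residue condition modulo a prime at least five that divides the order exactly once. -/
theorem false_of_residueSum_const {p : ℕ} (hp' : p.Prime) (hp5 : 5 ≤ p) {η a : Fin 4 → ℤ}
    {y : Fin 4 → ℂ} (hη : ∀ i, η i = 1 ∨ η i = -1) (hy : ∀ i, ‖y i‖ = 1) {R : ℂ} (hR0 : R ≠ 0)
    (hR : (starRingEnd ℂ) R = -R) (h : ∀ c, residueSum p η a y c = R)
    (ha : (p : ℤ) ∣ ∑ i, a i) (hprod : (∏ i, y i) ^ 2 = 1) {i j k l : Fin 4}
    (hu : Finset.univ = ({i, j, k, l} : Finset (Fin 4))) (hij : i ≠ j) (hik : i ≠ k) (hil : i ≠ l)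
    (hjk : j ≠ k) (hjl : j ≠ l) (hkl : k ≠ l) (hi : (p : ℤ) ∣ a i)
    (hj : (p : ℤ) ∣ a j - 1 ∨ (p : ℤ) ∣ a j + 1) (hk : (p : ℤ) ∣ a k - 2 ∨ (p : ℤ) ∣ a k + 2) :
    False := by
  have hsum : ∀ f : Fin 4 → ℂ, ∑ i, f i = f i + (f j + (f k + f l)) := by
    intro f
    rw [hu, Finset.sum_insert (by simp [*]), Finset.sum_insert (by simp [*]),
      Finset.sum_insert (by simp [*]), Finset.sum_singleton]
  have hsum' : ∑ i, a i = a i + (a j + (a k + a l)) := by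
    rw [hu, Finset.sum_insert (by simp [*]), Finset.sum_insert (by simp [*]),
      Finset.sum_insert (by simp [*]), Finset.sum_singleton]
  have hprod' : ∏ i, y i = y i * (y j * (y k * y l)) := by
    rw [hu, Finset.prod_insert (by simp [*]), Finset.prod_insert (by simp [*]),
      Finset.prod_insert (by simp [*]), Finset.prod_singleton]
  rw [hsum'] at ha
  rw [hprod'] at hprod
  have hη2 : ∀ i, (η i : ℂ) ^ 2 = 1 := fun i => by rcases hη i with h1 | h1 <;> simp [h1]
  have hηc : ∀ i, (starRingEnd ℂ) (η i : ℂ) = η i := fun i => by simp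
  have hηn : ∀ i, ‖(η i : ℂ)‖ = 1 := fun i => by rcases hη i with h1 | h1 <;> simp [h1]
  have h0 := h (a i)
  have h1 := h (a j)
  have h2 := h (a k)
  have h3 := h (a l)
  rw [residueSum, hsum] at h0 h1 h2 h3
  -- Every case ends here: a term alone in its class gives |R| = 1, whereas y_i² = −1 in class zero
  -- would give |R| = 2.
  have fin : ∀ m, (η m : ℂ) * y m = R → y i ^ 2 = -1 → (η i : ℂ) * (y i - (y i)⁻¹) = R → False :=
    fun m hm hyi hi0 => false_of_unit_relation (hηn i) (hηn m) (hy i) (hy m) (hi0.trans hm.symm) hyi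
  have hp : Fact p.Prime := ⟨hp'⟩
  have cast_ne : ∀ m : ℕ, 0 < m → m < 5 → (m : ZMod p) ≠ 0 := fun m hm hm5 h0 =>
    absurd (Nat.le_of_dvd hm ((ZMod.natCast_eq_zero_iff m p).1 h0)) (by omega)
  have n1 : (1 : ZMod p) ≠ 0 := one_ne_zero
  have n2 : (2 : ZMod p) ≠ 0 := by exact_mod_cast cast_ne 2 (by norm_num) (by norm_num)
  have n3 : (3 : ZMod p) ≠ 0 := by exact_mod_cast cast_ne 3 (by norm_num) (by norm_num)
  simp only [← ZMod.intCast_zmod_eq_zero_iff_dvd, Int.cast_add, Int.cast_sub, Int.cast_one,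
    Int.cast_ofNat] at h0 h1 h2 h3 ha hi hj hk
  generalize (a i : ZMod p) = A at *
  generalize (a j : ZMod p) = B at *
  generalize (a k : ZMod p) = C at *
  generalize (a l : ZMod p) = D at *
  subst hi
  have pair : ∀ m m', (η m : ℂ) * y m + η m' * y m' = R → (y m * y m') ^ 2 = 1 := fun m m' hm =>
    mul_eq_neg_of_conj hR hR0 (hη2 m) (hη2 m') (hηc m) (hηc m') (hy m) (hy m') hm
  have single : ∀ m, (η m : ℂ) * y m = R → y m ^ 2 = -1 := fun m hm =>
    sq_eq_neg_one_of_conj hR (hη2 m) (hηc m) (hy m) hm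
  obtain ⟨hB, hC, hBB, hCC, hBC, hBC', hCB'⟩ := residue_ne_zero n2 n3 hj hk
  clear cast_ne hj hk
  -- Balance determines the last residue. It is nonzero and differs from −B and −C, leaving D = B, D
  -- = C, or D in a class of its own. A lone term satisfies y² = −1, two terms sharing a class
  -- satisfy (y y')² = 1, and `hprod` then yields y_i² = −1 each time.
  have hD : D = -(B + C) := by linear_combination ha
  have hD0 : D ≠ 0 := by rw [hD]; exact neg_ne_zero.2 hBC
  have hCB : C + B ≠ 0 := by rwa [add_comm]
  have h0' : (η i : ℂ) * (y i - (y i)⁻¹) = R := by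
    simpa [hB, hC, hD0] using h0
  have hDB' : D + B ≠ 0 := by
    rw [hD]
    intro h5
    exact hC (by linear_combination -h5)
  have hDC' : D + C ≠ 0 := by
    rw [hD]
    intro h5
    exact hB (by linear_combination -h5)
  have hBD' : B + D ≠ 0 := by rwa [add_comm]
  have hCD' : C + D ≠ 0 := by rwa [add_comm]
  by_cases hDB : D - B = 0
  · have hDC : D - C ≠ 0 := by
      intro h5
      exact hBC' (by linear_combination h5 - hDB)
    have e1 : (η j : ℂ) * y j + η l * y l = R := by
      simpa [hB, hC, hBB, hCB, hCB', hDB', hDB] using h1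
    have e2 : (η k : ℂ) * y k = R := by
      simpa [hB, hC, hCC, hBC, hBC', hDC', hDC] using h2
    refine fin k e2 ?_ h0'
    linear_combination ((y i) ^ 2 * (y k) ^ 2) * pair j l e1 - hprod + (y i) ^ 2 * single k e2
  have e1 : (η j : ℂ) * y j = R := by
    simpa [hB, hC, hBB, hCB, hCB', hDB', hDB] using h1
  by_cases hDC : D - C = 0
  · have e2 : (η k : ℂ) * y k + η l * y l = R := by
      simpa [hB, hC, hCC, hBC, hBC', hDC', hDC] using h2
    refine fin j e1 ?_ h0'
    linear_combination ((y i) ^ 2 * (y j) ^ 2) * pair k l e2 - hprod + (y i) ^ 2 * single j e1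
  have e2 : (η k : ℂ) * y k = R := by
    simpa [hB, hC, hCC, hBC, hBC', hDC', hDC] using h2
  have hBD : B - D ≠ 0 := by rwa [← neg_sub, neg_ne_zero]
  have hCD : C - D ≠ 0 := by rwa [← neg_sub, neg_ne_zero]
  have hDD : D + D ≠ 0 := by
    rw [← two_mul]
    exact mul_ne_zero n2 hD0
  have e3 : (η l : ℂ) * y l = R := by
    simpa [hD0, hDD, hBD, hCD, hBD', hCD'] using h3
  refine fin j e1 ?_ h0'
  linear_combination -hprod + (y i * y j * y k) ^ 2 * single l e3 -
    (y i * y j) ^ 2 * single k e2 + (y i) ^ 2 * single j e1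

theorem exists_fin_four (i j k : Fin 4) (hij : i ≠ j) (hik : i ≠ k) (hjk : j ≠ k) :
    ∃ l, i ≠ l ∧ j ≠ l ∧ k ≠ l ∧ Finset.univ = ({i, j, k, l} : Finset (Fin 4)) := by
  have h : ∀ i j k : Fin 4, i ≠ j → i ≠ k → j ≠ k → ∃ l, i ≠ l ∧ j ≠ l ∧ k ≠ l ∧
      ∀ m : Fin 4, m ∈ ({i, j, k, l} : Finset (Fin 4)) := by decide
  obtain ⟨l, h1, h2, h3, h4⟩ := h i j k hij hik hjk
  exact ⟨l, h1, h2, h3, (Finset.eq_univ_iff_forall.2 h4).symm⟩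

/-- Four powers of a primitive `M`-th root of unity have nonzero imaginary parts whose sum with the
signs `η` vanishes. -/
structure SineRelation (M : ℕ) (ζ : ℂ) (η a : Fin 4 → ℤ) : Prop where
  prim : IsPrimitiveRoot ζ M
  pos : 0 < M
  sign : ∀ i, η i = 1 ∨ η i = -1
  dvd : (M : ℤ) ∣ 2 * ∑ i, a i
  im_ne : ∀ i, (ζ ^ a i).im ≠ 0
  sum_im : ∑ i, (η i : ℝ) * (ζ ^ a i).im = 0

variable {M : ℕ} {ζ : ℂ} {η a : Fin 4 → ℤ}

theorem SineRelation.norm_eq (h : SineRelation M ζ η a) (i : Fin 4) : ‖ζ ^ a i‖ = 1 := by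
  rw [norm_zpow, h.prim.norm'_eq_one h.pos.ne', one_zpow]

theorem sub_inv_eq_of_norm_eq_one {x : ℂ} (hx : ‖x‖ = 1) : x - x⁻¹ = 2 * Complex.I * x.im := by
  rw [Complex.inv_eq_conj hx, Complex.sub_conj]
  push_cast
  ring

/-- Replacing 2i Im x by x − x⁻¹ makes the relation algebraic with integral coefficients, so that it
passes to all conjugates. -/
theorem SineRelation.conj_sum (h : SineRelation M ζ η a) {ξ : ℂ} (hξ : IsPrimitiveRoot ξ M) :
    ∑ i, (η i : ℂ) * (ξ ^ a i - (ξ ^ a i)⁻¹) = 0 := by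
  have h1 : ∑ i : Fin 4 ⊕ Fin 4, ((Sum.elim η (-η) i : ℤ) : ℂ) * ζ ^ (Sum.elim a (-a) i) = 0 := by
    have h2 : ∑ i, (η i : ℂ) * (ζ ^ a i - (ζ ^ a i)⁻¹) = 0 := by
      have h3 : ∀ i, (η i : ℂ) * (ζ ^ a i - (ζ ^ a i)⁻¹) =
          2 * Complex.I * ((η i : ℝ) * (ζ ^ a i).im : ℝ) := fun i => by
        rw [sub_inv_eq_of_norm_eq_one (h.norm_eq i)]
        push_cast
        ring
      simp_rw [h3]
      rw [← Finset.mul_sum, ← Complex.ofReal_sum, h.sum_im, Complex.ofReal_zero, mul_zero]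
    rw [← h2, Fintype.sum_sum_type, ← Finset.sum_add_distrib]
    refine Finset.sum_congr rfl fun i _ => ?_
    simp [zpow_neg]
    ring
  have h4 := sum_zpow_eq_zero_of_isPrimitiveRoot h.pos h.prim hξ _ _ h1
  rw [← h4, Fintype.sum_sum_type, ← Finset.sum_add_distrib]
  refine Finset.sum_congr rfl fun i _ => ?_
  simp [zpow_neg]
  ring

theorem SineRelation.conj_sum_pow (h : SineRelation M ζ η a) {t : ℕ} (ht : t.Coprime M) :
    ∑ i, (η i : ℝ) * ((ζ ^ t) ^ a i).im = 0 := by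
  have h1 := h.conj_sum (h.prim.pow_of_coprime t ht)
  have h3 : ∀ i, (η i : ℂ) * ((ζ ^ t) ^ a i - ((ζ ^ t) ^ a i)⁻¹) =
      2 * Complex.I * ((η i : ℝ) * ((ζ ^ t) ^ a i).im : ℝ) := fun i => by
    rw [sub_inv_eq_of_norm_eq_one (by rw [norm_zpow, norm_pow, h.prim.norm'_eq_one h.pos.ne',
      one_pow, one_zpow])]
    push_cast
    ring
  simp_rw [h3] at h1
  rw [← Finset.mul_sum, ← Complex.ofReal_sum] at h1
  have h2 : (2 * Complex.I) ≠ 0 := by simp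
  exact Complex.ofReal_eq_zero.1 ((mul_eq_zero.1 h1).resolve_left h2)

/-- The conclusion of the resonance lemma: two of the four summands cancel. -/
def HasCancellingPair (ζ : ℂ) (η a : Fin 4 → ℤ) : Prop :=
  ∃ i j, i ≠ j ∧ (η i : ℝ) * (ζ ^ a i).im + η j * (ζ ^ a j).im = 0

/-- A prime factor of M other than p divides M/p, so p is the only prime that could be shared. These
exponents define the conjugations that multiply ζ by a p-th root of unity. -/
theorem coprime_one_add_mul {M p j : ℕ} (hp : p.Prime) (hpM : p ∣ M)
    (h : ¬ p ∣ 1 + j * (M / p)) : (1 + j * (M / p)).Coprime M := by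
  refine Nat.Coprime.symm (Nat.coprime_of_dvd fun q hq hqM hq1 => ?_)
  by_cases hqp : q = p
  · exact h (hqp ▸ hq1)
  · have h1 : q ∣ M / p := by
      have h2 : q ∣ p * (M / p) := by rwa [Nat.mul_div_cancel' hpM]
      rcases hq.dvd_mul.1 h2 with h3 | h3
      · exact absurd ((Nat.prime_dvd_prime_iff_eq hq hp).1 h3) hqp
      · exact h3
    have h4 : q ∣ 1 := (Nat.dvd_add_left (h1.mul_left j)).1 hq1
    exact hq.one_lt.ne' (Nat.dvd_one.1 h4)

theorem SineRelation.im_eq (h : SineRelation M ζ η a) (i : Fin 4) :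
    ((η i : ℂ) * ζ ^ a i).im = (η i : ℝ) * (ζ ^ a i).im := by
  rcases h.sign i with h1 | h1 <;> simp [h1]

theorem SineRelation.sign_ne (h : SineRelation M ζ η a) (i : Fin 4) : (η i : ℝ) ≠ 0 := by
  rcases h.sign i with h1 | h1 <;> simp [h1]

theorem SineRelation.sign_norm (h : SineRelation M ζ η a) (i : Fin 4) : ‖(η i : ℂ)‖ = 1 := by
  rcases h.sign i with h1 | h1 <;> simp [h1]

/-- The exponent 1 + M/2 is prime to M and sends ζ to −ζ. Adding the relation to its conjugate
isolates the even exponents, a nonempty subrelation that omits `j₀`. -/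
theorem SineRelation.pair_of_four_dvd (h : SineRelation M ζ η a) (h4 : 4 ∣ M) {i₀ j₀ : Fin 4}
    (hi₀ : Even (a i₀)) (hj₀ : Odd (a j₀)) : HasCancellingPair ζ η a := by
  obtain ⟨k, rfl⟩ := h4
  have ht : (1 + 1 * (4 * k / 2)).Coprime (4 * k) :=
    coprime_one_add_mul Nat.prime_two ⟨2 * k, by ring⟩ (by omega)
  have hw : ζ ^ (2 * k) = -1 := by
    have := h.prim.pow h.pos (show 4 * k = 2 * k * 2 by ring)
    exact this.eq_neg_one_of_two_right
  have h1 := h.conj_sum_pow ht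
  have h2 : ∀ i, (ζ ^ (1 + 1 * (4 * k / 2))) ^ a i = ζ ^ a i * (-1) ^ a i := fun i => by
    rw [show 1 + 1 * (4 * k / 2) = 1 + 2 * k by omega, pow_add, pow_one, hw, mul_zpow]
  have hz0 : ∀ i, ((η i : ℂ) * ζ ^ a i).im ≠ 0 := fun i => by
    rw [h.im_eq]
    exact mul_ne_zero (h.sign_ne i) (h.im_ne i)
  have hs : ∑ i, ((η i : ℂ) * ζ ^ a i).im = 0 := by simpa only [h.im_eq] using h.sum_im
  have hS : ∑ i ∈ {i | Even (a i)}, ((η i : ℂ) * ζ ^ a i).im = 0 := by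
    have h3 : 2 * ∑ i ∈ {i | Even (a i)}, ((η i : ℂ) * ζ ^ a i).im =
        ∑ i, (η i : ℝ) * (ζ ^ a i).im + ∑ i, (η i : ℝ) * ((ζ ^ (1 + 1 * (4 * k / 2))) ^ a i).im := by
      rw [Finset.sum_filter, Finset.mul_sum, ← Finset.sum_add_distrib]
      refine Finset.sum_congr rfl fun i _ => ?_
      rw [h2, h.im_eq]
      split_ifs with h5
      · rw [h5.neg_one_zpow, mul_one, two_mul]
      · rw [(Int.not_even_iff_odd.1 h5).neg_one_zpow]
        simp
    rw [h1, h.sum_im] at h3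
    simpa using h3
  have := exists_im_add_im_eq_zero (fun i => (η i : ℂ) * ζ ^ a i)
    (fun i => by rw [norm_mul, h.sign_norm, h.norm_eq, one_mul]) hz0 hs {i | Even (a i)}
    ⟨i₀, by simpa using hi₀⟩ hS (fun hu => by
      have h5 := Finset.mem_univ j₀
      rw [← hu, Finset.mem_filter] at h5
      exact absurd h5.2 (Int.not_even_iff_odd.2 hj₀))
  simpa only [HasCancellingPair, h.im_eq] using this

/-- The exponent 1 + M/4 multiplies ζ by ±i. For odd exponents the conjugate is therefore, up to
signs, a relation between real parts; with the original one it says that four unit vectors have sum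
zero in the plane. -/
theorem SineRelation.pair_of_eight_dvd (h : SineRelation M ζ η a) (h8 : 8 ∣ M)
    (ha : ∀ i, Odd (a i)) : HasCancellingPair ζ η a := by
  obtain ⟨k, rfl⟩ := h8
  have ht : (1 + 2 * k).Coprime (8 * k) := by
    refine Nat.Coprime.mul_right ?_ ?_
    · rw [show 8 = 2 ^ 3 by norm_num]
      exact Nat.Coprime.pow_right 3 (by simp)
    · simp
  have hw : (ζ ^ (2 * k)) ^ 2 = -1 := by
    have := h.prim.pow h.pos (show 8 * k = (2 * k * 2) * 2 by ring)
    rw [← pow_mul]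
    exact this.eq_neg_one_of_two_right
  have h1 := h.conj_sum_pow ht
  have h2 : ∀ i, ∃ s : ℝ, s ^ 2 = 1 ∧ ((ζ ^ (1 + 2 * k)) ^ a i).im = s * (ζ ^ a i).re := by
    intro i
    obtain ⟨b, hb⟩ := ha i
    have h3 : (ζ ^ (1 + 2 * k)) ^ a i = ζ ^ a i * ((-1) ^ b * ζ ^ (2 * k)) := by
      rw [pow_add, pow_one, mul_zpow]
      congr 1
      have h0 : ζ ^ (2 * k) ≠ 0 := pow_ne_zero _ (h.prim.ne_zero h.pos.ne')
      rw [hb, zpow_add₀ h0, zpow_mul, zpow_one, ← hw]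
      norm_cast
    have h4 : ζ ^ (2 * k) = Complex.I ∨ ζ ^ (2 * k) = -Complex.I := by
      rw [← sq_eq_sq_iff_eq_or_eq_neg, hw, Complex.I_sq]
    rw [h3]
    rcases Int.even_or_odd b with h5 | h5 <;> rcases h4 with h6 | h6 <;>
      rw [h6, h5.neg_one_zpow]
    · exact ⟨1, by norm_num, by simp⟩
    · exact ⟨-1, by norm_num, by simp⟩
    · exact ⟨-1, by norm_num, by simp⟩
    · exact ⟨1, by norm_num, by simp⟩
  choose s hs1 hs2 using h2
  simp only [hs2] at h1
  have hη2 : ∀ i, (η i : ℝ) ^ 2 = 1 := fun i => by rcases h.sign i with h1 | h1 <;> simp [h1]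
  refine exists_im_add_im_eq_zero (fun i => ⟨(η i : ℝ) * (s i * (ζ ^ a i).re),
    (η i : ℝ) * (ζ ^ a i).im⟩) (fun i => ?_) (fun i => mul_ne_zero (h.sign_ne i) (h.im_ne i))
    h.sum_im Finset.univ Finset.univ_nonempty h.sum_im (fun _ => ?_)
  · have h5 := h.norm_eq i
    rw [← sq_eq_sq₀ (norm_nonneg _) zero_le_one, Complex.sq_norm, Complex.normSq_apply] at h5 ⊢
    linear_combination h5 + ((s i) ^ 2 * (ζ ^ a i).re ^ 2 + (ζ ^ a i).im ^ 2) * hη2 i +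
      (ζ ^ a i).re ^ 2 * hs1 i
  · apply Complex.ext
    · simpa using h1
    · simpa using h.sum_im

theorem SineRelation.mul_residueSum (h : SineRelation M ζ η a) {p : ℕ} (hp : p.Prime)
    (hpM : p ∣ M) (c : ℤ) : p * residueSum p η a (fun i => ζ ^ a i) c =
      ∑ j ∈ Finset.range p, (ζ ^ (M / p)) ^ (-((j : ℤ) * c)) *
        ∑ i, (η i : ℂ) * ((ζ ^ (1 + j * (M / p))) ^ a i - ((ζ ^ (1 + j * (M / p))) ^ a i)⁻¹) := by
  have hw : IsPrimitiveRoot (ζ ^ (M / p)) p := h.prim.pow h.pos (Nat.div_mul_cancel hpM).symm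
  rw [FPU.mul_residueSum hp hw]
  refine Finset.sum_congr rfl fun j _ => ?_
  congr 1
  refine Finset.sum_congr rfl fun i _ => ?_
  have : (ζ ^ (1 + j * (M / p))) ^ a i = ζ ^ a i * (ζ ^ (M / p)) ^ ((j : ℤ) * a i) := by
    rw [pow_add, pow_one, mul_zpow, mul_comm j, pow_mul, zpow_mul, zpow_natCast]
  rw [this]

/-- Here p still divides M/p, so each exponent 1 + jM/p is prime to M. All conjugates vanish, and
with them all residue sums. -/
theorem SineRelation.pair_of_sq_dvd (h : SineRelation M ζ η a) {p : ℕ} (hp : p.Prime) (hp2 : p ≠ 2)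
    (hpM : p ^ 2 ∣ M) {i₀ : Fin 4} (hi₀ : ¬ (p : ℤ) ∣ a i₀) : HasCancellingPair ζ η a := by
  have hpM' : p ∣ M := dvd_trans (dvd_pow_self _ two_ne_zero) hpM
  refine exists_im_add_im_eq_zero_of_residueSum hp hp2 h.sign h.norm_eq h.im_ne h.sum_im hi₀ ?_
  have h1 := h.mul_residueSum hp hpM' (a i₀)
  rw [Finset.sum_eq_zero] at h1
  · simpa [hp.ne_zero] using h1
  · intro j _
    rw [h.conj_sum (h.prim.pow_of_coprime _ (coprime_one_add_mul hp hpM' _)), mul_zero]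
    intro h2
    have h3 : p ∣ M / p := (Nat.dvd_div_iff_mul_dvd hpM').2 (by rwa [← sq])
    exact hp.one_lt.ne' (Nat.dvd_one.1 ((Nat.dvd_add_left (h3.mul_left j)).1 h2))

/-- Now 1 + jM/p is divisible by p for a single j₀ below p, and only the value R of the sum at that
exponent survives the averaging. R = 0 is the previous situation. R ≠ 0 would force an exponent into
every residue class up to sign, which balance rules out. -/
theorem SineRelation.pair_of_dvd (h : SineRelation M ζ η a) {p : ℕ} (hp : p.Prime) (hp5 : 5 ≤ p)
    (hpM : p ∣ M) (hpM2 : ¬ p ^ 2 ∣ M) {i₀ : Fin 4} (hi₀ : ¬ (p : ℤ) ∣ a i₀) :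
    HasCancellingPair ζ η a := by
  have hfp : Fact p.Prime := ⟨hp⟩
  have hm : ((M / p : ℕ) : ZMod p) ≠ 0 := by
    rw [Ne, ZMod.natCast_eq_zero_iff, Nat.dvd_div_iff_mul_dvd hpM, ← sq]
    exact hpM2
  obtain ⟨j₀, hj₀, hj₀'⟩ : ∃ j₀ < p, ∀ j < p, p ∣ 1 + j * (M / p) → j = j₀ := by
    -- The solution of 1 + j (M/p) ≡ 0 modulo p.
    refine ⟨(-((M / p : ℕ) : ZMod p)⁻¹).val, ZMod.val_lt _, fun j hj hd => ?_⟩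
    rw [← ZMod.natCast_eq_zero_iff] at hd
    push_cast at hd
    have : (j : ZMod p) = -((M / p : ℕ) : ZMod p)⁻¹ := by
      field_simp
      linear_combination hd
    rw [← this, ZMod.val_natCast, Nat.mod_eq_of_lt hj]
  have hw : IsPrimitiveRoot (ζ ^ (M / p)) p := h.prim.pow h.pos (Nat.div_mul_cancel hpM).symm
  have hw0 : ζ ^ (M / p) ≠ 0 := hw.ne_zero hp.ne_zero
  set w := ζ ^ (M / p) with hwdef
  set R : ℂ := ∑ i, (η i : ℂ) * ((ζ ^ (1 + j₀ * (M / p))) ^ a i -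
    ((ζ ^ (1 + j₀ * (M / p))) ^ a i)⁻¹) with hR
  have hB : ∀ c, p * residueSum p η a (fun i => ζ ^ a i) c = w ^ (-((j₀ : ℤ) * c)) * R := by
    intro c
    rw [h.mul_residueSum hp hpM, Finset.sum_eq_single_of_mem j₀ (Finset.mem_range.2 hj₀)]
    intro j hj hne
    rw [h.conj_sum (h.prim.pow_of_coprime _ (coprime_one_add_mul hp hpM fun hd =>
      hne (hj₀' j (Finset.mem_range.1 hj) hd))), mul_zero]
  have hp0 : (p : ℂ) ≠ 0 := by exact_mod_cast hp.ne_zero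
  by_cases hR0 : R = 0
  · refine exists_im_add_im_eq_zero_of_residueSum hp (by omega) h.sign h.norm_eq h.im_ne h.sum_im
      hi₀ ?_
    have := hB (a i₀)
    rw [hR0, mul_zero] at this
    exact (mul_eq_zero.1 this).resolve_left hp0
  exfalso
  set y : Fin 4 → ℂ := fun i => (ζ ^ (1 + j₀ * (M / p))) ^ a i with hy
  have hyn : ∀ i, ‖y i‖ = 1 := fun i => by
    rw [hy, norm_zpow, norm_pow, h.prim.norm'_eq_one h.pos.ne', one_pow, one_zpow]
  have hyx : ∀ i, y i = ζ ^ a i * w ^ ((j₀ : ℤ) * a i) := fun i => by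
    rw [hy]
    simp only
    rw [pow_add, pow_one, mul_zpow, mul_comm j₀, pow_mul, zpow_mul, zpow_natCast]
  have hRc : (starRingEnd ℂ) R = -R := by
    rw [hR, map_sum, ← Finset.sum_neg_distrib]
    refine Finset.sum_congr rfl fun i _ => ?_
    change (starRingEnd ℂ) ((η i : ℂ) * (y i - (y i)⁻¹)) = -((η i : ℂ) * (y i - (y i)⁻¹))
    rw [sub_inv_eq_of_norm_eq_one (hyn i)]
    simp [Complex.conj_ofNat]
  -- Passing from `ζ ^ a i` to `y i` multiplies the class of c by w^(j₀c), which cancels the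
  -- character in `hB` and makes the residue sums independent of c.
  have hres : ∀ c, residueSum p η a y c = R / p := by
    intro c
    have h1 : residueSum p η a y c =
        w ^ ((j₀ : ℤ) * c) * residueSum p η a (fun i => ζ ^ a i) c := by
      rw [residueSum, residueSum, Finset.mul_sum]
      refine Finset.sum_congr rfl fun i _ => ?_
      have e1 : (p : ℤ) ∣ a i - c → w ^ ((j₀ : ℤ) * a i) = w ^ ((j₀ : ℤ) * c) := by
        rintro ⟨d, hd⟩
        rw [show (j₀ : ℤ) * a i = j₀ * c + p * (j₀ * d) by linear_combination (j₀ : ℤ) * hd,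
          zpow_add₀ hw0, zpow_mul w p, zpow_natCast, hw.pow_eq_one, one_zpow, mul_one]
      have e2 : (p : ℤ) ∣ a i + c → (w ^ ((j₀ : ℤ) * a i))⁻¹ = w ^ ((j₀ : ℤ) * c) := by
        rintro ⟨d, hd⟩
        rw [← zpow_neg, show -((j₀ : ℤ) * a i) = j₀ * c + p * (-j₀ * d) by
          linear_combination -(j₀ : ℤ) * hd,
          zpow_add₀ hw0, zpow_mul w p, zpow_natCast, hw.pow_eq_one, one_zpow, mul_one]
      rw [hyx i, mul_inv]
      split_ifs with h1 h2 h2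
      · rw [e2 h2, e1 h1]; ring
      · rw [e1 h1]; ring
      · rw [e2 h2]; ring
      · ring
    rw [h1, eq_div_iff hp0, mul_assoc, mul_comm (residueSum _ _ _ _ _), hB, zpow_neg,
      mul_inv_cancel_left₀ (zpow_ne_zero _ hw0)]
  have hRp : R / p ≠ 0 := div_ne_zero hR0 hp0
  have hex : ∀ c, ∃ i, (p : ℤ) ∣ a i - c ∨ (p : ℤ) ∣ a i + c := by
    intro c
    by_contra hno
    push Not at hno
    refine hRp ((hres c).symm.trans (Finset.sum_eq_zero fun i _ => ?_))
    rw [if_neg (hno i).1, if_neg (hno i).2, sub_zero, mul_zero]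
  obtain ⟨i, hi⟩ := hex 0
  replace hi : (p : ℤ) ∣ a i := by simpa using hi
  obtain ⟨j, hj⟩ := hex 1
  obtain ⟨k, hk⟩ := hex 2
  have hpi := Nat.prime_iff_prime_int.1 hp
  have hsum : (p : ℤ) ∣ ∑ i, a i := by
    have h1 : (p : ℤ) ∣ 2 * ∑ i, a i := dvd_trans (by exact_mod_cast hpM) h.dvd
    refine (hpi.dvd_or_dvd h1).resolve_left fun h2 => ?_
    have h3 : p ∣ 2 := by exact_mod_cast h2
    exact absurd (Nat.le_of_dvd two_pos h3) (by omega)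
  have d5 : ∀ m : ℕ, 0 < m → m < 5 → ¬ (p : ℤ) ∣ m := fun m h0 h5 hd =>
    absurd (Nat.le_of_dvd h0 (by exact_mod_cast hd)) (by omega)
  have hij : i ≠ j := by
    rintro rfl
    refine d5 1 one_pos (by norm_num) ?_
    rcases hj with hj | hj
    · simpa using dvd_sub hi hj
    · simpa using dvd_sub hj hi
  have hik : i ≠ k := by
    rintro rfl
    refine d5 2 two_pos (by norm_num) ?_
    rcases hk with hj | hj
    · simpa using dvd_sub hi hj
    · simpa using dvd_sub hj hi
  have hjk : j ≠ k := by
    rintro rfl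
    rcases hk with hk | hk <;> rcases hj with hj | hj
    · exact d5 1 one_pos (by norm_num) (by
        rw [show ((1 : ℕ) : ℤ) = a j - 1 - (a j - 2) by push_cast; ring]; exact dvd_sub hj hk)
    · exact d5 3 (by norm_num) (by norm_num) (by
        rw [show ((3 : ℕ) : ℤ) = a j + 1 - (a j - 2) by push_cast; ring]; exact dvd_sub hj hk)
    · exact d5 3 (by norm_num) (by norm_num) (by
        rw [show ((3 : ℕ) : ℤ) = a j + 2 - (a j - 1) by push_cast; ring]; exact dvd_sub hk hj)
    · exact d5 1 one_pos (by norm_num) (by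
        rw [show ((1 : ℕ) : ℤ) = a j + 2 - (a j + 1) by push_cast; ring]; exact dvd_sub hk hj)
  obtain ⟨l, hil, hjl, hkl, hu⟩ := exists_fin_four i j k hij hik hjk
  refine false_of_residueSum_const hp hp5 h.sign hyn hRp (by simp [hRc, neg_div]) hres hsum ?_ hu
    hij hik hil hjk hjl hkl hi hj hk
  have hz0 : ζ ≠ 0 := h.prim.ne_zero h.pos.ne'
  have hprod : ∏ i, y i = (ζ ^ (1 + j₀ * (M / p))) ^ (∑ i, a i) := by
    simp only [hy]
    simp only [Fin.prod_univ_four, Fin.sum_univ_four]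
    rw [zpow_add₀ (pow_ne_zero _ hz0), zpow_add₀ (pow_ne_zero _ hz0),
      zpow_add₀ (pow_ne_zero _ hz0)]
  -- Balance in multiplicative form: twice the exponent sum is a multiple of M, so the product of
  -- the `y i` has square 1.
  obtain ⟨d, hd⟩ := h.dvd
  rw [hprod, ← zpow_natCast, ← zpow_mul, mul_comm (∑ i, a i), Nat.cast_ofNat, hd, zpow_mul,
    zpow_natCast, ← pow_mul, mul_comm, pow_mul, h.prim.pow_eq_one, one_pow, one_zpow]

/-- The equation Im x⁶ = 0 factors as uv(4v² − 1)(4v² − 3) = 0 on the unit circle, and the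
hypotheses discard u = 0 and v = 0. -/
theorem im_eq_of_pow_twelve {x : ℂ} (hx : ‖x‖ = 1) (h : x ^ 12 = 1) (h0 : x.im ≠ 0)
    (h1 : x.im ^ 2 ≠ 1) : ∃ m n : ℤ, (m = 1 ∧ n = 0 ∨ m = -1 ∧ n = 0 ∨ m = 0 ∧ n = 1 ∨
      m = 0 ∧ n = -1) ∧ 2 * x.im = m + n * √3 := by
  have h3 : (√3 : ℝ) ^ 2 = 3 := Real.sq_sqrt (by norm_num)
  rw [← sq_eq_sq₀ (norm_nonneg _) zero_le_one, Complex.sq_norm, Complex.normSq_apply] at hx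
  have h6 : (x ^ 6) ^ 2 = 1 := by rw [← pow_mul]; exact h
  have h7 : (x ^ 6).im = 0 := by
    rcases eq_or_eq_neg_of_sq_eq_sq _ 1 (h6.trans (one_pow 2).symm) with h7 | h7 <;> simp [h7]
  obtain ⟨u, v⟩ := x
  simp only at hx h0 h1 ⊢
  have h8 : v * (u * ((4 * v ^ 2 - 1) * (4 * v ^ 2 - 3))) = 0 := by
    have h9 : ((⟨u, v⟩ : ℂ) ^ 6).im = 6 * u ^ 5 * v - 20 * u ^ 3 * v ^ 3 + 6 * u * v ^ 5 := by
      simp [pow_succ]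
      ring
    rw [h9] at h7
    have hu : u ^ 2 = 1 - v ^ 2 := by linear_combination hx
    linear_combination h7 / 2 + (-3 * u ^ 3 * v - 3 * u * v * (1 - v ^ 2) + 10 * u * v ^ 3) * hu
  have hu0 : u ≠ 0 := by
    rintro rfl
    exact h1 (by linear_combination hx)
  have h9 := (mul_eq_zero.1 ((mul_eq_zero.1 h8).resolve_left h0)).resolve_left hu0
  rcases mul_eq_zero.1 h9 with h10 | h10
  · have : (2 * v) ^ 2 = 1 ^ 2 := by linear_combination h10
    rcases sq_eq_sq_iff_eq_or_eq_neg.1 this with h11 | h11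
    · exact ⟨1, 0, by simp, by simpa using h11⟩
    · exact ⟨-1, 0, by simp, by simpa using h11⟩
  · have : (2 * v) ^ 2 = (√3) ^ 2 := by linear_combination h10 - h3
    rcases sq_eq_sq_iff_eq_or_eq_neg.1 this with h11 | h11
    · exact ⟨0, 1, by simp, by simpa using h11⟩
    · exact ⟨0, -1, by simp, by simpa using h11⟩

/-- As √3 is irrational, the coefficients of 1 and of √3 sum to zero separately. Four vectors from
±(1, 0), ±(0, 1) with sum zero include two opposite ones. -/
theorem SineRelation.pair_of_dvd_twelve (h : SineRelation M ζ η a) (hM : M ∣ 12)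
    (h1 : ∀ i, (ζ ^ a i).im ^ 2 ≠ 1) : HasCancellingPair ζ η a := by
  have hx : ∀ i, ∃ m n : ℤ, (m = 1 ∧ n = 0 ∨ m = -1 ∧ n = 0 ∨ m = 0 ∧ n = 1 ∨ m = 0 ∧ n = -1) ∧
      2 * ((η i : ℝ) * (ζ ^ a i).im) = m + n * √3 := by
    intro i
    have h12 : (ζ ^ a i) ^ 12 = 1 := by
      obtain ⟨d, hd⟩ := hM
      rw [hd, ← zpow_natCast, ← zpow_mul, mul_comm, zpow_mul]
      rw [zpow_natCast, pow_mul, h.prim.pow_eq_one, one_pow, one_zpow]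
    obtain ⟨m, n, hmn, he⟩ := im_eq_of_pow_twelve (h.norm_eq i) h12 (h.im_ne i) (h1 i)
    rcases h.sign i with hs | hs
    · exact ⟨m, n, hmn, by rw [hs]; simpa using he⟩
    · refine ⟨-m, -n, by omega, ?_⟩
      rw [hs]
      push_cast
      linear_combination -he
  choose m n hmn he using hx
  have hsum : ((∑ i, m i : ℤ) : ℝ) + (∑ i, n i : ℤ) * √3 = 0 := by
    push_cast
    rw [Finset.sum_mul, ← Finset.sum_add_distrib]
    simp_rw [← he]
    rw [← Finset.mul_sum, h.sum_im, mul_zero]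
  have hirr : Irrational √3 := Nat.Prime.irrational_sqrt (p := 3) (by norm_num)
  have hn : ∑ i, n i = 0 := by
    by_contra hn
    exact ((hirr.intCast_mul hn).intCast_add (∑ i, m i)).ne_zero hsum
  have hm : ∑ i, m i = 0 := by
    rw [hn] at hsum
    exact_mod_cast (by simpa using hsum : ((∑ i, m i : ℤ) : ℝ) = 0)
  suffices ∃ i j, i ≠ j ∧ m i + m j = 0 ∧ n i + n j = 0 by
    obtain ⟨i, j, hij, hmij, hnij⟩ := this
    refine ⟨i, j, hij, ?_⟩
    have e1 : (m i : ℝ) + m j = 0 := by exact_mod_cast hmij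
    have e2 : (n i : ℝ) + n j = 0 := by exact_mod_cast hnij
    linear_combination (he i) / 2 + (he j) / 2 + e1 / 2 + e2 * √3 / 2
  by_contra hno
  push Not at hno
  rw [Fin.sum_univ_four] at hm hn
  have a1 := hno 0 1 (by decide)
  have a2 := hno 0 2 (by decide)
  have a3 := hno 0 3 (by decide)
  have a4 := hno 1 2 (by decide)
  have a5 := hno 1 3 (by decide)
  have a6 := hno 2 3 (by decide)
  rcases hmn 0 with ⟨b1, b2⟩ | ⟨b1, b2⟩ | ⟨b1, b2⟩ | ⟨b1, b2⟩ <;>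
  rcases hmn 1 with ⟨c1, c2⟩ | ⟨c1, c2⟩ | ⟨c1, c2⟩ | ⟨c1, c2⟩ <;>
  rcases hmn 2 with ⟨d1, d2⟩ | ⟨d1, d2⟩ | ⟨d1, d2⟩ | ⟨d1, d2⟩ <;>
  · have := hmn 3
    omega

/-- A prime of M dividing all exponents is absorbed by replacing ζ with ζ^p, by induction on M.
Otherwise a pair results as soon as 8, an odd prime square, or a prime at least five divides M; when
none of them does, M ∣ 12. -/
theorem SineRelation.pair (M : ℕ) : ∀ {ζ : ℂ} {η a : Fin 4 → ℤ}, SineRelation M ζ η a →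
    (∀ i, (ζ ^ a i).im ^ 2 ≠ 1) → HasCancellingPair ζ η a := by
  induction M using Nat.strong_induction_on with
  | _ M ih =>
  intro ζ η a h h1
  by_cases hall : ∃ p, p.Prime ∧ p ∣ M ∧ ∀ i, (p : ℤ) ∣ a i
  · obtain ⟨p, hp, ⟨M', rfl⟩, hpa⟩ := hall
    choose b hb using hpa
    have hM' : 0 < M' := Nat.pos_of_mul_pos_left h.pos
    have hz : ∀ i, (ζ ^ p) ^ b i = ζ ^ a i := fun i => by
      rw [hb, zpow_mul, zpow_natCast]
    have h' : SineRelation M' (ζ ^ p) η b := by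
      refine ⟨h.prim.pow h.pos rfl, hM', h.sign, ?_, ?_, ?_⟩
      · have := h.dvd
        simp_rw [hb] at this
        rw [← Finset.mul_sum, ← mul_assoc, mul_comm 2, mul_assoc, Nat.cast_mul] at this
        exact Int.dvd_of_mul_dvd_mul_left (by exact_mod_cast hp.ne_zero) this
      · simpa only [hz] using h.im_ne
      · simpa only [hz] using h.sum_im
    have := ih M' (lt_mul_of_one_lt_left hM' hp.one_lt) h' (by simpa only [hz] using h1)
    simpa only [HasCancellingPair, hz] using this
  push Not at hall
  have h2 : 4 ∣ M → (∀ i, Odd (a i)) ∨ HasCancellingPair ζ η a := by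
    intro h4
    obtain ⟨j, hj⟩ := hall 2 Nat.prime_two (dvd_trans (by norm_num) h4)
    by_cases he : ∃ i, Even (a i)
    · obtain ⟨i, hi⟩ := he
      exact Or.inr (h.pair_of_four_dvd h4 hi
        (Int.not_even_iff_odd.1 fun h5 => hj (by exact_mod_cast even_iff_two_dvd.1 h5)))
    · push Not at he
      exact Or.inl fun i => Int.not_even_iff_odd.1 (he i)
  by_cases h8 : 8 ∣ M
  · rcases h2 (dvd_trans (by norm_num) h8) with h3 | h3
    · exact h.pair_of_eight_dvd h8 h3
    · exact h3
  by_cases h9 : ∃ p, p.Prime ∧ p ≠ 2 ∧ p ^ 2 ∣ M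
  · obtain ⟨p, hp, hp2, hpM⟩ := h9
    obtain ⟨i, hi⟩ := hall p hp (dvd_trans (dvd_pow_self _ two_ne_zero) hpM)
    exact h.pair_of_sq_dvd hp hp2 hpM hi
  push Not at h9
  by_cases h10 : ∃ p, p.Prime ∧ 5 ≤ p ∧ p ∣ M
  · obtain ⟨p, hp, hp5, hpM⟩ := h10
    obtain ⟨i, hi⟩ := hall p hp hpM
    exact h.pair_of_dvd hp hp5 hpM (h9 p hp (by omega)) hi
  push Not at h10
  refine h.pair_of_dvd_twelve ((Nat.dvd_iff_prime_pow_dvd_dvd 12 M).2 fun p k hp hk => ?_) h1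
  rcases Nat.eq_zero_or_pos k with rfl | hk0
  · simp
  have hpM : p ∣ M := dvd_trans (dvd_pow_self _ hk0.ne') hk
  have hp5 : p < 5 := lt_of_not_ge fun h5 => h10 p hp h5 hpM
  have hp2 := hp.two_le
  interval_cases p
  · have : k ≤ 2 := by
      by_contra hk3
      exact h8 (dvd_trans (pow_dvd_pow 2 (show 3 ≤ k by omega)) hk)
    exact dvd_trans (pow_dvd_pow 2 this) (by norm_num)
  · have : k ≤ 1 := by
      by_contra hk3
      exact h9 3 hp (by norm_num) (dvd_trans (pow_dvd_pow 3 (show 2 ≤ k by omega)) hk)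
    exact dvd_trans (pow_dvd_pow 3 this) (by norm_num)
  · norm_num at hp

end FPU

/-! ### Resonances of the lattice frequencies. -/

namespace FPU

/-- The mode number of a complex normal coordinate. -/
def modeIndex {n : ℕ} (c : Fin n ⊕ Fin n) : Fin n := Sum.elim id id c

/-- The signed frequency of a complex normal coordinate. -/
noncomputable def signedFrequency {n : ℕ} (c : Fin n ⊕ Fin n) : ℝ :=
  Sum.elim (fun i => -frequency n i) (fun i => frequency n i) c

variable {n : ℕ}

theorem angle_mem (i : Fin n) : 0 < ((i : ℝ) + 1) * Real.pi / (2 * n + 2) ∧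
    ((i : ℝ) + 1) * Real.pi / (2 * n + 2) < Real.pi / 2 := by
  have h1 : (i : ℝ) + 1 ≤ n := by exact_mod_cast i.2
  have h2 := Real.pi_pos
  have h3 : (0 : ℝ) < 2 * n + 2 := by positivity
  refine ⟨by positivity, ?_⟩
  rw [div_lt_iff₀ h3]
  nlinarith

theorem frequency_pos (i : Fin n) : 0 < frequency n i := by
  obtain ⟨h1, h2⟩ := angle_mem i
  exact mul_pos two_pos (Real.sin_pos_of_pos_of_lt_pi h1 (by linarith [Real.pi_pos]))

theorem frequency_lt (i : Fin n) : frequency n i < 2 := by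
  obtain ⟨h1, h2⟩ := angle_mem i
  have := Real.sin_lt_sin_of_lt_of_le_pi_div_two (by linarith) le_rfl h2
  rw [Real.sin_pi_div_two] at this
  rw [frequency]
  linarith

theorem frequency_injective : Function.Injective (frequency n) := by
  intro i j h
  obtain ⟨h1, h2⟩ := angle_mem i
  obtain ⟨h3, h4⟩ := angle_mem j
  have h5 := Real.injOn_sin ⟨by linarith, h2.le⟩ ⟨by linarith, h4.le⟩ (mul_left_cancel₀ two_ne_zero h)
  have h6 : (2 * (n : ℝ) + 2) ≠ 0 := by positivity
  have h7 := Real.pi_ne_zero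
  field_simp at h5
  exact Fin.ext (by exact_mod_cast add_right_cancel h5)

theorem signedFrequency_add_eq_zero {c d : Fin n ⊕ Fin n}
    (h : signedFrequency c + signedFrequency d = 0) : d = c.swap := by
  rcases c with i | i <;> rcases d with j | j <;> simp only [signedFrequency, Sum.elim_inl,
    Sum.elim_inr, Sum.swap_inl, Sum.swap_inr, Sum.inr.injEq, Sum.inl.injEq, reduceCtorEq] at h ⊢
  · linarith [frequency_pos i, frequency_pos j]
  · exact (frequency_injective (by linarith)).symm
  · exact (frequency_injective (by linarith)).symm
  · linarith [frequency_pos i, frequency_pos j]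

theorem exists_signedFrequency_eq (c : Fin n ⊕ Fin n) :
    ∃ s : ℤ, (s = 1 ∨ s = -1) ∧ signedFrequency c = s * frequency n (modeIndex c) := by
  rcases c with i | i
  · exact ⟨-1, by simp, by simp [signedFrequency, modeIndex]⟩
  · exact ⟨1, by simp, by simp [signedFrequency, modeIndex]⟩

/-- The sum of the signed wave numbers is divisible by `2 n + 2`. -/
def WaveBalanced (m : Multiset ((Fin n ⊕ Fin n) × ℤˣ)) : Prop :=
  (2 * n + 2 : ℤ) ∣ (m.map fun x => (x.2 : ℤ) * ((modeIndex x.1 : ℕ) + 1)).sum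

/-- With ζ = exp(2πi/(4n + 4)), Ω_k / 2 is the imaginary part of ζ^k. The balancing signs are put
into the exponents and undone in η. The factor two in `SineRelation.dvd` bridges 2n + 2 and the
order 4n + 4. -/
theorem exists_pair_of_resonance {x : Fin 4 → (Fin n ⊕ Fin n) × ℤˣ}
    (hx : (2 * n + 2 : ℤ) ∣ ∑ i, ((x i).2 : ℤ) * ((modeIndex (x i).1 : ℕ) + 1))
    (h : ∑ i, signedFrequency (x i).1 = 0) :
    ∃ i j, i ≠ j ∧ signedFrequency (x i).1 + signedFrequency (x j).1 = 0 := by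
  choose s hs hs' using fun i => exists_signedFrequency_eq (x i).1
  have hM : (4 * n + 4) ≠ 0 := by omega
  have hu : ∀ i, ((x i).2 : ℤ) = 1 ∨ ((x i).2 : ℤ) = -1 := fun i => by
    rcases Int.units_eq_one_or (x i).2 with h1 | h1 <;> simp [h1]
  have him : ∀ i, (Complex.exp (2 * Real.pi * Complex.I / (4 * n + 4 : ℕ)) ^
      (((x i).2 : ℤ) * ((modeIndex (x i).1 : ℕ) + 1))).im =
      ((x i).2 : ℤ) * (frequency n (modeIndex (x i).1) / 2) := by
    intro i
    rw [← Complex.exp_int_mul]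
    rw [show (((((x i).2 : ℤ) * ((modeIndex (x i).1 : ℕ) + 1) : ℤ) : ℂ) *
      (2 * Real.pi * Complex.I / (4 * n + 4 : ℕ))) = ((((x i).2 : ℤ) *
        (((modeIndex (x i).1 : ℕ) + 1) * Real.pi / (2 * n + 2)) : ℝ) : ℂ) * Complex.I by
      have h2 : (2 * (n : ℂ) + 2) ≠ 0 := by exact_mod_cast (by omega : 2 * n + 2 ≠ 0)
      have h3 : (4 * (n : ℂ) + 4) ≠ 0 := by exact_mod_cast hM
      push_cast
      field_simp
      norm_num]
    rw [Complex.exp_ofReal_mul_I_im, frequency]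
    rcases hu i with h1 | h1 <;> rw [h1] <;> simp
  have hrel : SineRelation (4 * n + 4) (Complex.exp (2 * Real.pi * Complex.I / (4 * n + 4 : ℕ)))
      (fun i => s i * (x i).2) (fun i => ((x i).2 : ℤ) * ((modeIndex (x i).1 : ℕ) + 1)) := by
    have hsum : ∀ i, ((s i * (x i).2 : ℤ) : ℝ) * (((x i).2 : ℤ) *
        (frequency n (modeIndex (x i).1) / 2)) = signedFrequency (x i).1 / 2 := by
      intro i
      rw [hs']
      push_cast
      rcases hu i with h1 | h1 <;> simp only [h1] <;> push_cast <;> ring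
    refine ⟨Complex.isPrimitiveRoot_exp _ hM, by omega, fun i => ?_, ?_, fun i => ?_, ?_⟩
    · rcases hu i with h1 | h1 <;> rcases hs i with h2 | h2 <;> rw [h1, h2] <;> simp
    · have := mul_dvd_mul_left 2 hx
      push_cast
      rwa [show (4 * n + 4 : ℤ) = 2 * (2 * n + 2) by ring]
    · rw [him]
      have := frequency_pos (modeIndex (x i).1)
      rcases hu i with h1 | h1 <;> rw [h1] <;> simp [this.ne']
    · simp_rw [him, hsum]
      rw [← Finset.sum_div, h, zero_div]
  obtain ⟨i, j, hij, hp⟩ := SineRelation.pair _ hrel fun i => by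
    rw [him]
    have h1 := frequency_pos (modeIndex (x i).1)
    have h2 := frequency_lt (modeIndex (x i).1)
    have h3 : (((x i).2 : ℤ) : ℝ) ^ 2 = 1 := by
      rcases hu i with h1 | h1 <;> rw [h1] <;> simp
    rw [mul_pow, h3]
    nlinarith
  refine ⟨i, j, hij, ?_⟩
  rw [him, him] at hp
  rw [hs', hs']
  push_cast at hp
  rcases hu i with h1 | h1 <;> rcases hu j with h2 | h2 <;> simp only [h1, h2] at hp <;>
    push_cast at hp <;> linear_combination 2 * hp

theorem exists_eq_map_univ {α : Type*} {r : ℕ} (m : Multiset α) (h : m.card = r) :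
    ∃ x : Fin r → α, m = Finset.univ.val.map x := by
  obtain ⟨l, rfl⟩ : ∃ l : List α, (l : Multiset α) = m := Quot.exists_rep m
  subst h
  have h1 : (Finset.univ : Finset (Fin l.length)).val.map l.get = l := by
    rw [Fin.univ_val_map, List.ofFn_get]
  exact ⟨l.get, h1.symm⟩

/-- In a balanced quartic resonance every complex coordinate occurs as often as its conjugate. -/
theorem WaveBalanced.count_eq {m : Multiset ((Fin n ⊕ Fin n) × ℤˣ)} (hm : WaveBalanced m)
    (hc : m.card = 4) (h : (m.map fun x => signedFrequency x.1).sum = 0) (k : Fin n) :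
    (m.map Prod.fst).count (Sum.inl k) = (m.map Prod.fst).count (Sum.inr k) := by
  obtain ⟨x, rfl⟩ := exists_eq_map_univ m hc
  rw [WaveBalanced, Multiset.map_map] at hm
  rw [Multiset.map_map] at h
  obtain ⟨i, j, hij, hp⟩ := exists_pair_of_resonance hm h
  obtain ⟨k', hk'⟩ : ∃ k', i ≠ k' ∧ j ≠ k' := by
    have : ∀ i j : Fin 4, ∃ k', i ≠ k' ∧ j ≠ k' := by decide
    exact this i j
  obtain ⟨l, hil, hjl, hkl, hu⟩ := exists_fin_four i j k' hij hk'.1 hk'.2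
  have hval : (Finset.univ : Finset (Fin 4)).val = i ::ₘ j ::ₘ k' ::ₘ {l} := by
    rw [hu, Finset.insert_val_of_notMem (by simp [*]), Finset.insert_val_of_notMem (by simp [*]),
      Finset.insert_val_of_notMem (by simp [*]), Finset.singleton_val]
  rw [hval] at h ⊢
  simp only [Function.comp_def, Multiset.map_cons, Multiset.map_singleton, Multiset.sum_cons,
    Multiset.sum_singleton] at h ⊢
  -- Once one pair cancels, the remaining two frequencies cancel as well, so the four coordinates
  -- form two conjugate pairs.
  rw [signedFrequency_add_eq_zero hp, signedFrequency_add_eq_zero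
    (show signedFrequency (x k').1 + signedFrequency (x l).1 = 0 by linarith)]
  rcases (x i).1 with a | a <;> rcases (x k').1 with b | b <;>
    simp only [Multiset.count_cons, Multiset.count_singleton, Sum.swap_inl, Sum.swap_inr,
      Sum.inl.injEq, Sum.inr.injEq, reduceCtorEq, if_false] <;> omega

/-- The relation gives sin z = |sin(x ± y)|. The addition formula bounds this strictly by sin x +
sin y because both cosines lie strictly between 0 and 1. -/
theorem sin_lt_sin_add_sin {x y z : ℝ} (hx : 0 < x) (hx' : x < Real.pi / 2) (hy : 0 < y)
    (hy' : y < Real.pi / 2) (hz : 0 < z) (hz' : z < Real.pi / 2) {a b c : ℤˣ} {m : ℤ}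
    (h : ((a : ℤ) : ℝ) * x + ((b : ℤ) : ℝ) * y + ((c : ℤ) : ℝ) * z = m * Real.pi) :
    Real.sin z < Real.sin x + Real.sin y := by
  have h1 := Real.sin_pos_of_pos_of_lt_pi hx (by linarith)
  have h2 := Real.sin_pos_of_pos_of_lt_pi hy (by linarith)
  have h3 := Real.sin_pos_of_pos_of_lt_pi hz (by linarith)
  have hcx := Real.cos_pos_of_mem_Ioo ⟨by linarith, hx'⟩
  have hcy := Real.cos_pos_of_mem_Ioo ⟨by linarith, hy'⟩
  have hcx' : Real.cos x < 1 := by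
    nlinarith [Real.sin_sq_add_cos_sq x]
  have hcy' : Real.cos y < 1 := by
    nlinarith [Real.sin_sq_add_cos_sq y]
  have key : |Real.sin z| = |Real.sin (((a : ℤ) : ℝ) * x + ((b : ℤ) : ℝ) * y)| := by
    rw [show ((a : ℤ) : ℝ) * x + ((b : ℤ) : ℝ) * y = m * Real.pi - ((c : ℤ) : ℝ) * z by
      linear_combination h, Real.sin_int_mul_pi_sub, abs_neg, abs_mul]
    rcases Int.units_eq_one_or c with rfl | rfl <;>
      simp [abs_zpow]
  rw [abs_of_pos h3] at key
  rw [key, abs_lt]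
  rcases Int.units_eq_one_or a with rfl | rfl <;> rcases Int.units_eq_one_or b with rfl | rfl <;>
    simp only [Units.val_one, Units.val_neg, Int.cast_one, Int.cast_neg, neg_mul, one_mul,
      Real.sin_add, Real.sin_neg, Real.cos_neg] <;> constructor <;> nlinarith

/-- There are no balanced cubic resonances. -/
theorem WaveBalanced.sum_ne_zero {m : Multiset ((Fin n ⊕ Fin n) × ℤˣ)} (hm : WaveBalanced m)
    (hc : m.card = 3) : (m.map fun x => signedFrequency x.1).sum ≠ 0 := by
  obtain ⟨x, rfl⟩ := exists_eq_map_univ m hc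
  rw [WaveBalanced, Multiset.map_map] at hm
  rw [Multiset.map_map]
  change _ ∣ ∑ i, ((x i).2 : ℤ) * ((modeIndex (x i).1 : ℕ) + 1) at hm
  change ∑ i, signedFrequency (x i).1 ≠ 0
  obtain ⟨d, hd⟩ := hm
  rw [Fin.sum_univ_three] at hd ⊢
  choose s hs hs' using fun i => exists_signedFrequency_eq (x i).1
  have ha := fun i => angle_mem (modeIndex (x i).1)
  have hf : ∀ i, signedFrequency (x i).1 = s i * (2 * Real.sin
    (((modeIndex (x i).1 : ℝ) + 1) * Real.pi / (2 * n + 2))) := hs'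
  have hd' : ((((x 0).2 : ℤ) : ℝ) * (((modeIndex (x 0).1 : ℝ) + 1) * Real.pi / (2 * n + 2)) +
      (((x 1).2 : ℤ) : ℝ) * (((modeIndex (x 1).1 : ℝ) + 1) * Real.pi / (2 * n + 2))) +
      (((x 2).2 : ℤ) : ℝ) * (((modeIndex (x 2).1 : ℝ) + 1) * Real.pi / (2 * n + 2)) =
      d * Real.pi := by
    have h2 := congrArg (Int.cast (R := ℝ)) hd
    push_cast at h2
    field_simp
    linear_combination h2
  rw [hf, hf, hf]
  have ha0 := ha 0
  have ha1 := ha 1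
  have ha2 := ha 2
  clear ha hf hs'
  generalize (((modeIndex (x 1).1 : ℝ) + 1) * Real.pi / (2 * n + 2)) = t₁ at *
  generalize (((modeIndex (x 2).1 : ℝ) + 1) * Real.pi / (2 * n + 2)) = t₂ at *
  generalize (((modeIndex (x 0).1 : ℝ) + 1) * Real.pi / (2 * n + 2)) = t₀ at *
  -- Balance is symmetric in the three angles, so each sine is smaller than the sum of the other two
  -- and no choice of signs gives zero.
  have h1 := sin_lt_sin_add_sin ha0.1 ha0.2 ha1.1 ha1.2 ha2.1 ha2.2 hd'
  have h2 := sin_lt_sin_add_sin (a := (x 1).2) (b := (x 2).2) (c := (x 0).2) ha1.1 ha1.2 ha2.1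
    ha2.2 ha0.1 ha0.2 (by rw [← hd']; ring : _ = (d : ℝ) * Real.pi)
  have h3 := sin_lt_sin_add_sin (a := (x 2).2) (b := (x 0).2) (c := (x 1).2) ha2.1 ha2.2 ha0.1
    ha0.2 ha1.1 ha1.2 (by rw [← hd']; ring : _ = (d : ℝ) * Real.pi)
  intro h
  rcases hs 0 with e0 | e0 <;> rcases hs 1 with e1 | e1 <;> rcases hs 2 with e2 | e2 <;>
    rw [e0, e1, e2] at h <;> push_cast at h <;> linarith


/-! ### Trigonometric lattice sums and the selection rule. -/

theorem two_mul_sin_mul_sum_cos_odd (x : ℝ) (m : ℕ) :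
    2 * Real.sin x * ∑ j ∈ Finset.range m, Real.cos ((2 * j + 1) * x) = Real.sin (2 * m * x) := by
  induction m with
  | zero => simp
  | succ m ih =>
    rw [Finset.sum_range_succ, mul_add, ih, show (2 : ℝ) * (m + 1 : ℕ) * x = (2 * m + 1) * x + x by
      push_cast; ring, show (2 : ℝ) * m * x = (2 * m + 1) * x - x by ring, Real.sin_add,
      Real.sin_sub]
    ring

theorem two_mul_sin_mul_sum_cos_even (x : ℝ) (m : ℕ) :
    2 * Real.sin x * ∑ j ∈ Finset.range (m + 1), Real.cos (2 * j * x) =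
      Real.sin ((2 * m + 1) * x) + Real.sin x := by
  induction m with
  | zero => simp; ring
  | succ m ih =>
    rw [Finset.sum_range_succ, mul_add, ih,
      show (2 * (m + 1 : ℕ) + 1) * x = 2 * (m + 1 : ℕ) * x + x by ring,
      show (2 * m + 1) * x = 2 * (m + 1 : ℕ) * x - x by push_cast; ring, Real.sin_add,
      Real.sin_sub]
    ring

theorem sin_ne_zero_of_not_dvd {K : ℤ} (hK : ¬ (2 * n + 2 : ℤ) ∣ K) :
    Real.sin (K * (Real.pi / (2 * n + 2))) ≠ 0 := by
  intro h
  obtain ⟨m, hm⟩ := Real.sin_eq_zero_iff.1 h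
  refine hK ⟨m, ?_⟩
  have h1 := Real.pi_ne_zero
  have h2 : (2 * (n : ℝ) + 2) ≠ 0 := by positivity
  field_simp at hm
  have : (((2 * n + 2) * m : ℤ) : ℝ) = K := by push_cast; linarith
  exact_mod_cast this.symm

theorem sum_cos_odd_eq_zero {K : ℤ} (hK : ¬ (2 * n + 2 : ℤ) ∣ K) :
    ∑ j ∈ Finset.range (n + 1), Real.cos ((2 * j + 1) * (K * (Real.pi / (2 * n + 2)))) = 0 := by
  have h1 := two_mul_sin_mul_sum_cos_odd (K * (Real.pi / (2 * n + 2))) (n + 1)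
  have h2 : (2 * (n : ℝ) + 2) ≠ 0 := by positivity
  rw [show 2 * ((n + 1 : ℕ) : ℝ) * (K * (Real.pi / (2 * n + 2))) = K * Real.pi by
    push_cast; field_simp, Real.sin_int_mul_pi] at h1
  exact (mul_eq_zero.1 h1).resolve_left (mul_ne_zero two_ne_zero (sin_ne_zero_of_not_dvd hK))

/-- The value depends only on the parity of K; this suffices for the sine modes, whose sums and
differences of wave numbers have equal parity. -/
theorem sum_cos_even_of_even {K : ℤ} (hK : ¬ (2 * n + 2 : ℤ) ∣ K) :
    ∑ j ∈ Finset.range (n + 1), Real.cos (2 * j * (K * (Real.pi / (2 * n + 2)))) =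
      (1 - (-1) ^ K) / 2 := by
  have h1 := two_mul_sin_mul_sum_cos_even (K * (Real.pi / (2 * n + 2))) n
  have h2 : (2 * (n : ℝ) + 2) ≠ 0 := by positivity
  rw [show (2 * (n : ℝ) + 1) * (K * (Real.pi / (2 * n + 2))) =
    K * Real.pi - K * (Real.pi / (2 * n + 2)) by field_simp; ring, Real.sin_int_mul_pi_sub] at h1
  have h3 := sin_ne_zero_of_not_dvd hK
  refine mul_left_cancel₀ (mul_ne_zero two_ne_zero h3) (h1.trans ?_)
  ring

/-- Selection rule: a product of bond modes has nonzero sum over the lattice only if the wave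
numbers can be balanced. -/
theorem exists_waveBalanced (s : Multiset (Fin n ⊕ Fin n)) (K : ℤ)
    (h : ∑ j ∈ Finset.range (n + 1), Real.cos ((2 * j + 1) * (K * (Real.pi / (2 * n + 2)))) *
      (s.map fun c => Real.cos ((2 * j + 1) * (((modeIndex c : ℕ) + 1) *
        (Real.pi / (2 * n + 2))))).prod ≠ 0) :
    ∃ m : Multiset ((Fin n ⊕ Fin n) × ℤˣ), m.map Prod.fst = s ∧
      (2 * n + 2 : ℤ) ∣ K + (m.map fun x => (x.2 : ℤ) * ((modeIndex x.1 : ℕ) + 1)).sum := by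
  induction s using Multiset.induction_on generalizing K with
  | empty =>
    refine ⟨0, rfl, ?_⟩
    by_contra hK
    exact h (by simpa using sum_cos_odd_eq_zero (by simpa using hK))
  | cons c s ih =>
    -- Product-to-sum: the sum for `c ::ₘ s` is the mean of the sums for K + k and K − k, k being
    -- the wave number of c, so one of the two is nonzero.
    by_cases h1 : ∑ j ∈ Finset.range (n + 1), Real.cos ((2 * j + 1) *
        ((K + ((modeIndex c : ℕ) + 1) : ℤ) * (Real.pi / (2 * n + 2)))) *
        (s.map fun c => Real.cos ((2 * j + 1) * (((modeIndex c : ℕ) + 1) *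
          (Real.pi / (2 * n + 2))))).prod = 0
    · obtain ⟨m, hm, hd⟩ := ih (K - ((modeIndex c : ℕ) + 1)) (by
        intro h2
        apply h
        have h3 := congrArg₂ (fun a b => (a + b) / 2) h1 h2
        simp only [add_zero, zero_div] at h3
        rw [← h3, ← Finset.sum_add_distrib, Finset.sum_div]
        refine Finset.sum_congr rfl fun j _ => ?_
        rw [Multiset.map_cons, Multiset.prod_cons]
        push_cast
        rw [add_mul (K : ℝ), sub_mul (K : ℝ), mul_add (2 * (j : ℝ) + 1), mul_sub (2 * (j : ℝ) + 1),
          Real.cos_add, Real.cos_sub]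
        ring)
      refine ⟨(c, -1) ::ₘ m, by simp [hm], ?_⟩
      convert hd using 1
      simp
      ring
    · obtain ⟨m, hm, hd⟩ := ih _ h1
      refine ⟨(c, 1) ::ₘ m, by simp [hm], ?_⟩
      convert hd using 1
      simp
      ring

/-! ### The Hamiltonian in Fourier modes. -/

/-- The coefficients of the bond variables `q_{j+1} - q_j` in the normalized normal modes. -/
noncomputable def cosCoeff (n : ℕ) (j : ℕ) (i : Fin n) : ℝ :=
  √(2 / ((n : ℝ) + 1)) * Real.cos ((2 * j + 1) * (((i : ℕ) + 1) * (Real.pi / (2 * n + 2))))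

theorem sq_sqrt_two_div : √(2 / ((n : ℝ) + 1)) * √(2 / ((n : ℝ) + 1)) = 2 / (n + 1) :=
  Real.mul_self_sqrt (by positivity)

theorem sum_cosCoeff_mul (i i' : Fin n) :
    ∑ j ∈ Finset.range (n + 1), cosCoeff n j i * cosCoeff n j i' = if i = i' then 1 else 0 := by
  have hn : ((n : ℝ) + 1) ≠ 0 := by positivity
  have h1 : ∀ j : ℕ, cosCoeff n j i * cosCoeff n j i' = (1 / (n + 1)) *
      (Real.cos ((2 * j + 1) * (((i + i' + 2 : ℕ) : ℤ) * (Real.pi / (2 * n + 2)))) +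
       Real.cos ((2 * j + 1) * (((i - i' : ℤ)) * (Real.pi / (2 * n + 2))))) := by
    intro j
    rw [cosCoeff, cosCoeff]
    push_cast
    rw [show (2 * (j : ℝ) + 1) * ((i + i' + 2) * (Real.pi / (2 * n + 2))) =
      (2 * j + 1) * ((i + 1) * (Real.pi / (2 * n + 2))) + (2 * j + 1) * ((i' + 1) *
        (Real.pi / (2 * n + 2))) by ring, show (2 * (j : ℝ) + 1) * ((i - i') *
        (Real.pi / (2 * n + 2))) = (2 * j + 1) * ((i + 1) * (Real.pi / (2 * n + 2))) -
        (2 * j + 1) * ((i' + 1) * (Real.pi / (2 * n + 2))) by ring, Real.cos_add, Real.cos_sub]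
    have h2 := @sq_sqrt_two_div n
    generalize √(2 / ((n : ℝ) + 1)) = r at *
    generalize Real.cos _ = a
    generalize Real.cos _ = b
    rw [show r * a * (r * b) = (r * r) * (a * b) by ring, h2]
    ring
  simp_rw [h1]
  rw [← Finset.mul_sum, Finset.sum_add_distrib, sum_cos_odd_eq_zero, zero_add]
  · split_ifs with hii
    · subst hii
      simp [hn]
    · rw [sum_cos_odd_eq_zero, mul_zero]
      intro hd
      have hne : (i : ℤ) - i' ≠ 0 := by
        intro h0
        exact hii (Fin.ext (by omega))
      have := Int.le_of_dvd (abs_pos.2 hne) ((dvd_abs _ _).2 hd)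
      have : |(i : ℤ) - i'| < n := abs_lt.2 ⟨by omega, by omega⟩
      omega
  · intro hd
    have := Int.le_of_dvd (by positivity) hd
    omega

theorem sum_sineCoeff_mul (i i' : Fin n) :
    ∑ l, sineCoeff n i l * sineCoeff n i' l = if i = i' then 1 else 0 := by
  have hn : ((n : ℝ) + 1) ≠ 0 := by positivity
  have hn2 : (2 * (n : ℝ) + 2) ≠ 0 := by positivity
  have h1 : ∀ l : ℕ, √(2 / ((n : ℝ) + 1)) *
      Real.sin ((l : ℝ) * ((i : ℝ) + 1) * Real.pi / ((n : ℝ) + 1)) * (√(2 / ((n : ℝ) + 1)) *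
      Real.sin ((l : ℝ) * ((i' : ℝ) + 1) * Real.pi / ((n : ℝ) + 1))) = (1 / (n + 1)) *
      (Real.cos (2 * l * (((i - i' : ℤ)) * (Real.pi / (2 * n + 2)))) -
        Real.cos (2 * l * (((i + i' + 2 : ℕ) : ℤ) * (Real.pi / (2 * n + 2))))) := by
    intro l
    push_cast
    rw [show 2 * (l : ℝ) * ((i + i' + 2) * (Real.pi / (2 * n + 2))) =
      (l : ℝ) * ((i : ℝ) + 1) * Real.pi / ((n : ℝ) + 1) +
      (l : ℝ) * ((i' : ℝ) + 1) * Real.pi / ((n : ℝ) + 1) by field_simp; ring,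
      show 2 * (l : ℝ) * ((i - i') * (Real.pi / (2 * n + 2))) =
      (l : ℝ) * ((i : ℝ) + 1) * Real.pi / ((n : ℝ) + 1) -
      (l : ℝ) * ((i' : ℝ) + 1) * Real.pi / ((n : ℝ) + 1) by field_simp; ring,
      Real.cos_add, Real.cos_sub]
    have h2 := @sq_sqrt_two_div n
    generalize √(2 / ((n : ℝ) + 1)) = r at *
    generalize Real.sin _ = a
    generalize Real.sin _ = b
    rw [show r * a * (r * b) = (r * r) * (a * b) by ring, h2]
    ring
  -- The sine vanishes at the endpoint of index 0; adding that site completes the range to n + 1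
  -- terms.
  have h2 : ∑ l, sineCoeff n i l * sineCoeff n i' l = ∑ l ∈ Finset.range (n + 1),
      √(2 / ((n : ℝ) + 1)) * Real.sin ((l : ℝ) * ((i : ℝ) + 1) * Real.pi / ((n : ℝ) + 1)) *
      (√(2 / ((n : ℝ) + 1)) *
        Real.sin ((l : ℝ) * ((i' : ℝ) + 1) * Real.pi / ((n : ℝ) + 1))) := by
    rw [Finset.sum_range_succ', ← Fin.sum_univ_eq_sum_range]
    simp [sineCoeff]
  rw [h2]
  simp_rw [h1]
  have hnd : ¬ (2 * n + 2 : ℤ) ∣ ((i + i' + 2 : ℕ) : ℤ) := by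
    intro hd
    have := Int.le_of_dvd (by positivity) hd
    omega
  rw [← Finset.mul_sum, Finset.sum_sub_distrib, sum_cos_even_of_even hnd]
  split_ifs with hii
  · subst hii
    rw [Even.neg_one_zpow ⟨i + 1, by push_cast; ring⟩]
    simp [hn]
  · rw [sum_cos_even_of_even]
    · have : ((-1 : ℝ)) ^ ((i + i' + 2 : ℕ) : ℤ) = (-1) ^ ((i : ℤ) - i') := by
        rw [show ((i + i' + 2 : ℕ) : ℤ) = ((i : ℤ) - i') + 2 * (i' + 1) by push_cast; ring,
          zpow_add₀ (by norm_num), Even.neg_one_zpow (n := 2 * _) ⟨i' + 1, by ring⟩, mul_one]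
      rw [this]
      ring
    · intro hd
      have hne : (i : ℤ) - i' ≠ 0 := by
        intro h0
        exact hii (Fin.ext (by omega))
      have := Int.le_of_dvd (abs_pos.2 hne) ((dvd_abs _ _).2 hd)
      have : |(i : ℤ) - i'| < n := abs_lt.2 ⟨by omega, by omega⟩
      omega

theorem sineCoeff_comm (i i' : Fin n) : sineCoeff n i i' = sineCoeff n i' i := by
  rw [sineCoeff, sineCoeff]
  ring_nf

theorem sum_sineCoeff_mul' (l l' : Fin n) :
    ∑ i, sineCoeff n i l * sineCoeff n i l' = if l = l' then 1 else 0 := by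
  rw [← sum_sineCoeff_mul l l']
  simp_rw [sineCoeff_comm]

theorem sum_sineCoeff_mul_modePosition (l : Fin n) :
    ∑ i, C (sineCoeff n i l) * modePosition n i = X (Sum.inl l) := by
  simp_rw [modePosition, Finset.mul_sum, ← mul_assoc, ← C_mul]
  rw [Finset.sum_comm]
  simp_rw [← Finset.sum_mul, ← map_sum, sum_sineCoeff_mul']
  simp

theorem sum_sineCoeff_mul_modeMomentum (l : Fin n) :
    ∑ i, C (sineCoeff n i l) * modeMomentum n i = X (Sum.inr l) := by
  simp_rw [modeMomentum, Finset.mul_sum, ← mul_assoc, ← C_mul]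
  rw [Finset.sum_comm]
  simp_rw [← Finset.sum_mul, ← map_sum, sum_sineCoeff_mul']
  simp

/-- The sine modes vanish at 0 and n + 1, so the expansion of the moving particles also covers the
two fixed endpoints. -/
theorem position_eq_sum {j : ℕ} (hj : j ≤ n + 1) : position n j =
    ∑ i : Fin n, C (√(2 / ((n : ℝ) + 1)) *
      Real.sin ((j : ℝ) * ((i : ℝ) + 1) * Real.pi / ((n : ℝ) + 1))) * modePosition n i := by
  have hn : ((n : ℝ) + 1) ≠ 0 := by positivity
  rw [position]
  split_ifs with h
  · rw [← sum_sineCoeff_mul_modePosition]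
    refine Finset.sum_congr rfl fun i _ => ?_
    have h1 : sineCoeff n i ⟨j - 1, by omega⟩ = √(2 / ((n : ℝ) + 1)) *
        Real.sin ((j : ℝ) * ((i : ℝ) + 1) * Real.pi / ((n : ℝ) + 1)) := by
      rw [sineCoeff, Fin.val_mk, Nat.cast_sub h.1, Nat.cast_one, sub_add_cancel]
    rw [h1]
  · refine (Finset.sum_eq_zero fun i _ => ?_).symm
    rcases (show j = 0 ∨ j = n + 1 by omega) with rfl | rfl
    · simp
    · rw [show ((n + 1 : ℕ) : ℝ) * ((i : ℝ) + 1) * Real.pi / ((n : ℝ) + 1) =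
        ((i + 1 : ℕ) : ℝ) * Real.pi by push_cast; field_simp, Real.sin_nat_mul_pi]
      simp

/-- From sin(θ + φ) − sin(θ − φ) = 2 sin φ cos θ, with φ half the angular step of the mode: the
factor 2 sin φ is the frequency, and the cosine is taken at the midpoint of the bond. -/
theorem bond_eq_sum {j : ℕ} (hj : j < n + 1) : position n (j + 1) - position n j =
    ∑ i, C (frequency n i * cosCoeff n j i) * modePosition n i := by
  rw [position_eq_sum (by omega), position_eq_sum (by omega), ← Finset.sum_sub_distrib]
  refine Finset.sum_congr rfl fun i _ => ?_
  rw [← sub_mul, ← C_sub]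
  congr 2
  have hn : ((n : ℝ) + 1) ≠ 0 := by positivity
  have hn2 : (2 * (n : ℝ) + 2) ≠ 0 := by positivity
  rw [frequency, cosCoeff]
  rw [show ((j + 1 : ℕ) : ℝ) * ((i : ℝ) + 1) * Real.pi / ((n : ℝ) + 1) =
    (2 * j + 1) * (((i : ℕ) + 1) * (Real.pi / (2 * n + 2))) +
      ((i : ℝ) + 1) * Real.pi / (2 * n + 2) by push_cast; field_simp; ring,
    show (j : ℝ) * ((i : ℝ) + 1) * Real.pi / ((n : ℝ) + 1) =
    (2 * j + 1) * (((i : ℕ) + 1) * (Real.pi / (2 * n + 2))) -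
      ((i : ℝ) + 1) * Real.pi / (2 * n + 2) by field_simp; ring, Real.sin_add, Real.sin_sub]
  ring

theorem sum_momentum_sq : ∑ i : Fin n, (X (Sum.inr i) : Poly n) ^ 2 =
    ∑ i, modeMomentum n i ^ 2 := by
  simp_rw [← sum_sineCoeff_mul_modeMomentum, sq, Finset.sum_mul_sum]
  rw [Finset.sum_comm]
  refine Finset.sum_congr rfl fun i _ => ?_
  rw [Finset.sum_comm]
  have : ∀ j, ∑ l, C (sineCoeff n i l) * modeMomentum n i * (C (sineCoeff n j l) *
      modeMomentum n j) = C (if i = j then 1 else 0) * (modeMomentum n i * modeMomentum n j) := by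
    intro j
    rw [← sum_sineCoeff_mul, map_sum, Finset.sum_mul]
    refine Finset.sum_congr rfl fun l _ => ?_
    rw [C_mul]
    ring
  simp_rw [this]
  simp

theorem sum_bond_sq : ∑ j ∈ Finset.range (n + 1), (position n (j + 1) - position n j) ^ 2 =
    ∑ i, C (frequency n i ^ 2) * modePosition n i ^ 2 := by
  rw [Finset.sum_congr rfl fun j hj => by rw [bond_eq_sum (Finset.mem_range.1 hj), sq,
    Finset.sum_mul_sum], Finset.sum_comm]
  refine Finset.sum_congr rfl fun i _ => ?_
  rw [Finset.sum_comm]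
  have : ∀ i', ∑ j ∈ Finset.range (n + 1), C (frequency n i * cosCoeff n j i) * modePosition n i *
      (C (frequency n i' * cosCoeff n j i') * modePosition n i') = C (if i = i' then 1 else 0) *
      (C (frequency n i * frequency n i') * (modePosition n i * modePosition n i')) := by
    intro i'
    rw [← sum_cosCoeff_mul, map_sum, Finset.sum_mul]
    refine Finset.sum_congr rfl fun l _ => ?_
    simp only [C_mul]
    ring
  simp_rw [this]
  simp
  ring

/-- The cubic and quartic parts are lattice sums of powers of the bond variables. -/
noncomputable def bondSum (n r : ℕ) : Poly n :=
  ∑ j ∈ Finset.range (n + 1), (position n (j + 1) - position n j) ^ r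

theorem hamiltonian_eq (α β : ℝ) : hamiltonian n α β =
    ∑ i, modeEnergy n i + C (α / 6) * bondSum n 3 + C (β / 24) * bondSum n 4 := by
  simp_rw [hamiltonian, potential, Finset.sum_add_distrib, ← Finset.mul_sum, sum_momentum_sq,
    modeEnergy, sum_bond_sq, bondSum, ← Finset.mul_sum, Finset.sum_add_distrib]
  ring

theorem modePosition_isHomogeneous (i : Fin n) : (modePosition n i).IsHomogeneous 1 :=
  IsHomogeneous.sum _ _ _ fun _ _ => isHomogeneous_C_mul_X _ _

theorem modeMomentum_isHomogeneous (i : Fin n) : (modeMomentum n i).IsHomogeneous 1 :=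
  IsHomogeneous.sum _ _ _ fun _ _ => isHomogeneous_C_mul_X _ _

theorem modeEnergy_isHomogeneous (i : Fin n) : (modeEnergy n i).IsHomogeneous 2 :=
  (((modeMomentum_isHomogeneous i).pow 2).add
    (((modePosition_isHomogeneous i).pow 2).C_mul _)).C_mul _

theorem bondSum_isHomogeneous (r : ℕ) : (bondSum n r).IsHomogeneous r :=
  IsHomogeneous.sum _ _ _ fun j hj => by
    have h1 : (position n (j + 1) - position n j).IsHomogeneous 1 := by
      rw [bond_eq_sum (Finset.mem_range.1 hj)]
      exact IsHomogeneous.sum _ _ _ fun i _ => (modePosition_isHomogeneous i).C_mul _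
    simpa using h1.pow r

theorem homogeneousComponent_hamiltonian_two (α β : ℝ) :
    homogeneousComponent 2 (hamiltonian n α β) = ∑ i, modeEnergy n i := by
  rw [hamiltonian_eq, map_add, map_add,
    homogeneousComponent_of_mem (IsHomogeneous.sum _ _ _ fun i _ => modeEnergy_isHomogeneous i),
    homogeneousComponent_of_mem ((bondSum_isHomogeneous 3).C_mul _),
    homogeneousComponent_of_mem ((bondSum_isHomogeneous 4).C_mul _)]
  simp


/-! ### The Poisson bracket in complex normal coordinates. -/

theorem pderiv_aeval {σ τ : Type*} [Fintype σ] {R A : Type*} [CommRing R] [CommRing A] [Algebra R A]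
    (g : σ → MvPolynomial τ A) (c : τ) (f : MvPolynomial σ R) :
    pderiv c (aeval g f) = ∑ a, aeval g (pderiv a f) * pderiv c (g a) := by
  classical
  induction f using MvPolynomial.induction_on with
  | C r => simp [MvPolynomial.algebraMap_apply]
  | add p q hp hq => simp only [map_add, hp, hq, add_mul, Finset.sum_add_distrib]
  | mul_X p i hp =>
    simp only [map_mul, aeval_X, Derivation.leibniz, hp, smul_eq_mul, map_add, add_mul,
      Finset.sum_add_distrib, pderiv_X, Finset.mul_sum]
    congr 1
    · simp [Pi.single_apply, apply_ite (aeval g)]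
    · exact Finset.sum_congr rfl fun a _ => by ring

theorem coeff_X_mul_pderiv {σ R : Type*} [CommRing R] (i : σ) (f : MvPolynomial σ R) (s : σ →₀ ℕ) :
    coeff s (X i * pderiv i f) = s i * coeff s f := by
  classical
  induction f using MvPolynomial.induction_on' with
  | monomial u a =>
    rw [X_mul_pderiv_monomial, coeff_smul, coeff_monomial, nsmul_eq_mul]
    split_ifs with h
    · rw [h]
    · simp
  | add p q hp hq => simp only [map_add, mul_add, coeff_add, hp, hq]

theorem poisson_add_right (f g h : Poly n) : poisson f (g + h) = poisson f g + poisson f h := by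
  simp only [poisson, map_add, ← Finset.sum_add_distrib]
  exact Finset.sum_congr rfl fun i _ => by ring

theorem poisson_add_left (f g h : Poly n) : poisson (f + g) h = poisson f h + poisson g h := by
  simp only [poisson, map_add, ← Finset.sum_add_distrib]
  exact Finset.sum_congr rfl fun i _ => by ring

theorem poisson_smul_right (c : ℝ) (f g : Poly n) : poisson f (c • g) = c • poisson f g := by
  simp only [poisson, Derivation.map_smul, Finset.smul_sum, mul_smul_comm, smul_sub]

theorem poisson_antisymm (f g : Poly n) : poisson f g = -poisson g f := by
  simp only [poisson, ← Finset.sum_neg_distrib]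
  exact Finset.sum_congr rfl fun i _ => by ring

theorem poisson_smul_left (c : ℝ) (f g : Poly n) : poisson (c • f) g = c • poisson f g := by
  rw [poisson_antisymm, poisson_smul_right, poisson_antisymm f, smul_neg]

/-- The Hamiltonian derivation `{f, ·}` as a linear map. -/
noncomputable def poissonHom (f : Poly n) : Poly n →ₗ[ℝ] Poly n where
  toFun := poisson f
  map_add' := poisson_add_right f
  map_smul' c g := poisson_smul_right c f g

theorem poisson_isHomogeneous {f g : Poly n} {a b : ℕ} (hf : f.IsHomogeneous (a + 1))
    (hg : g.IsHomogeneous (b + 1)) : (poisson f g).IsHomogeneous (a + b) :=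
  IsHomogeneous.sum _ _ _ fun _ _ => (hf.pderiv.mul hg.pderiv).sub (hf.pderiv.mul hg.pderiv)

/-- The bracket in the complex normal coordinates `X (inl k) = P_k + i Ω_k Q_k` and
`X (inr k) = P_k - i Ω_k Q_k`. -/
noncomputable def normalBracket (f g : MvPolynomial (Fin n ⊕ Fin n) ℂ) :
    MvPolynomial (Fin n ⊕ Fin n) ℂ :=
  ∑ k, C (2 * Complex.I * frequency n k) *
    (pderiv (Sum.inl k) f * pderiv (Sum.inr k) g - pderiv (Sum.inr k) f * pderiv (Sum.inl k) g)

/-- `Q_k` in the complex normal coordinates. -/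
noncomputable def normalPosition (k : Fin n) : MvPolynomial (Fin n ⊕ Fin n) ℂ :=
  C ((2 * Complex.I * frequency n k)⁻¹) * (X (Sum.inl k) - X (Sum.inr k))

/-- `P_k` in the complex normal coordinates. -/
noncomputable def normalMomentum (k : Fin n) : MvPolynomial (Fin n ⊕ Fin n) ℂ :=
  C (2⁻¹) * (X (Sum.inl k) + X (Sum.inr k))

/-- The substitution of the complex normal coordinates. -/
noncomputable def toNormal : Poly n →ₐ[ℝ] MvPolynomial (Fin n ⊕ Fin n) ℂ :=
  aeval (Sum.elim (fun l => ∑ i, C (sineCoeff n i l : ℂ) * normalPosition i)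
    (fun l => ∑ i, C (sineCoeff n i l : ℂ) * normalMomentum i))

theorem toNormal_C (r : ℝ) : toNormal (C r : Poly n) = C (r : ℂ) := by
  rw [toNormal, aeval_C, MvPolynomial.algebraMap_apply]
  rfl

theorem toNormal_X_inl (l : Fin n) : toNormal (X (Sum.inl l) : Poly n) =
    ∑ i, C (sineCoeff n i l : ℂ) * normalPosition i := by
  rw [toNormal, aeval_X, Sum.elim_inl]

theorem toNormal_X_inr (l : Fin n) : toNormal (X (Sum.inr l) : Poly n) =
    ∑ i, C (sineCoeff n i l : ℂ) * normalMomentum i := by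
  rw [toNormal, aeval_X, Sum.elim_inr]

theorem sum_ofReal_sineCoeff (i i' : Fin n) :
    ∑ l, (sineCoeff n i l : ℂ) * sineCoeff n i' l = if i = i' then 1 else 0 := by
  have h := congrArg Complex.ofReal (sum_sineCoeff_mul i i')
  rw [Complex.ofReal_sum] at h
  simp only [Complex.ofReal_mul] at h
  rw [h]
  split_ifs <;> simp

theorem sum_C_sineCoeff (i i' : Fin n) :
    ∑ l, (C (sineCoeff n i l : ℂ) * C (sineCoeff n i' l : ℂ) : MvPolynomial (Fin n ⊕ Fin n) ℂ) =
      if i = i' then 1 else 0 := by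
  simp_rw [← C_mul, ← map_sum, sum_ofReal_sineCoeff]
  split_ifs <;> simp

theorem sum_C_sineCoeff' (i i' : Fin n) :
    ∑ l, (C (sineCoeff n l i : ℂ) * C (sineCoeff n l i' : ℂ) : MvPolynomial (Fin n ⊕ Fin n) ℂ) =
      if i = i' then 1 else 0 := by
  simp_rw [sineCoeff_comm _ i, sineCoeff_comm _ i', sum_C_sineCoeff]

theorem toNormal_modePosition (k : Fin n) : toNormal (modePosition n k) = normalPosition k := by
  simp_rw [modePosition, map_sum, map_mul, toNormal_C, toNormal_X_inl, Finset.mul_sum]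
  rw [Finset.sum_comm]
  simp_rw [← mul_assoc, ← Finset.sum_mul, sum_C_sineCoeff]
  simp

theorem toNormal_modeMomentum (k : Fin n) : toNormal (modeMomentum n k) = normalMomentum k := by
  simp_rw [modeMomentum, map_sum, map_mul, toNormal_C, toNormal_X_inr, Finset.mul_sum]
  rw [Finset.sum_comm]
  simp_rw [← mul_assoc, ← Finset.sum_mul, sum_C_sineCoeff]
  simp

theorem frequency_ne_zero (k : Fin n) : (frequency n k : ℂ) ≠ 0 := by
  exact_mod_cast (frequency_pos k).ne'

theorem two_I_frequency_ne_zero (k : Fin n) : (2 * Complex.I * frequency n k : ℂ) ≠ 0 :=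
  mul_ne_zero (by simp) (frequency_ne_zero k)

theorem toNormal_modeEnergy (k : Fin n) :
    toNormal (modeEnergy n k) = C (1 / 2) * (X (Sum.inl k) * X (Sum.inr k)) := by
  have h2 := two_I_frequency_ne_zero k
  have h3 : ((frequency n k : ℂ)) ^ 2 * ((2 * Complex.I * frequency n k)⁻¹) ^ 2 = - (1 / 4) := by
    have := frequency_ne_zero k
    field_simp
    rw [Complex.I_sq]
    norm_num
  rw [modeEnergy, map_mul, map_add, map_pow, map_mul, map_pow toNormal (modePosition n k),
    toNormal_C, toNormal_C,
    toNormal_modePosition, toNormal_modeMomentum, normalPosition, normalMomentum, mul_pow, mul_pow,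
    ← mul_assoc (C _) (C _ ^ 2), ← C_pow, ← C_pow, ← C_mul]
  push_cast
  rw [h3]
  have h4 : (C (-(1 / 4) : ℂ) : MvPolynomial (Fin n ⊕ Fin n) ℂ) = -C (2⁻¹ ^ 2) := by
    rw [← C_neg]
    norm_num
  have h5 : (C (2⁻¹ ^ 2 : ℂ) : MvPolynomial (Fin n ⊕ Fin n) ℂ) * 4 = 1 := by
    rw [show (4 : MvPolynomial (Fin n ⊕ Fin n) ℂ) = C 4 from rfl, ← C_mul]
    norm_num
  rw [h4]
  linear_combination C (1 / 2) * (X (Sum.inl k) * X (Sum.inr k)) * h5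

/-- The inverse substitution. -/
noncomputable def ofNormal : MvPolynomial (Fin n ⊕ Fin n) ℂ →ₐ[ℂ] MvPolynomial (Fin n ⊕ Fin n) ℂ :=
  aeval (Sum.elim
    (fun k => map (algebraMap ℝ ℂ) (modeMomentum n k) +
      C (Complex.I * frequency n k) * map (algebraMap ℝ ℂ) (modePosition n k))
    (fun k => map (algebraMap ℝ ℂ) (modeMomentum n k) -
      C (Complex.I * frequency n k) * map (algebraMap ℝ ℂ) (modePosition n k)))

theorem ofNormal_C (r : ℂ) : ofNormal (C r : MvPolynomial (Fin n ⊕ Fin n) ℂ) = C r := by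
  rw [ofNormal, aeval_C]
  rfl

theorem ofNormal_normalPosition (k : Fin n) :
    ofNormal (normalPosition k) = map (algebraMap ℝ ℂ) (modePosition n k) := by
  rw [normalPosition, map_mul, map_sub, ofNormal_C]
  simp only [ofNormal, aeval_X, Sum.elim_inl, Sum.elim_inr]
  rw [add_sub_sub_cancel, ← add_mul, ← mul_assoc, ← C_add, ← C_mul]
  rw [show (2 * Complex.I * frequency n k)⁻¹ *
    (Complex.I * frequency n k + Complex.I * frequency n k) = 1 by
      have := frequency_ne_zero k
      field_simp
      norm_num, C_1, one_mul]

theorem ofNormal_normalMomentum (k : Fin n) :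
    ofNormal (normalMomentum k) = map (algebraMap ℝ ℂ) (modeMomentum n k) := by
  rw [normalMomentum, map_mul, map_add, ofNormal_C]
  simp only [ofNormal, aeval_X, Sum.elim_inl, Sum.elim_inr]
  rw [add_add_sub_cancel, ← two_mul, ← mul_assoc, show (2 : MvPolynomial (Fin n ⊕ Fin n) ℂ) = C 2 from
    rfl, ← C_mul, inv_mul_cancel₀ two_ne_zero, C_1, one_mul]

theorem ofNormal_toNormal_X (c : Fin n ⊕ Fin n) :
    ofNormal (toNormal (X c : Poly n)) = map (algebraMap ℝ ℂ) (X c) := by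
  rcases c with l | l
  · rw [toNormal_X_inl, map_sum ofNormal]
    refine Eq.trans ?_ (congrArg (map (algebraMap ℝ ℂ)) (sum_sineCoeff_mul_modePosition l))
    rw [map_sum (map (algebraMap ℝ ℂ))]
    refine Finset.sum_congr rfl fun i _ => ?_
    rw [map_mul ofNormal, map_mul (map (algebraMap ℝ ℂ)), ofNormal_C, ofNormal_normalPosition,
      map_C, Complex.coe_algebraMap]
  · rw [toNormal_X_inr, map_sum ofNormal]
    refine Eq.trans ?_ (congrArg (map (algebraMap ℝ ℂ)) (sum_sineCoeff_mul_modeMomentum l))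
    rw [map_sum (map (algebraMap ℝ ℂ))]
    refine Finset.sum_congr rfl fun i _ => ?_
    rw [map_mul ofNormal, map_mul (map (algebraMap ℝ ℂ)), ofNormal_C, ofNormal_normalMomentum,
      map_C, Complex.coe_algebraMap]

theorem ofNormal_toNormal (f : Poly n) : ofNormal (toNormal f) = map (algebraMap ℝ ℂ) f := by
  induction f using MvPolynomial.induction_on with
  | C r => rw [toNormal_C, ofNormal_C, map_C, Complex.coe_algebraMap]
  | add p q hp hq =>
    rw [map_add toNormal, map_add ofNormal, hp, hq, map_add (map (algebraMap ℝ ℂ))]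
  | mul_X p i hp =>
    rw [map_mul toNormal, map_mul ofNormal, hp, ofNormal_toNormal_X,
      map_mul (map (algebraMap ℝ ℂ))]

/-- After extension of scalars to ℂ, `ofNormal` is a left inverse. Identities between real
polynomials can thus be tested on complex monomials. -/
theorem toNormal_injective : Function.Injective (toNormal (n := n)) := fun f g h =>
  map_injective (algebraMap ℝ ℂ) Complex.ofReal_injective (by
    rw [← ofNormal_toNormal, h, ofNormal_toNormal])

theorem toNormal_isHomogeneous {f : Poly n} {r : ℕ} (hf : f.IsHomogeneous r) :
    (toNormal f).IsHomogeneous r := by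
  have h : ∀ a : Fin n ⊕ Fin n, (Sum.elim (fun l => ∑ i, C (sineCoeff n i l : ℂ) * normalPosition i)
      (fun l => ∑ i, C (sineCoeff n i l : ℂ) * normalMomentum i) a :
        MvPolynomial (Fin n ⊕ Fin n) ℂ).IsHomogeneous 1 := by
    rintro (a | a)
    · exact IsHomogeneous.sum _ _ _ fun i _ =>
        (((isHomogeneous_X _ _).sub (isHomogeneous_X _ _)).C_mul _).C_mul _
    · exact IsHomogeneous.sum _ _ _ fun i _ =>
        (((isHomogeneous_X _ _).add (isHomogeneous_X _ _)).C_mul _).C_mul _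
  have h1 := hf.aeval _ h
  rw [one_mul] at h1
  exact h1

theorem sum_mul_sum_of_orthogonal {A : Type*} [CommRing A] (S : Fin n → Fin n → A)
    (hS : ∀ l l', ∑ k, S k l * S k l' = if l = l' then 1 else 0) (a b : Fin n → A) :
    ∑ k, (∑ l, a l * S k l) * (∑ l, b l * S k l) = ∑ l, a l * b l := by
  simp_rw [Finset.sum_mul_sum]
  rw [Finset.sum_comm]
  refine Finset.sum_congr rfl fun l _ => ?_
  rw [Finset.sum_comm]
  have : ∀ l', ∑ k, a l * S k l * (b l' * S k l') = a l * b l' * if l = l' then 1 else 0 := by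
    intro l'
    rw [← hS, Finset.mul_sum]
    exact Finset.sum_congr rfl fun k _ => by ring
  simp_rw [this]
  simp

theorem pderiv_toNormal (c : Fin n ⊕ Fin n) (f : Poly n) : pderiv c (toNormal f) =
    ∑ l, toNormal (pderiv (Sum.inl l) f) * pderiv c (toNormal (X (Sum.inl l) : Poly n)) +
    ∑ l, toNormal (pderiv (Sum.inr l) f) * pderiv c (toNormal (X (Sum.inr l) : Poly n)) := by
  simp only [toNormal_X_inl, toNormal_X_inr]
  rw [toNormal, pderiv_aeval, Fintype.sum_sum_type]
  simp only [Sum.elim_inl, Sum.elim_inr]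

theorem pderiv_inl_toNormal_X_inl (k l : Fin n) :
    pderiv (Sum.inl k) (toNormal (X (Sum.inl l) : Poly n)) =
      C ((2 * Complex.I * frequency n k)⁻¹) * C (sineCoeff n k l : ℂ) := by
  rw [toNormal_X_inl, map_sum, Finset.sum_eq_single_of_mem k (Finset.mem_univ _)]
  · rw [normalPosition, pderiv_C_mul, pderiv_C_mul, map_sub, pderiv_X_self,
      pderiv_X_of_ne (by simp), sub_zero, mul_one, mul_comm]
  · intro j _ hj
    rw [normalPosition, pderiv_C_mul, pderiv_C_mul, map_sub, pderiv_X_of_ne (by simpa using hj),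
      pderiv_X_of_ne (by simp), sub_zero, mul_zero, mul_zero]

theorem pderiv_inr_toNormal_X_inl (k l : Fin n) :
    pderiv (Sum.inr k) (toNormal (X (Sum.inl l) : Poly n)) =
      -C ((2 * Complex.I * frequency n k)⁻¹) * C (sineCoeff n k l : ℂ) := by
  rw [toNormal_X_inl, map_sum, Finset.sum_eq_single_of_mem k (Finset.mem_univ _)]
  · rw [normalPosition, pderiv_C_mul, pderiv_C_mul, map_sub, pderiv_X_self,
      pderiv_X_of_ne (by simp)]
    ring
  · intro j _ hj
    rw [normalPosition, pderiv_C_mul, pderiv_C_mul, map_sub, pderiv_X_of_ne (by simp),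
      pderiv_X_of_ne (by simpa using hj), sub_zero, mul_zero, mul_zero]

theorem pderiv_inl_toNormal_X_inr (k l : Fin n) :
    pderiv (Sum.inl k) (toNormal (X (Sum.inr l) : Poly n)) =
      C (2⁻¹) * C (sineCoeff n k l : ℂ) := by
  rw [toNormal_X_inr, map_sum, Finset.sum_eq_single_of_mem k (Finset.mem_univ _)]
  · rw [normalMomentum, pderiv_C_mul, pderiv_C_mul, map_add, pderiv_X_self,
      pderiv_X_of_ne (by simp), add_zero, mul_one, mul_comm]
  · intro j _ hj
    rw [normalMomentum, pderiv_C_mul, pderiv_C_mul, map_add, pderiv_X_of_ne (by simpa using hj),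
      pderiv_X_of_ne (by simp), add_zero, mul_zero, mul_zero]

theorem pderiv_inr_toNormal_X_inr (k l : Fin n) :
    pderiv (Sum.inr k) (toNormal (X (Sum.inr l) : Poly n)) =
      C (2⁻¹) * C (sineCoeff n k l : ℂ) := by
  rw [toNormal_X_inr, map_sum, Finset.sum_eq_single_of_mem k (Finset.mem_univ _)]
  · rw [normalMomentum, pderiv_C_mul, pderiv_C_mul, map_add, pderiv_X_self,
      pderiv_X_of_ne (by simp), zero_add, mul_one, mul_comm]
  · intro j _ hj
    rw [normalMomentum, pderiv_C_mul, pderiv_C_mul, map_add, pderiv_X_of_ne (by simp),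
      pderiv_X_of_ne (by simpa using hj), add_zero, mul_zero, mul_zero]

theorem pderiv_inl_toNormal (k : Fin n) (f : Poly n) : pderiv (Sum.inl k) (toNormal f) =
    C ((2 * Complex.I * frequency n k)⁻¹) *
      ∑ l, toNormal (pderiv (Sum.inl l) f) * C (sineCoeff n k l : ℂ) +
    C (2⁻¹) * ∑ l, toNormal (pderiv (Sum.inr l) f) * C (sineCoeff n k l : ℂ) := by
  rw [pderiv_toNormal]
  simp only [pderiv_inl_toNormal_X_inl, pderiv_inl_toNormal_X_inr,
    Finset.mul_sum, mul_left_comm (C _)]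

theorem pderiv_inr_toNormal (k : Fin n) (f : Poly n) : pderiv (Sum.inr k) (toNormal f) =
    -C ((2 * Complex.I * frequency n k)⁻¹) *
      ∑ l, toNormal (pderiv (Sum.inl l) f) * C (sineCoeff n k l : ℂ) +
    C (2⁻¹) * ∑ l, toNormal (pderiv (Sum.inr l) f) * C (sineCoeff n k l : ℂ) := by
  rw [pderiv_toNormal]
  simp only [pderiv_inr_toNormal_X_inl, pderiv_inr_toNormal_X_inr,
    Finset.mul_sum, mul_left_comm (C _), mul_left_comm (-C _)]

theorem toNormal_poisson (f g : Poly n) :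
    toNormal (poisson f g) = normalBracket (toNormal f) (toNormal g) := by
  have h := sum_mul_sum_of_orthogonal (fun k l => (C (sineCoeff n k l : ℂ) :
    MvPolynomial (Fin n ⊕ Fin n) ℂ)) sum_C_sineCoeff'
  rw [poisson, map_sum]
  simp_rw [map_sub, map_mul]
  -- Orthogonality of the sine matrix turns the sum over particles into a sum over modes.
  rw [Finset.sum_sub_distrib, ← h (fun l => toNormal (pderiv (Sum.inl l) f)),
    ← h (fun l => toNormal (pderiv (Sum.inr l) f)), ← Finset.sum_sub_distrib, normalBracket]
  refine Finset.sum_congr rfl fun k _ => ?_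
  simp only [pderiv_inl_toNormal, pderiv_inr_toNormal]
  have h1 : (C (2 * Complex.I * frequency n k) * C ((2 * Complex.I * frequency n k)⁻¹) :
      MvPolynomial (Fin n ⊕ Fin n) ℂ) = 1 := by
    rw [← C_mul, mul_inv_cancel₀ (two_I_frequency_ne_zero k), C_1]
  have h2 : (C (2⁻¹ : ℂ) * 2 : MvPolynomial (Fin n ⊕ Fin n) ℂ) = 1 := by
    rw [show (2 : MvPolynomial (Fin n ⊕ Fin n) ℂ) = C 2 from rfl, ← C_mul]
    norm_num
  generalize ∑ l, toNormal (pderiv (Sum.inl l) f) * C (sineCoeff n k l : ℂ) = U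
  generalize ∑ l, toNormal (pderiv (Sum.inr l) f) * C (sineCoeff n k l : ℂ) = V
  generalize ∑ l, toNormal (pderiv (Sum.inl l) g) * C (sineCoeff n k l : ℂ) = U'
  generalize ∑ l, toNormal (pderiv (Sum.inr l) g) * C (sineCoeff n k l : ℂ) = V'
  generalize (C (2 * Complex.I * frequency n k) : MvPolynomial (Fin n ⊕ Fin n) ℂ) = a at *
  generalize (C ((2 * Complex.I * frequency n k)⁻¹) : MvPolynomial (Fin n ⊕ Fin n) ℂ) = b at *
  generalize (C (2⁻¹ : ℂ) : MvPolynomial (Fin n ⊕ Fin n) ℂ) = c at *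
  linear_combination -(U * V' - V * U') * (h1 + a * b * h2)

/-- Since E_k is half of z_k times its conjugate, bracketing with it is a multiple of a difference
of two Euler operators, for which monomials are eigenvectors. -/
theorem coeff_normalBracket_energy (k : Fin n) (g : MvPolynomial (Fin n ⊕ Fin n) ℂ)
    (s : Fin n ⊕ Fin n →₀ ℕ) : coeff s (normalBracket (toNormal (modeEnergy n k)) g) =
      Complex.I * frequency n k * ((s (Sum.inr k) : ℂ) - s (Sum.inl k)) * coeff s g := by
  have h : normalBracket (toNormal (modeEnergy n k)) g = C (Complex.I * frequency n k) *
      (X (Sum.inr k) * pderiv (Sum.inr k) g - X (Sum.inl k) * pderiv (Sum.inl k) g) := by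
    rw [toNormal_modeEnergy, normalBracket, Finset.sum_eq_single_of_mem k (Finset.mem_univ _)]
    · simp only [Derivation.leibniz, pderiv_C, pderiv_X_self, smul_eq_mul, mul_zero, add_zero,
        mul_one, pderiv_X_of_ne (show (Sum.inr k : Fin n ⊕ Fin n) ≠ Sum.inl k by simp),
        pderiv_X_of_ne (show (Sum.inl k : Fin n ⊕ Fin n) ≠ Sum.inr k by simp), zero_add]
      rw [show (2 * Complex.I * frequency n k : ℂ) = Complex.I * frequency n k * 2 by ring, C_mul]
      have h2 : (C (2 : ℂ) * C (1 / 2) : MvPolynomial (Fin n ⊕ Fin n) ℂ) = 1 := by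
        rw [← C_mul]
        norm_num
      linear_combination C (Complex.I * frequency n k) * (X (Sum.inr k) * pderiv (Sum.inr k) g -
        X (Sum.inl k) * pderiv (Sum.inl k) g) * h2
    · intro j _ hj
      simp [pderiv_X, hj.symm]
  rw [h, coeff_C_mul, coeff_sub, coeff_X_mul_pderiv, coeff_X_mul_pderiv]
  ring


/-! ### The Jacobi identity. -/

/-- The commutator of two derivations is a derivation, and this one kills every variable. -/
theorem pderiv_pderiv_comm {σ R : Type*} [CommRing R] (i j : σ) (f : MvPolynomial σ R) :
    pderiv i (pderiv j f) = pderiv j (pderiv i f) := by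
  classical
  have h : ⁅(pderiv i : Derivation R (MvPolynomial σ R) (MvPolynomial σ R)), pderiv j⁆ = (0 : Derivation R (MvPolynomial σ R) (MvPolynomial σ R)) := by
    refine derivation_ext fun k => ?_
    rw [Derivation.commutator_apply, pderiv_X, pderiv_X, Pi.single_apply, Pi.single_apply]
    split_ifs <;> simp
  have h1 := congrArg (fun D => D f) h
  simp only [Derivation.commutator_apply, Derivation.zero_apply] at h1
  exact sub_eq_zero.1 h1

theorem poisson_mul_right (f g h : Poly n) :
    poisson f (g * h) = g * poisson f h + h * poisson f g := by
  simp only [poisson, pderiv_mul, Finset.mul_sum, ← Finset.sum_add_distrib]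
  exact Finset.sum_congr rfl fun i _ => by ring

theorem poisson_mul_left (f g h : Poly n) :
    poisson (f * g) h = f * poisson g h + g * poisson f h := by
  rw [poisson_antisymm, poisson_mul_right, poisson_antisymm g, poisson_antisymm f]
  ring

theorem poisson_C_right (f : Poly n) (c : ℝ) : poisson f (C c) = 0 := by simp [poisson]

theorem poisson_C_left (f : Poly n) (c : ℝ) : poisson (C c) f = 0 := by simp [poisson]

theorem poisson_X_inl (f : Poly n) (i : Fin n) :
    poisson f (X (Sum.inl i)) = -pderiv (Sum.inr i) f := by
  classical
  simp [poisson, pderiv_X, Pi.single_apply]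

theorem poisson_X_inr (f : Poly n) (i : Fin n) :
    poisson f (X (Sum.inr i)) = pderiv (Sum.inl i) f := by
  classical
  simp [poisson, pderiv_X, Pi.single_apply]

theorem poisson_jacobi_X_X (h : Poly n) (a b : Fin n ⊕ Fin n) :
    poisson h (poisson (X a) (X b)) =
      poisson (poisson h (X a)) (X b) + poisson (X a) (poisson h (X b)) := by
  classical
  rw [poisson_antisymm (X a) (poisson h (X b))]
  have h0 : ∀ c d : Fin n ⊕ Fin n, ∀ g : Poly n, poisson g (pderiv c (X d)) = 0 := by
    intro c d g
    rw [pderiv_X, Pi.single_apply]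
    split_ifs
    · exact poisson_C_right g 1
    · simpa using poisson_C_right g 0
  have hneg : ∀ f g : Poly n, poisson f (-g) = -poisson f g := fun f g => by
    simpa using poisson_smul_right (-1) f g
  have hneg' : ∀ f g : Poly n, poisson (-f) g = -poisson f g := fun f g => by
    simpa using poisson_smul_left (-1) f g
  rcases a with i | i <;> rcases b with j | j <;>
    simp only [poisson_X_inl, poisson_X_inr, hneg, h0, map_neg, neg_neg, neg_zero] <;>
    rw [pderiv_pderiv_comm] <;> ring

/-- The Leibniz rule in f and then in g reduces the identity to coordinates, where it is the
symmetry of the second derivatives of h. -/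
theorem poisson_jacobi (h f g : Poly n) : poisson h (poisson f g) =
    poisson (poisson h f) g + poisson f (poisson h g) := by
  induction f using MvPolynomial.induction_on with
  | C r => simp only [poisson_C_left, poisson_C_right]
           simpa using (poisson_C_right h 0).trans (poisson_C_left g 0).symm
  | add p q hp hq =>
    simp only [poisson_add_left, poisson_add_right, hp, hq]
    ring
  | mul_X p a hp =>
    have hX : poisson h (poisson (X a) g) =
        poisson (poisson h (X a)) g + poisson (X a) (poisson h g) := by
      clear hp
      induction g using MvPolynomial.induction_on with
      | C r => simp only [poisson_C_right]
               simpa using (poisson_C_right h 0).trans (poisson_C_right (X a) 0).symm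
      | add p q hp hq =>
        simp only [poisson_add_right, hp, hq]
        ring
      | mul_X p b hp =>
        simp only [poisson_mul_right, poisson_add_right, hp, poisson_jacobi_X_X]
        ring
    simp only [poisson_mul_left, poisson_mul_right, poisson_add_left, poisson_add_right, hp, hX]
    ring

/-! ### Balanced monomials form a Poisson subalgebra. -/

/-- The monomials whose wave numbers can be balanced. -/
def Balanced (s : Fin n ⊕ Fin n →₀ ℕ) : Prop :=
  ∃ m : Multiset ((Fin n ⊕ Fin n) × ℤˣ), m.map Prod.fst = Finsupp.toMultiset s ∧ WaveBalanced m

/-- The bracket deletes one coordinate from each monomial, both of the same mode. If e and e' are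
their signs, multiplying all signs of the second monomial by −e e' makes the deleted wave numbers
cancel. -/
theorem Balanced.contract {u v : Fin n ⊕ Fin n →₀ ℕ} {a b : Fin n ⊕ Fin n}
    (hab : modeIndex a = modeIndex b) (hu : Balanced (u + Finsupp.single a 1))
    (hv : Balanced (v + Finsupp.single b 1)) : Balanced (u + v) := by
  have key : ∀ {w : Fin n ⊕ Fin n →₀ ℕ} {c}, Balanced (w + Finsupp.single c 1) →
      ∃ m : Multiset ((Fin n ⊕ Fin n) × ℤˣ), ∃ e : ℤˣ, m.map Prod.fst = Finsupp.toMultiset w ∧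
        WaveBalanced ((c, e) ::ₘ m) := by
    rintro w c ⟨m, hm, hb⟩
    rw [Finsupp.toMultiset_add, Finsupp.toMultiset_single, one_smul] at hm
    have hc : c ∈ m.map Prod.fst := by rw [hm]; simp
    obtain ⟨⟨c', e⟩, hx, rfl⟩ := Multiset.mem_map.1 hc
    obtain ⟨m', rfl⟩ := Multiset.exists_cons_of_mem hx
    refine ⟨m', e, ?_, hb⟩
    rw [Multiset.map_cons, add_comm, Multiset.singleton_add] at hm
    exact (Multiset.cons_inj_right _).1 hm
  obtain ⟨m, e, hm, hb⟩ := key hu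
  obtain ⟨m', e', hm', hb'⟩ := key hv
  refine ⟨m + m'.map fun x => (x.1, -(e * e') * x.2), ?_, ?_⟩
  · rw [Multiset.map_add, Multiset.map_map, Finsupp.toMultiset_add, hm, ← hm']
    rfl
  · unfold WaveBalanced at *
    rw [Multiset.map_cons, Multiset.sum_cons] at hb hb'
    rw [Multiset.map_add, Multiset.sum_add, Multiset.map_map]
    have h1 : (m'.map ((fun x : (Fin n ⊕ Fin n) × ℤˣ => (x.2 : ℤ) * ((modeIndex x.1 : ℕ) + 1)) ∘
        fun x => (x.1, -(e * e') * x.2))).sum = -(e * e' : ℤ) *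
        (m'.map fun x => (x.2 : ℤ) * ((modeIndex x.1 : ℕ) + 1)).sum := by
      rw [← Multiset.sum_map_mul_left]
      congr 1
      refine Multiset.map_congr rfl fun x _ => ?_
      simp
      ring
    rw [h1]
    have h2 := dvd_sub hb (Dvd.dvd.mul_left hb' (e * e' : ℤ))
    rw [hab] at h2
    have h3 : (e' : ℤ) * e' = 1 := by
      rcases Int.units_eq_one_or e' with h | h <;> simp [h]
    refine Eq.mp (congrArg _ ?_) h2
    linear_combination (-(e : ℤ) * ((modeIndex b : ℕ) + 1)) * h3

/-- The span of the monomials with balanced wave numbers. -/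
noncomputable def balancedSubmodule (n : ℕ) : Submodule ℂ (MvPolynomial (Fin n ⊕ Fin n) ℂ) :=
  restrictSupport ℂ {s | Balanced s}

theorem mem_balancedSubmodule {f : MvPolynomial (Fin n ⊕ Fin n) ℂ} :
    f ∈ balancedSubmodule n ↔ ∀ s, coeff s f ≠ 0 → Balanced s := by
  rw [balancedSubmodule, mem_restrictSupport_iff]
  simp [Set.subset_def]

theorem pderiv_mul_pderiv_mem {f g : MvPolynomial (Fin n ⊕ Fin n) ℂ} (hf : f ∈ balancedSubmodule n)
    (hg : g ∈ balancedSubmodule n) {a b : Fin n ⊕ Fin n} (hab : modeIndex a = modeIndex b) :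
    pderiv a f * pderiv b g ∈ balancedSubmodule n := by
  classical
  rw [mem_balancedSubmodule] at *
  intro s hs
  have h1 := support_mul (pderiv a f) (pderiv b g) (mem_support_iff.2 hs)
  obtain ⟨u, hu, v, hv, rfl⟩ := Finset.mem_add.1 h1
  rw [mem_support_iff, coeff_pderiv] at hu hv
  exact Balanced.contract hab (hf _ (left_ne_zero_of_mul hu)) (hg _ (left_ne_zero_of_mul hv))

theorem normalBracket_mem {f g : MvPolynomial (Fin n ⊕ Fin n) ℂ} (hf : f ∈ balancedSubmodule n)
    (hg : g ∈ balancedSubmodule n) : normalBracket f g ∈ balancedSubmodule n := by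
  refine Submodule.sum_mem _ fun k _ => ?_
  rw [← smul_eq_C_mul]
  exact Submodule.smul_mem _ _ (Submodule.sub_mem _ (pderiv_mul_pderiv_mem hf hg rfl)
    (pderiv_mul_pderiv_mem hf hg rfl))

/-- In the expansion of the power over tuples of coordinates, the site enters each coefficient only
through a product of cosines. By the selection rule its lattice sum vanishes for unbalanced tuples.
-/
theorem toNormal_bondSum_mem (r : ℕ) : toNormal (bondSum n r) ∈ balancedSubmodule n := by
  let d : Fin n ⊕ Fin n → ℂ := Sum.elim
    (fun i => frequency n i * √(2 / ((n : ℝ) + 1)) * (2 * Complex.I * frequency n i)⁻¹)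
    (fun i => -(frequency n i * √(2 / ((n : ℝ) + 1)) * (2 * Complex.I * frequency n i)⁻¹))
  let e : ℕ → Fin n ⊕ Fin n → ℝ := fun j c =>
    Real.cos ((2 * j + 1) * (((modeIndex c : ℕ) + 1) * (Real.pi / (2 * n + 2))))
  have h1 : ∀ j ∈ Finset.range (n + 1), toNormal ((position n (j + 1) - position n j) ^ r) =
      ∑ p : Fin r → Fin n ⊕ Fin n, monomial (∑ i, Finsupp.single (p i) 1)
        ((∏ i, d (p i)) * (∏ i, e j (p i) : ℝ)) := by
    intro j hj
    have h2 : toNormal (position n (j + 1) - position n j) =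
        ∑ c, C (d c * e j c) * X c := by
      rw [bond_eq_sum (Finset.mem_range.1 hj), map_sum, Fintype.sum_sum_type,
        ← Finset.sum_add_distrib]
      refine Finset.sum_congr rfl fun i _ => ?_
      rw [map_mul, toNormal_C, toNormal_modePosition, normalPosition, ← mul_assoc, ← C_mul, mul_sub,
        sub_eq_add_neg, ← neg_mul, ← C_neg]
      congr 3 <;> simp only [d, e, cosCoeff, Sum.elim_inl, Sum.elim_inr, modeIndex, id] <;>
        push_cast <;> ring
    rw [map_pow, h2, Fintype.sum_pow]
    refine Finset.sum_congr rfl fun p _ => ?_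
    rw [Complex.ofReal_prod, ← Finset.prod_mul_distrib]
    have h3 : ∀ s : Finset (Fin r), ∏ i ∈ s, (C (d (p i) * e j (p i)) * X (p i) : MvPolynomial (Fin n ⊕ Fin n) ℂ) =
        monomial (∑ i ∈ s, Finsupp.single (p i) 1) (∏ i ∈ s, d (p i) * e j (p i)) := by
      intro s
      induction s using Finset.cons_induction with
      | empty => simp
      | cons a s ha ih =>
        rw [Finset.prod_cons, Finset.sum_cons, Finset.prod_cons, ih, C_mul_X_eq_monomial,
          monomial_mul]
    exact h3 _
  rw [bondSum, map_sum, Finset.sum_congr rfl h1, Finset.sum_comm]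
  refine Submodule.sum_mem _ fun p _ => ?_
  rw [← map_sum, ← Finset.mul_sum, ← Complex.ofReal_sum]
  rw [balancedSubmodule, monomial_mem_restrictSupport]
  by_cases h0 : ∑ j ∈ Finset.range (n + 1), ∏ i, e j (p i) = 0
  · right
    rw [h0]
    simp
  · left
    obtain ⟨m, hm, hd⟩ := exists_waveBalanced (Finset.univ.val.map p) 0 (by
      intro h4
      apply h0
      rw [← h4]
      refine Finset.sum_congr rfl fun j _ => ?_
      rw [Multiset.map_map]
      simp only [Int.cast_zero, zero_mul, mul_zero, Real.cos_zero, one_mul]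
      rfl)
    refine ⟨m, ?_, by unfold WaveBalanced; simpa using hd⟩
    rw [hm, Finsupp.toMultiset_sum]
    simp only [Finsupp.toMultiset_single, one_smul]
    exact (Multiset.sum_map_singleton (Finset.univ.val.map p)).symm.trans (by
      rw [Multiset.map_map]; rfl)

/-! ### The homological equations. -/

/-- The real polynomials of degree `r` all of whose normal monomials are balanced. -/
noncomputable def balancedForms (n r : ℕ) : Submodule ℝ (Poly n) :=
  homogeneousSubmodule (Fin n ⊕ Fin n) ℝ r ⊓
    ((balancedSubmodule n).restrictScalars ℝ).comap toNormal.toLinearMap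

/-- The quadratic part of the Hamiltonian. -/
noncomputable def totalEnergy (n : ℕ) : Poly n := ∑ k, modeEnergy n k

theorem totalEnergy_isHomogeneous : (totalEnergy n).IsHomogeneous 2 :=
  IsHomogeneous.sum _ _ _ fun i _ => modeEnergy_isHomogeneous i

theorem poisson_sum_left {ι : Type*} (s : Finset ι) (f : ι → Poly n) (g : Poly n) :
    poisson (∑ i ∈ s, f i) g = ∑ i ∈ s, poisson (f i) g := by
  induction s using Finset.cons_induction with
  | empty => simpa using poisson_C_left g 0
  | cons a s ha ih => rw [Finset.sum_cons, Finset.sum_cons, poisson_add_left, ih]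

theorem coeff_toNormal_poisson_modeEnergy (k : Fin n) (f : Poly n) (s : Fin n ⊕ Fin n →₀ ℕ) :
    coeff s (toNormal (poisson (modeEnergy n k) f)) =
      Complex.I * frequency n k * ((s (Sum.inr k) : ℂ) - s (Sum.inl k)) *
        coeff s (toNormal f) := by
  rw [toNormal_poisson, coeff_normalBracket_energy]

theorem sum_signedFrequency (s : Fin n ⊕ Fin n →₀ ℕ) :
    ((Finsupp.toMultiset s).map signedFrequency).sum =
      ∑ k, frequency n k * ((s (Sum.inr k) : ℝ) - s (Sum.inl k)) := by
  classical
  induction s using Finsupp.induction_linear with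
  | zero => simp
  | add f g hf hg =>
    rw [Finsupp.toMultiset_add, Multiset.map_add, Multiset.sum_add, hf, hg,
      ← Finset.sum_add_distrib]
    refine Finset.sum_congr rfl fun k _ => ?_
    rw [Finsupp.add_apply, Finsupp.add_apply]
    push_cast
    ring
  | single c m =>
    rw [Finsupp.toMultiset_single, Multiset.map_nsmul, Multiset.sum_nsmul]
    rcases c with i | i <;>
      simp [Finsupp.single_apply, signedFrequency, Finset.sum_ite_eq, mul_comm]

theorem coeff_toNormal_poisson_totalEnergy (f : Poly n) (s : Fin n ⊕ Fin n →₀ ℕ) :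
    coeff s (toNormal (poisson (totalEnergy n) f)) =
      Complex.I * (((Finsupp.toMultiset s).map signedFrequency).sum : ℝ) *
        coeff s (toNormal f) := by
  rw [totalEnergy, poisson_sum_left, map_sum, coeff_sum]
  simp_rw [coeff_toNormal_poisson_modeEnergy]
  rw [← Finset.sum_mul, sum_signedFrequency]
  push_cast
  rw [Finset.mul_sum]
  congr 1
  exact Finset.sum_congr rfl fun k _ => by ring

theorem poisson_modeEnergy_modeEnergy (k l : Fin n) :
    poisson (modeEnergy n k) (modeEnergy n l) = 0 := by
  classical
  apply toNormal_injective
  ext s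
  rw [coeff_toNormal_poisson_modeEnergy, toNormal_modeEnergy, map_zero, coeff_zero, coeff_C_mul]
  by_cases h : coeff s (X (Sum.inl l) * X (Sum.inr l) : MvPolynomial (Fin n ⊕ Fin n) ℂ) = 0
  · rw [h, mul_zero, mul_zero]
  · have hs : Finsupp.single (Sum.inl l) 1 + Finsupp.single (Sum.inr l) 1 = s := by
      by_contra hs
      apply h
      rw [X, X, monomial_mul, coeff_monomial, if_neg hs]
    rw [← hs]
    by_cases hkl : l = k <;> simp [hkl]

/-- The operator `{H₂, ·}` is semisimple. -/
theorem poisson_totalEnergy_eq_zero {f : Poly n}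
    (h : poisson (totalEnergy n) (poisson (totalEnergy n) f) = 0) :
    poisson (totalEnergy n) f = 0 := by
  apply toNormal_injective
  ext s
  have h1 := congrArg (fun g => coeff s (toNormal g)) h
  simp only [map_zero, coeff_zero, coeff_toNormal_poisson_totalEnergy] at h1 ⊢
  rcases mul_eq_zero.1 h1 with h2 | h2
  · rw [h2, zero_mul]
  · exact h2

theorem balanced_card {r : ℕ} {f : Poly n} (hf : f ∈ balancedForms n r) {s : Fin n ⊕ Fin n →₀ ℕ}
    (hs : coeff s (toNormal f) ≠ 0) : ∃ m : Multiset ((Fin n ⊕ Fin n) × ℤˣ),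
      m.map Prod.fst = Finsupp.toMultiset s ∧ WaveBalanced m ∧ m.card = r := by
  obtain ⟨m, hm, hb⟩ := mem_balancedSubmodule.1 hf.2 s hs
  refine ⟨m, hm, hb, ?_⟩
  rw [← Multiset.card_map Prod.fst, hm, Finsupp.card_toMultiset]
  by_contra hne
  exact hs ((toNormal_isHomogeneous hf.1).coeff_eq_zero hne)

theorem sum_signedFrequency_eq_zero {f : Poly n} (h : poisson (totalEnergy n) f = 0)
    {s : Fin n ⊕ Fin n →₀ ℕ} (hs : coeff s (toNormal f) ≠ 0) :
    ((Finsupp.toMultiset s).map signedFrequency).sum = 0 := by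
  have h1 := coeff_toNormal_poisson_totalEnergy f s
  rw [h, map_zero, coeff_zero] at h1
  have h2 := (mul_eq_zero.1 h1.symm).resolve_right hs
  exact Complex.ofReal_eq_zero.1 ((mul_eq_zero.1 h2).resolve_left Complex.I_ne_zero)

theorem eq_zero_of_mem_balancedForms_three {f : Poly n} (hf : f ∈ balancedForms n 3)
    (h : poisson (totalEnergy n) f = 0) : f = 0 := by
  apply toNormal_injective
  ext s
  rw [map_zero, coeff_zero]
  by_contra hs
  obtain ⟨m, hm, hb, hc⟩ := balanced_card hf hs
  have h1 := sum_signedFrequency_eq_zero h hs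
  rw [← hm, Multiset.map_map] at h1
  exact hb.sum_ne_zero hc h1

/-- A resonant monomial contains z_k and its conjugate equally often, and the difference of these
multiplicities is its eigenvalue under {E_k, ·} up to a constant. -/
theorem poisson_modeEnergy_of_mem_balancedForms_four {f : Poly n} (hf : f ∈ balancedForms n 4)
    (h : poisson (totalEnergy n) f = 0) (k : Fin n) : poisson f (modeEnergy n k) = 0 := by
  rw [poisson_antisymm, neg_eq_zero]
  apply toNormal_injective
  ext s
  rw [coeff_toNormal_poisson_modeEnergy, map_zero, coeff_zero]
  by_cases hs : coeff s (toNormal f) = 0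
  · rw [hs, mul_zero]
  obtain ⟨m, hm, hb, hc⟩ := balanced_card hf hs
  have h1 := sum_signedFrequency_eq_zero h hs
  rw [← hm, Multiset.map_map] at h1
  have h2 := hb.count_eq hc h1 k
  rw [hm, Finsupp.count_toMultiset, Finsupp.count_toMultiset] at h2
  rw [h2, sub_self, mul_zero, zero_mul]

theorem poisson_mem_balancedForms {f g : Poly n} {a b : ℕ} (hf : f ∈ balancedForms n (a + 1))
    (hg : g ∈ balancedForms n (b + 1)) : poisson f g ∈ balancedForms n (a + b) := by
  refine ⟨poisson_isHomogeneous hf.1 hg.1, ?_⟩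
  change toNormal (poisson f g) ∈ balancedSubmodule n
  rw [toNormal_poisson]
  exact normalBracket_mem hf.2 hg.2

theorem poisson_totalEnergy_mem {f : Poly n} {r : ℕ} (hf : f ∈ balancedForms n (r + 1)) :
    poisson (totalEnergy n) f ∈ balancedForms n (r + 1) := by
  refine ⟨?_, ?_⟩
  · have := poisson_isHomogeneous totalEnergy_isHomogeneous hf.1
    rwa [add_comm] at this
  · refine mem_balancedSubmodule.2 fun s hs => mem_balancedSubmodule.1 hf.2 s fun h0 => hs ?_
    change coeff s (toNormal (poisson (totalEnergy n) f)) = 0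
    change coeff s (toNormal f) = 0 at h0
    rw [coeff_toNormal_poisson_totalEnergy, h0, mul_zero]

theorem bondSum_mem (c : ℝ) (r : ℕ) : C c * bondSum n r ∈ balancedForms n r := by
  rw [← smul_eq_C_mul]
  exact Submodule.smul_mem _ _ ⟨bondSum_isHomogeneous r, toNormal_bondSum_mem r⟩

instance (r : ℕ) : FiniteDimensional ℝ (balancedForms n r) := by
  have : FiniteDimensional ℝ (homogeneousSubmodule (Fin n ⊕ Fin n) ℝ r) :=
    Module.Finite.iff_fg.2 (homogeneousSubmodule_fg _ _ r)
  exact Submodule.finiteDimensional_of_le inf_le_left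

/-- The splitting of the balanced forms into the kernel and the image of `{H₂, ·}`. -/
theorem exists_eq_add_poisson {f : Poly n} {r : ℕ} (hf : f ∈ balancedForms n (r + 1)) :
    ∃ k ∈ balancedForms n (r + 1), ∃ g ∈ balancedForms n (r + 1),
      poisson (totalEnergy n) k = 0 ∧ f = k + poisson (totalEnergy n) g := by
  let T : balancedForms n (r + 1) →ₗ[ℝ] balancedForms n (r + 1) :=
    (poissonHom (totalEnergy n)).restrict fun g hg => poisson_totalEnergy_mem hg
  have hT : ∀ g, (T g : Poly n) = poisson (totalEnergy n) g := fun g => rfl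
  -- Semisimplicity makes kernel and range disjoint; by rank and nullity they then span the
  -- finite-dimensional space.
  have hd : Disjoint (LinearMap.ker T) (LinearMap.range T) := by
    rw [Submodule.disjoint_def]
    rintro _ h1 ⟨g, rfl⟩
    have h2 := congrArg Subtype.val (LinearMap.mem_ker.1 h1)
    rw [hT, hT] at h2
    exact Subtype.ext (poisson_totalEnergy_eq_zero h2)
  have htop := Submodule.eq_top_of_disjoint _ _
    (by have := LinearMap.finrank_range_add_finrank_ker T; omega) hd
  obtain ⟨k, hk, _, ⟨g, rfl⟩, hkg⟩ := Submodule.mem_sup.1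
    (show (⟨f, hf⟩ : balancedForms n (r + 1)) ∈ LinearMap.ker T ⊔ LinearMap.range T from
      htop ▸ Submodule.mem_top)
  refine ⟨k, k.2, g, g.2, ?_, ?_⟩
  · rw [← hT, LinearMap.mem_ker.1 hk]
    rfl
  · rw [← hT, ← Submodule.coe_add, hkg]

/-- The algebraic normalization of the cubic and quartic parts. -/
theorem exists_normalization (n : ℕ) (a b : ℝ) : ∃ F₀ K₄ F₄ : Poly n,
    F₀.IsHomogeneous 3 ∧ K₄.IsHomogeneous 4 ∧ F₄.IsHomogeneous 4 ∧
    poisson (totalEnergy n) F₀ = -(C a * bondSum n 3) ∧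
    C b * bondSum n 4 + C (1 / 2) * poisson (C a * bondSum n 3) F₀ =
      K₄ + poisson (totalEnergy n) F₄ ∧ poisson (totalEnergy n) K₄ = 0 ∧
    ∀ k, poisson K₄ (modeEnergy n k) = 0 := by
  obtain ⟨k, hk, g, hg, hk0, h⟩ := exists_eq_add_poisson (bondSum_mem (n := n) a 3)
  have hk' := eq_zero_of_mem_balancedForms_three hk hk0
  rw [hk', zero_add] at h
  have hg' : -g ∈ balancedForms n 3 := Submodule.neg_mem _ hg
  -- Removing the cubic part adds half the bracket of H₃ with its generator. That this term is
  -- balanced too is what makes the quartic resonance lemma applicable.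
  have h4 : C b * bondSum n 4 + C (1 / 2) * poisson (C a * bondSum n 3) (-g) ∈
      balancedForms n 4 := by
    rw [← smul_eq_C_mul (poisson _ _)]
    exact Submodule.add_mem _ (bondSum_mem b 4)
      (Submodule.smul_mem _ _ (poisson_mem_balancedForms (bondSum_mem a 3) hg'))
  obtain ⟨K, hK, F, hF, hK0, h'⟩ := exists_eq_add_poisson h4
  refine ⟨-g, K, F, hg'.1, hK.1, hF.1, ?_, h', hK0,
    poisson_modeEnergy_of_mem_balancedForms_four hK hK0⟩
  rw [h]
  simpa using poisson_smul_right (-1) (totalEnergy n) g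

/-! ### Independence of the mode energies. -/

/-- The differentials of the mode energies are independent on an open dense set. -/
theorem independent_modeEnergy (n : ℕ) : ∃ V : Set (Phase n), IsOpen V ∧ Dense V ∧ ∀ x ∈ V,
    LinearIndependent ℝ fun (k : Fin n) (c : Fin n ⊕ Fin n) => eval x (pderiv c (modeEnergy n k)) := by
  classical
  -- Where no P_k vanishes the momentum derivatives suffice: that of E_k is P_k times the k-th row
  -- of the orthogonal sine matrix.
  refine ⟨⋂ k, {x | eval x (modeMomentum n k) ≠ 0}, ?_, ?_, ?_⟩
  · exact isOpen_iInter_of_finite fun k => isOpen_ne_fun (continuous_eval _) continuous_const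
  · refine dense_iInter_of_isOpen
      (fun k => isOpen_ne_fun (continuous_eval _) continuous_const) fun k x => ?_
    -- Along the k-th momentum mode P_k grows at unit rate, so points with P_k ≠ 0 lie arbitrarily
    -- close to x.
    let v : Phase n := Sum.elim 0 (sineCoeff n k)
    have hv : ∀ t : ℝ, eval (x + t • v) (modeMomentum n k) = eval x (modeMomentum n k) + t := by
      intro t
      have h1 := sum_sineCoeff_mul (n := n) k k
      simp only [modeMomentum, map_sum, map_mul, eval_C, eval_X, Pi.add_apply, Pi.smul_apply,
        smul_eq_mul, v, Sum.elim_inr, mul_add, Finset.sum_add_distrib]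
      rw [if_pos rfl] at h1
      rw [add_right_inj]
      refine Eq.trans ?_ (mul_one t)
      rw [← h1, Finset.mul_sum]
      exact Finset.sum_congr rfl fun i _ => by ring
    have ht : Filter.Tendsto (fun t : ℝ => x + t • v) (𝓝[≠] 0) (𝓝 x) := by
      have h2 : Continuous fun t : ℝ => x + t • v := by fun_prop
      simpa using (h2.tendsto 0).mono_left nhdsWithin_le_nhds
    refine mem_closure_of_tendsto ht ?_
    by_cases h0 : eval x (modeMomentum n k) = 0
    · filter_upwards [self_mem_nhdsWithin] with t ht
      simpa [hv, h0] using ht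
    · have h3 : ∀ᶠ t : ℝ in 𝓝 0, eval x (modeMomentum n k) + t ≠ 0 :=
        ((continuous_const.add continuous_id).continuousAt (x := (0 : ℝ))).eventually_ne
          (by simpa using h0)
      filter_upwards [nhdsWithin_le_nhds h3] with t ht
      simpa [hv] using ht
  · intro x hx
    rw [Set.mem_iInter] at hx
    have hd : ∀ k c, eval x (pderiv (Sum.inr c) (modeEnergy n k)) =
        eval x (modeMomentum n k) * sineCoeff n k c := by
      intro k c
      have h1 : pderiv (Sum.inr c) (modePosition n k) = 0 := by
        simp [modePosition, pderiv_X]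
      have h2 : pderiv (Sum.inr c) (modeMomentum n k) = C (sineCoeff n k c) := by
        simp [modeMomentum, pderiv_X, Pi.single_apply]
      simp only [modeEnergy, map_add, pow_two, pderiv_mul, h1, h2, map_mul, eval_C]
      simp
      ring
    rw [Fintype.linearIndependent_iff]
    intro g hg l
    have h1 : ∀ c, ∑ k, g k * eval x (modeMomentum n k) * sineCoeff n k c = 0 := by
      intro c
      have h2 := congrFun hg (Sum.inr c)
      simp only [Finset.sum_apply, Pi.smul_apply, hd, smul_eq_mul, Pi.zero_apply] at h2
      simpa only [mul_assoc] using h2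
    have h3 : ∑ c, (∑ k, g k * eval x (modeMomentum n k) * sineCoeff n k c) * sineCoeff n l c =
        g l * eval x (modeMomentum n l) := by
      simp_rw [Finset.sum_mul]
      rw [Finset.sum_comm]
      simp_rw [mul_assoc, ← Finset.mul_sum, sum_sineCoeff_mul]
      simp
    simp only [h1, zero_mul, Finset.sum_const_zero] at h3
    exact (mul_eq_zero.1 h3.symm).resolve_right (hx l)

end FPU

/-! ### Taylor polynomials and their uniqueness. -/

namespace FPU
section Taylor

variable {ι : Type*} [Fintype ι]

/-- Euler's identity writes a form of positive degree as a combination of variables times its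
derivatives, so the induction never leaves the homogeneous polynomials. -/
theorem homogeneous_induction {P : ℕ → MvPolynomial ι ℝ → Prop} (zero : ∀ d, P d 0)
    (const : ∀ c, P 0 (C c)) (add : ∀ d p q, P d p → P d q → P d (p + q))
    (X_mul : ∀ d p i, p.IsHomogeneous d → P d p → P (d + 1) (X i * p))
    {d : ℕ} {p : MvPolynomial ι ℝ} (hp : p.IsHomogeneous d) : P d p := by
  induction d generalizing p with
  | zero =>
    rw [totalDegree_eq_zero_iff_eq_C.1 ((totalDegree_zero_iff_isHomogeneous ι).2 hp)]
    exact const _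
  | succ d ih =>
    have h1 : p = ∑ i, X i * (C ((d + 1 : ℝ)⁻¹) * pderiv i p) := by
      have h2 := hp.sum_X_mul_pderiv
      simp_rw [mul_left_comm _ (C _)]
      rw [← Finset.mul_sum, h2, ← smul_eq_C_mul, ← Nat.cast_smul_eq_nsmul ℝ, smul_smul]
      push_cast
      rw [inv_mul_cancel₀ (by positivity), one_smul]
    rw [h1]
    have h3 : ∀ s : Finset ι, P (d + 1) (∑ i ∈ s, X i * (C ((d + 1 : ℝ)⁻¹) * pderiv i p)) := by
      intro s
      induction s using Finset.cons_induction with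
      | empty => exact zero _
      | cons a s ha hs =>
        rw [Finset.sum_cons]
        have h4 : (C ((d + 1 : ℝ)⁻¹) * pderiv a p).IsHomogeneous d := hp.pderiv.C_mul _
        exact add _ _ _ (X_mul _ _ _ h4 (ih h4)) hs
    exact h3 _

theorem isBigO_apply (i : ι) : (fun x : ι → ℝ => x i) =O[𝓝 0] fun x => ‖x‖ :=
  IsBigO.of_bound' (Filter.Eventually.of_forall fun x => by
    simpa using norm_le_pi_norm x i)

theorem isBigO_pow_of_le {k m : ℕ} (h : k ≤ m) :
    (fun x : ι → ℝ => ‖x‖ ^ m) =O[𝓝 0] fun x => ‖x‖ ^ k := by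
  refine IsBigO.of_bound' ?_
  filter_upwards [Metric.ball_mem_nhds (0 : ι → ℝ) one_pos] with x hx
  rw [mem_ball_zero_iff] at hx
  rw [Real.norm_of_nonneg (by positivity), Real.norm_of_nonneg (by positivity)]
  exact pow_le_pow_of_le_one (norm_nonneg _) hx.le h

theorem isBigO_eval {k : ℕ} {p : MvPolynomial ι ℝ} (hp : p.IsHomogeneous k) :
    (fun x => eval x p) =O[𝓝 0] fun x : ι → ℝ => ‖x‖ ^ k := by
  refine homogeneous_induction (P := fun k p => (fun x => eval x p) =O[𝓝 0] fun x : ι → ℝ => ‖x‖ ^ k)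
    (fun d => ?_) (fun c => ?_) (fun d p q h1 h2 => ?_) (fun d p i _ h => ?_) hp
  · simpa using isBigO_zero _ _
  · simpa using isBigO_const_const c (one_ne_zero (α := ℝ)) (𝓝 (0 : ι → ℝ))
  · simpa using h1.add h2
  · simpa [pow_succ'] using (isBigO_apply i).mul h

theorem isBigO_eval_of_le {k m : ℕ} (h : k ≤ m) {p : MvPolynomial ι ℝ} (hp : p.IsHomogeneous m) :
    (fun x => eval x p) =O[𝓝 0] fun x : ι → ℝ => ‖x‖ ^ k :=
  (isBigO_eval hp).trans (isBigO_pow_of_le h)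

theorem eval_smul_of_isHomogeneous {k : ℕ} {p : MvPolynomial ι ℝ} (hp : p.IsHomogeneous k) (t : ℝ)
    (x : ι → ℝ) : eval (t • x) p = t ^ k * eval x p := by
  refine homogeneous_induction (P := fun k p => eval (t • x) p = t ^ k * eval x p)
    (fun d => ?_) (fun c => ?_) (fun d p q h1 h2 => ?_) (fun d p i _ h => ?_) hp
  · simp
  · simp
  · simp only [map_add, h1, h2]; ring
  · simp only [map_mul, eval_X, h, Pi.smul_apply, smul_eq_mul]; ring

/-- On the ray through x the value is t^k p(x), which is O(t^(k+1)) only if p(x) = 0. -/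
theorem eq_zero_of_isBigO {k : ℕ} {p : MvPolynomial ι ℝ} (hp : p.IsHomogeneous k)
    (h : (fun x => eval x p) =O[𝓝 0] fun x : ι → ℝ => ‖x‖ ^ (k + 1)) : p = 0 := by
  refine MvPolynomial.funext fun x => ?_
  rw [map_zero]
  have ht : Filter.Tendsto (fun t : ℝ => t • x) (𝓝[≠] 0) (𝓝 0) := by
    have h2 : Continuous fun t : ℝ => t • x := by fun_prop
    simpa using (h2.tendsto 0).mono_left nhdsWithin_le_nhds
  have h1 := h.comp_tendsto ht
  have h3 : (fun _ : ℝ => eval x p) =O[𝓝[≠] 0] fun t : ℝ => t := by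
    have h4 : (fun t : ℝ => (t ^ k)⁻¹ * eval (t • x) p) =O[𝓝[≠] 0]
        fun t : ℝ => (t ^ k)⁻¹ * ‖t • x‖ ^ (k + 1) := (isBigO_refl _ _).mul h1
    refine (h4.congr' ?_ .rfl).trans ?_
    · filter_upwards [self_mem_nhdsWithin] with t ht
      have ht : t ≠ 0 := ht
      rw [eval_smul_of_isHomogeneous hp, inv_mul_cancel_left₀ (pow_ne_zero _ ht)]
    · refine IsBigO.of_bound (‖x‖ ^ (k + 1)) ?_
      filter_upwards [self_mem_nhdsWithin] with t ht
      have ht : ‖t‖ ≠ 0 := norm_ne_zero_iff.2 ht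
      rw [norm_mul, norm_inv, norm_pow, norm_pow, norm_norm, norm_smul]
      apply le_of_eq
      field_simp
      ring
  have h5 : Filter.Tendsto (fun _ : ℝ => eval x p) (𝓝[≠] 0) (𝓝 0) :=
    h3.trans_tendsto (Filter.tendsto_id.mono_right nhdsWithin_le_nhds)
  exact tendsto_nhds_unique tendsto_const_nhds h5

theorem isBigO_sub_sum_homogeneousComponent (p : MvPolynomial ι ℝ) (m : ℕ) :
    (fun x => eval x p - eval x (∑ k ∈ Finset.range m, homogeneousComponent k p)) =O[𝓝 0]
      fun x : ι → ℝ => ‖x‖ ^ m := by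
  by_cases hm : m ≤ p.totalDegree + 1
  · have h1 : ∀ x : ι → ℝ, eval x p - eval x (∑ k ∈ Finset.range m, homogeneousComponent k p) =
        ∑ k ∈ Finset.Ico m (p.totalDegree + 1), eval x (homogeneousComponent k p) := by
      intro x
      have h2 := congrArg (eval x) (sum_homogeneousComponent p)
      rw [← Finset.sum_range_add_sum_Ico _ hm, map_add] at h2
      rw [← h2, add_sub_cancel_left, map_sum]
    simp_rw [h1]
    refine IsBigO.fun_sum fun k hk => isBigO_eval_of_le (Finset.mem_Ico.1 hk).1
      (homogeneousComponent_isHomogeneous k p)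
  · have h1 : ∑ k ∈ Finset.range m, homogeneousComponent k p = p := by
      conv_rhs => rw [← sum_homogeneousComponent p]
      refine (Finset.sum_subset (Finset.range_subset_range.2 (by omega)) fun k _ hk => ?_).symm
      exact homogeneousComponent_eq_zero _ _ (by simpa using hk)
    simpa [h1] using isBigO_zero _ _

theorem homogeneousComponent_eq_zero_of_isBigO {m : ℕ} {p : MvPolynomial ι ℝ}
    (h : (fun x => eval x p) =O[𝓝 0] fun x : ι → ℝ => ‖x‖ ^ m) {k : ℕ} (hk : k < m) :
    homogeneousComponent k p = 0 := by
  induction k using Nat.strong_induction_on with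
  | _ k ih =>
    refine eq_zero_of_isBigO (homogeneousComponent_isHomogeneous k p) ?_
    have h1 := (h.trans (isBigO_pow_of_le hk)).sub (isBigO_sub_sum_homogeneousComponent p (k + 1))
    rw [Finset.sum_range_succ, Finset.sum_eq_zero fun j hj =>
      ih j (Finset.mem_range.1 hj) ((Finset.mem_range.1 hj).trans hk)] at h1
    simpa using h1

omit [Fintype ι] in
theorem homogeneousComponent_pderiv (d : ℕ) (i : ι) (p : MvPolynomial ι ℝ) :
    homogeneousComponent d (pderiv i p) = pderiv i (homogeneousComponent (d + 1) p) := by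
  ext s
  rw [coeff_homogeneousComponent, coeff_pderiv, coeff_pderiv, coeff_homogeneousComponent]
  have h : (s + Finsupp.single i 1).degree = s.degree + 1 := by simp
  rw [h]
  by_cases hs : s.degree = d <;> simp [hs]

/-- The Poincaré lemma for forms with homogeneous coefficients: closedness turns ∂_j ∑ x_i a_i into
a_j + ∑ x_i ∂_i a_j, and Euler's identity makes this (d + 1) a_j. -/
theorem exists_potential_of_isHomogeneous [DecidableEq ι] {d : ℕ} {a : ι → MvPolynomial ι ℝ}
    (ha : ∀ i, (a i).IsHomogeneous d) (hc : ∀ i j, pderiv i (a j) = pderiv j (a i)) :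
    ∃ F : MvPolynomial ι ℝ, F.IsHomogeneous (d + 1) ∧ ∀ i, pderiv i F = a i := by
  refine ⟨C ((d + 1 : ℝ)⁻¹) * ∑ i, X i * a i, ?_, fun j => ?_⟩
  · refine IsHomogeneous.C_mul (IsHomogeneous.sum _ _ _ fun i _ => ?_) _
    rw [add_comm]
    exact (isHomogeneous_X _ i).mul (ha i)
  · have h1 : pderiv j (∑ i, X i * a i) = (d + 1) • a j := by
      simp only [map_sum, pderiv_mul, pderiv_X, hc j, Finset.sum_add_distrib,
        (ha j).sum_X_mul_pderiv, Pi.single_apply, ite_mul, one_mul, zero_mul]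
      rw [Finset.sum_ite_eq' Finset.univ j, if_pos (Finset.mem_univ _), add_comm, succ_nsmul]
    rw [pderiv_C_mul, h1, ← smul_eq_C_mul, ← Nat.cast_smul_eq_nsmul ℝ, smul_smul]
    push_cast
    rw [inv_mul_cancel₀ (by positivity), one_smul]

theorem hasFDerivAt_eval (p : MvPolynomial ι ℝ) (x : ι → ℝ) :
    HasFDerivAt (fun y => eval y p)
      (∑ i, eval x (pderiv i p) • ContinuousLinearMap.proj (R := ℝ) (φ := fun _ : ι => ℝ) i) x := by
  classical
  induction p using MvPolynomial.induction_on with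
  | C c => simpa using hasFDerivAt_const c x
  | add p q hp hq =>
    simp only [map_add, add_smul, Finset.sum_add_distrib]
    exact hp.add hq
  | mul_X p j hp =>
    have h1 := hp.mul (hasFDerivAt_apply j x)
    simp only [map_mul, eval_X]
    refine h1.congr_fderiv ?_
    simp only [pderiv_mul, map_add, map_mul, eval_X, add_smul, Finset.sum_add_distrib, pderiv_X,
      Pi.single_apply, apply_ite (eval x), map_zero, mul_ite, mul_one, mul_zero, ite_smul,
      zero_smul, Finset.sum_ite_eq, Finset.mem_univ, if_true, Finset.smul_sum, smul_smul,
      mul_comm (x j)]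
    rw [add_comm]

theorem fderiv_eval_single [DecidableEq ι] (p : MvPolynomial ι ℝ) (x : ι → ℝ) (i : ι) :
    fderiv ℝ (fun y => eval y p) x (Pi.single i 1) = eval x (pderiv i p) := by
  rw [(hasFDerivAt_eval p x).fderiv]
  simp [Pi.single_apply]

theorem contDiff_eval (p : MvPolynomial ι ℝ) : ContDiff ℝ ∞ fun x => eval x p := by
  induction p using MvPolynomial.induction_on with
  | C c => simpa using contDiff_const
  | add p q hp hq => simpa using hp.add hq
  | mul_X p j hp => simpa using hp.mul (contDiff_apply ℝ ℝ j)

theorem isBigO_of_fderiv [DecidableEq ι] {f : (ι → ℝ) → ℝ} {m : ℕ}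
    (hf : ∀ᶠ x in 𝓝 0, DifferentiableAt ℝ f x) (h0 : f 0 = 0)
    (h : ∀ i, (fun x => fderiv ℝ f x (Pi.single i 1)) =O[𝓝 0] fun x : ι → ℝ => ‖x‖ ^ m) :
    f =O[𝓝 0] fun x : ι → ℝ => ‖x‖ ^ (m + 1) := by
  have h1 : (fun x => fderiv ℝ f x) =O[𝓝 0] fun x : ι → ℝ => ‖x‖ ^ m := by
    have h2 : ∀ x, fderiv ℝ f x = ∑ i, fderiv ℝ f x (Pi.single i 1) •
        ContinuousLinearMap.proj (R := ℝ) (φ := fun _ : ι => ℝ) i := by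
      refine fun x => ContinuousLinearMap.ext fun v => ?_
      have h3 := congrArg (fderiv ℝ f x) (pi_eq_sum_univ' v)
      rw [map_sum] at h3
      rw [h3]
      simp only [sum_apply, smul_apply, map_smul, smul_eq_mul, ContinuousLinearMap.proj_apply]
      exact Finset.sum_congr rfl fun i _ => mul_comm _ _
    refine IsBigO.congr_left ?_ fun x => (h2 x).symm
    refine IsBigO.fun_sum fun i _ => ?_
    refine IsBigO.trans (IsBigO.of_bound ‖ContinuousLinearMap.proj (R := ℝ) (φ := fun _ : ι => ℝ) i‖
      (Filter.Eventually.of_forall fun x => ?_)) (h i)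
    rw [norm_smul, mul_comm]
  obtain ⟨c, hc⟩ := h1.bound
  refine IsBigO.of_bound c ?_
  obtain ⟨ε, hε, hball⟩ := Metric.eventually_nhds_iff_ball.1 (hc.and hf)
  filter_upwards [Metric.ball_mem_nhds (0 : ι → ℝ) hε] with x hx
  have hc0 : ∀ y ∈ Metric.closedBall (0 : ι → ℝ) ‖x‖, y ∈ Metric.ball (0 : ι → ℝ) ε := by
    intro y hy
    rw [mem_closedBall_zero_iff] at hy
    rw [mem_ball_zero_iff] at hx ⊢
    exact hy.trans_lt hx
  -- A bounding constant need not be nonnegative; if it is negative, the estimate on the derivative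
  -- leaves only x = 0.
  by_cases hcn : 0 ≤ c
  · have h3 := (convex_closedBall (0 : ι → ℝ) ‖x‖).norm_image_sub_le_of_norm_fderiv_le (𝕜 := ℝ)
      (f := f) (C := c * ‖x‖ ^ m) (x := 0) (y := x)
      (fun y hy => (hball y (hc0 y hy)).2) (fun y hy => by
        refine (hball y (hc0 y hy)).1.trans ?_
        rw [norm_pow, norm_norm]
        have := mem_closedBall_zero_iff.1 hy
        gcongr) (by simp) (by simp)
    rw [h0, sub_zero, sub_zero] at h3
    rw [norm_pow, norm_norm, pow_succ, ← mul_assoc]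
    exact h3
  · have h4 := (hball x hx).1
    rw [norm_pow, norm_norm] at h4
    rw [norm_pow, norm_norm]
    by_cases hx0 : x = 0
    · simp [hx0, h0]
    · have h5 : 0 < ‖x‖ ^ m := by positivity
      nlinarith [norm_nonneg (fderiv ℝ f x)]

theorem isBigO_sub_eval [DecidableEq ι] {m : ℕ} {f : (ι → ℝ) → ℝ} {U : Set (ι → ℝ)}
    (hU : IsOpen U) (h0 : 0 ∈ U) (hf : ContDiffOn ℝ ∞ f U) {q : MvPolynomial ι ℝ}
    (hq : f 0 = eval 0 q)
    (h : ∀ i, (fun x => fderiv ℝ f x (Pi.single i 1) - eval x (pderiv i q)) =O[𝓝 0]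
      fun x => ‖x‖ ^ m) : (fun x => f x - eval x q) =O[𝓝 0] fun x => ‖x‖ ^ (m + 1) := by
  have hd : ∀ x ∈ U, DifferentiableAt ℝ f x := fun x hx =>
    (hf.contDiffAt (hU.mem_nhds hx)).differentiableAt (by simp)
  refine isBigO_of_fderiv ?_ (by simp [hq]) fun i => (h i).congr' ?_ .rfl
  · filter_upwards [hU.mem_nhds h0] with x hx
    exact (hd x hx).sub (hasFDerivAt_eval q x).differentiableAt
  · filter_upwards [hU.mem_nhds h0] with x hx
    rw [fderiv_fun_sub (hd x hx) (hasFDerivAt_eval q x).differentiableAt, sub_apply,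
      fderiv_eval_single]

/-- Induction on the order: expand the partial derivatives, observe that symmetry of the second
derivative makes these expansions a closed form up to the relevant degree, and integrate. The bound
on derivatives drives the induction, and later lets symplecticity be tested on the jet. -/
theorem exists_taylor [DecidableEq ι] (m : ℕ) {f : (ι → ℝ) → ℝ} {U : Set (ι → ℝ)} (hU : IsOpen U)
    (h0 : 0 ∈ U) (hf : ContDiffOn ℝ ∞ f U) : ∃ p : MvPolynomial ι ℝ,
      ((fun x => f x - eval x p) =O[𝓝 0] fun x => ‖x‖ ^ (m + 1)) ∧
      ∀ i, (fun x => fderiv ℝ f x (Pi.single i 1) - eval x (pderiv i p)) =O[𝓝 0]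
        fun x => ‖x‖ ^ m := by
  induction m generalizing f with
  | zero =>
    have hfd : ContDiffOn ℝ ∞ (fderiv ℝ f) U := hf.fderiv_of_isOpen hU (by simp)
    have hfi : ∀ i, ContDiffOn ℝ ∞ (fun x => fderiv ℝ f x (Pi.single i 1)) U := fun i =>
      hfd.clm_apply contDiffOn_const
    have h1 : ∀ i, (fun x => fderiv ℝ f x (Pi.single i 1) - eval x (pderiv i (C (f 0)))) =O[𝓝 0]
        fun x : ι → ℝ => ‖x‖ ^ 0 := by
      intro i
      have h2 := ((hfi i).continuousOn.continuousAt (hU.mem_nhds h0)).isBigO_one ℝ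
      simpa using h2
    refine ⟨C (f 0), ?_, h1⟩
    exact isBigO_sub_eval hU h0 hf (by simp) h1
  | succ m ih =>
    have hfd : ContDiffOn ℝ ∞ (fderiv ℝ f) U := hf.fderiv_of_isOpen hU (by simp)
    have hfi : ∀ i, ContDiffOn ℝ ∞ (fun x => fderiv ℝ f x (Pi.single i 1)) U := fun i =>
      hfd.clm_apply contDiffOn_const
    choose a ha ha' using fun i => ih (hfi i)
    have hsymm : ∀ i j, (fun x => fderiv ℝ (fun x => fderiv ℝ f x (Pi.single i 1)) x
        (Pi.single j 1)) =ᶠ[𝓝 0] fun x => fderiv ℝ (fun x => fderiv ℝ f x (Pi.single j 1)) x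
        (Pi.single i 1) := by
      intro i j
      filter_upwards [hU.mem_nhds h0] with x hx
      have h1 : DifferentiableAt ℝ (fderiv ℝ f) x :=
        (hfd.contDiffAt (hU.mem_nhds hx)).differentiableAt (by simp)
      have h2 : IsSymmSndFDerivAt ℝ f x :=
        (hf.contDiffAt (hU.mem_nhds hx)).isSymmSndFDerivAt
          (by rw [minSmoothness_of_isRCLikeNormedField]; exact ENat.LEInfty.out)
      have h3 : ∀ i j, fderiv ℝ (fun x => fderiv ℝ f x (Pi.single i 1)) x (Pi.single j 1) =
          fderiv ℝ (fderiv ℝ f) x (Pi.single j 1) (Pi.single i 1) := by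
        intro i j
        rw [fderiv_clm_apply h1 (differentiableAt_const _)]
        simp
      rw [h3, h3]
      exact h2 _ _
    have hclosed : ∀ i j, ∀ k < m, pderiv j (homogeneousComponent (k + 1) (a i)) =
        pderiv i (homogeneousComponent (k + 1) (a j)) := by
      intro i j k hk
      rw [← homogeneousComponent_pderiv, ← homogeneousComponent_pderiv, ← sub_eq_zero, ← map_sub]
      refine homogeneousComponent_eq_zero_of_isBigO (m := m) ?_ hk
      refine ((ha' j i).sub (ha' i j)).congr' ?_ .rfl
      filter_upwards [hsymm i j] with x hx
      rw [hx, map_sub]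
      ring
    have hpot : ∀ k : ℕ, ∃ F : MvPolynomial ι ℝ, F.IsHomogeneous (k + 1) ∧
        (k < m + 1 → ∀ i, pderiv i F = homogeneousComponent k (a i)) := by
      intro k
      by_cases hk : k < m + 1
      · obtain ⟨F, hF, hF'⟩ := exists_potential_of_isHomogeneous (d := k)
          (a := fun i => homogeneousComponent k (a i))
          (fun i => homogeneousComponent_isHomogeneous k _) fun i j => by
            rcases k with - | k
            · simp
            · exact hclosed j i k (by omega)
        exact ⟨F, hF, fun _ => hF'⟩
      · exact ⟨0, isHomogeneous_zero _ _ _, fun h => absurd h hk⟩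
    choose F hF hF' using hpot
    have h1 : ∀ i, (fun x => fderiv ℝ f x (Pi.single i 1) -
        eval x (pderiv i (C (f 0) + ∑ k ∈ Finset.range (m + 1), F k))) =O[𝓝 0]
        fun x => ‖x‖ ^ (m + 1) := by
      intro i
      have h2 : pderiv i (C (f 0) + ∑ k ∈ Finset.range (m + 1), F k) =
          ∑ k ∈ Finset.range (m + 1), homogeneousComponent k (a i) := by
        rw [map_add, pderiv_C, zero_add, map_sum]
        exact Finset.sum_congr rfl fun k hk => hF' k (Finset.mem_range.1 hk) i
      rw [h2]
      refine ((ha i).add (isBigO_sub_sum_homogeneousComponent (a i) (m + 1))).congr_left fun x => ?_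
      ring
    refine ⟨C (f 0) + ∑ k ∈ Finset.range (m + 1), F k, ?_, h1⟩
    refine isBigO_sub_eval hU h0 hf ?_ h1
    have h5 : ∀ k, eval (0 : ι → ℝ) (F k) = 0 := fun k => by
      have := eval_smul_of_isHomogeneous (hF k) 0 0
      simpa using this
    rw [map_add, eval_C, map_sum, Finset.sum_eq_zero fun k _ => h5 k, add_zero]

end Taylor

/-! ### Second-order jets of compositions. -/

theorem poisson_X_inl_left (f : Poly n) (i : Fin n) :
    poisson (X (Sum.inl i)) f = pderiv (Sum.inr i) f := by
  rw [poisson_antisymm, poisson_X_inl, neg_neg]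

theorem poisson_X_inr_left (f : Poly n) (i : Fin n) :
    poisson (X (Sum.inr i)) f = -pderiv (Sum.inl i) f := by
  rw [poisson_antisymm, poisson_X_inr]

theorem poisson_isHomogeneous_right {f F : Poly n} {d b : ℕ} (hf : f.IsHomogeneous d)
    (hF : F.IsHomogeneous (b + 2)) : (poisson f F).IsHomogeneous (d + b) := by
  rcases d with - | d
  · rw [totalDegree_eq_zero_iff_eq_C.1 ((totalDegree_zero_iff_isHomogeneous _).2 hf),
      poisson_C_left]
    exact isHomogeneous_zero _ _ _
  · have h := poisson_isHomogeneous (a := d) (b := b + 1) hf hF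
    rwa [add_comm b 1, ← add_assoc] at h

theorem pderiv_poisson (u : Fin n ⊕ Fin n) (f g : Poly n) :
    pderiv u (poisson f g) = poisson (pderiv u f) g + poisson f (pderiv u g) := by
  simp only [poisson, map_sum, map_sub, pderiv_mul, pderiv_pderiv_comm u,
    ← Finset.sum_add_distrib]
  exact Finset.sum_congr rfl fun i _ => by ring

/-- The second order jet of the composition of `f` with a symplectic map which is tangent to the
identity and is generated by `F` (in degree three) and `G` (in degree four). -/
noncomputable def flowJet (F G f : Poly n) : Poly n :=
  f + poisson f F + (C (1 / 2) * poisson (poisson f F) F + poisson f G)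

theorem flowJet_add (F G f g : Poly n) : flowJet F G (f + g) = flowJet F G f + flowJet F G g := by
  simp only [flowJet, poisson_add_left]
  ring

theorem flowJet_C (F G : Poly n) (c : ℝ) : flowJet F G (C c) = C c := by
  have h : poisson 0 F = 0 := by simpa using poisson_C_left F 0
  simp [flowJet, poisson_C_left, h]

/-- Brackets with F and G are derivations, and half the double bracket of a product contains the
cross term {f, F}{g, F} exactly once. Hence `flowJet` is multiplicative up to terms raising the
degree by at least three. -/
theorem flowJet_mul_sub (F G f g : Poly n) :
    flowJet F G f * flowJet F G g - flowJet F G (f * g) =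
      poisson f F * (C (1 / 2) * poisson (poisson g F) F + poisson g G) +
      (C (1 / 2) * poisson (poisson f F) F + poisson f G) * poisson g F +
      (C (1 / 2) * poisson (poisson f F) F + poisson f G) *
        (C (1 / 2) * poisson (poisson g F) F + poisson g G) := by
  have h : (C (1 / 2) * 2 : Poly n) = 1 := by
    rw [← map_ofNat C 2, ← C_mul]
    norm_num
  simp only [flowJet, poisson_mul_left, poisson_add_left]
  linear_combination (-poisson f F * poisson g F) * h

section

variable {F G : Poly n} (hF : F.IsHomogeneous 3) (hG : G.IsHomogeneous 4)
include hF hG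

theorem flowJet_second_isHomogeneous {f : Poly n} {d : ℕ} (hf : f.IsHomogeneous d) :
    (C (1 / 2) * poisson (poisson f F) F + poisson f G).IsHomogeneous (d + 2) :=
  ((poisson_isHomogeneous_right (b := 1) (poisson_isHomogeneous_right (b := 1) hf hF) hF).C_mul
    _).add (poisson_isHomogeneous_right (b := 2) hf hG)

theorem isBigO_flowJet {f : Poly n} {d : ℕ} (hf : f.IsHomogeneous d) :
    (fun x => eval x (flowJet F G f)) =O[𝓝 0] fun x : Phase n => ‖x‖ ^ d := by
  simp only [flowJet, map_add (eval _) (f + _), map_add (eval _) f]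
  exact ((isBigO_eval hf).add (isBigO_eval_of_le (Nat.le_add_right d 1)
    (poisson_isHomogeneous_right (b := 1) hf hF))).add
    (isBigO_eval_of_le (Nat.le_add_right d 2) (flowJet_second_isHomogeneous hF hG hf))

theorem isBigO_flowJet_mul_sub {f g : Poly n} {d e : ℕ} (hf : f.IsHomogeneous d)
    (hg : g.IsHomogeneous e) :
    (fun x => eval x (flowJet F G f) * eval x (flowJet F G g) - eval x (flowJet F G (f * g)))
      =O[𝓝 0] fun x : Phase n => ‖x‖ ^ (d + e + 3) := by
  simp_rw [← map_mul, ← map_sub]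
  rw [flowJet_mul_sub]
  have h1 {k : Poly n} {c : ℕ} (hk : k.IsHomogeneous c) :=
    poisson_isHomogeneous_right (b := 1) hk hF
  have h2 {k : Poly n} {c : ℕ} (hk : k.IsHomogeneous c) := flowJet_second_isHomogeneous hF hG hk
  simp only [map_add (eval _) (_ + _) (_ * _), map_add (eval _) (_ * _) (_ * _)]
  exact ((isBigO_eval_of_le (by omega) ((h1 hf).mul (h2 hg))).add
    (isBigO_eval_of_le (by omega) ((h2 hf).mul (h1 hg)))).add
    (isBigO_eval_of_le (by omega) ((h2 hf).mul (h2 hg)))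

/-- The second order expansion of a homogeneous polynomial under a near identity map. -/
theorem isBigO_eval_comp_sub_flowJet {Φ : Phase n → Phase n}
    (hΦ : ∀ a, (fun x => Φ x a - eval x (flowJet F G (X a))) =O[𝓝 0] fun x => ‖x‖ ^ 4)
    {d : ℕ} {f : Poly n} (hf : f.IsHomogeneous d) :
    (fun x => eval (Φ x) f - eval x (flowJet F G f)) =O[𝓝 0] fun x => ‖x‖ ^ (d + 3) := by
  refine homogeneous_induction (P := fun d f => (fun x => eval (Φ x) f - eval x (flowJet F G f))
    =O[𝓝 0] fun x => ‖x‖ ^ (d + 3)) (fun d => ?_) (fun c => ?_) (fun d p q h1 h2 => ?_)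
    (fun d p i hp h => ?_) hf
  · have h0 := flowJet_C F G 0
    rw [C_0] at h0
    simpa [h0] using isBigO_zero _ _
  · simpa [flowJet_C] using isBigO_zero _ _
  · refine (h1.add h2).congr_left fun x => ?_
    rw [flowJet_add, map_add, map_add]
    ring
  -- Three errors add up: that of the new variable, that of p, and the defect of multiplicativity of
  -- `flowJet`.
  · have hX := isHomogeneous_X ℝ i
    have h1 : (fun x => eval (Φ x) p) =O[𝓝 0] fun x => ‖x‖ ^ d :=
      ((h.trans (isBigO_pow_of_le (Nat.le_add_right d 3))).add
        (isBigO_flowJet hF hG hp)).congr_left fun x => by ring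
    have h2 := ((hΦ i).mul h1).congr_right (g₂ := fun x => ‖x‖ ^ (d + 1 + 3)) fun x => by ring
    have h3 := ((isBigO_flowJet hF hG hX).mul h).congr_right
      (g₂ := fun x => ‖x‖ ^ (d + 1 + 3)) fun x => by ring
    have h4 := (isBigO_flowJet_mul_sub hF hG hX hp).congr_right
      (g₂ := fun x => ‖x‖ ^ (d + 1 + 3)) fun x => by ring
    refine ((h2.add h3).add h4).congr_left fun x => ?_
    rw [map_mul, eval_X]
    ring

end

/-! ### Symplectic jets are generated by Hamiltonians. -/

/-- The symplectic form on vectors of polynomials. -/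
noncomputable def polySymplecticForm (a b : Fin n ⊕ Fin n → Poly n) : Poly n :=
  ∑ i, (a (Sum.inl i) * b (Sum.inr i) - a (Sum.inr i) * b (Sum.inl i))

/-- The covector field dual to a vector field. -/
noncomputable def flat (a : Fin n ⊕ Fin n → Poly n) : Fin n ⊕ Fin n → Poly n :=
  Sum.elim (fun i => a (Sum.inr i)) (fun i => -a (Sum.inl i))

theorem polySymplecticForm_X_left (u : Fin n ⊕ Fin n) (b : Fin n ⊕ Fin n → Poly n) :
    polySymplecticForm (fun a => pderiv u (X a)) b = flat b u := by
  classical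
  rcases u with i | i <;> simp [polySymplecticForm, flat, pderiv_X, Pi.single_apply]

theorem polySymplecticForm_X_right (u : Fin n ⊕ Fin n) (b : Fin n ⊕ Fin n → Poly n) :
    polySymplecticForm b (fun a => pderiv u (X a)) = -flat b u := by
  classical
  rcases u with i | i <;> simp [polySymplecticForm, flat, pderiv_X, Pi.single_apply]

theorem flat_pderiv (u v : Fin n ⊕ Fin n) (a : Fin n ⊕ Fin n → Poly n) :
    flat (fun c => pderiv v (a c)) u = pderiv v (flat a u) := by
  rcases u with i | i <;> simp [flat]

theorem flat_isHomogeneous {d : ℕ} {a : Fin n ⊕ Fin n → Poly n} (ha : ∀ c, (a c).IsHomogeneous d)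
    (u : Fin n ⊕ Fin n) : (flat a u).IsHomogeneous d := by
  rcases u with i | i
  · exact ha _
  · exact (ha _).neg

theorem exists_poisson_of_closed {d : ℕ} {a : Fin n ⊕ Fin n → Poly n}
    (ha : ∀ c, (a c).IsHomogeneous d)
    (hc : ∀ u v, pderiv v (flat a u) = pderiv u (flat a v)) :
    ∃ F : Poly n, F.IsHomogeneous (d + 1) ∧ ∀ c, a c = poisson (X c) F := by
  obtain ⟨F, hF, h⟩ := exists_potential_of_isHomogeneous (flat_isHomogeneous ha)
    fun u v => hc v u
  refine ⟨-F, hF.neg, fun c => ?_⟩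
  rcases c with i | i
  · rw [poisson_X_inl_left, map_neg, h]
    simp [flat]
  · rw [poisson_X_inr_left, map_neg, h]
    simp [flat]

theorem polySymplecticForm_pderiv_poisson (F : Poly n) (u v : Fin n ⊕ Fin n) :
    polySymplecticForm (fun c => pderiv u (poisson (X c) F)) (fun c => pderiv v (poisson (X c) F)) =
      poisson (pderiv u F) (pderiv v F) := by
  rw [polySymplecticForm, poisson]
  refine Finset.sum_congr rfl fun i _ => ?_
  rw [poisson_X_inl_left, poisson_X_inr_left, map_neg, map_neg, pderiv_pderiv_comm u,
    pderiv_pderiv_comm v, pderiv_pderiv_comm u, pderiv_pderiv_comm v]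
  ring

theorem flat_poisson (F : Poly n) (u : Fin n ⊕ Fin n) :
    flat (fun c => poisson (X c) F) u = -pderiv u F := by
  rcases u with i | i
  · exact poisson_X_inr_left F i
  · exact congrArg Neg.neg (poisson_X_inl_left F i)

theorem flat_sub_C_mul_poisson (c : ℝ) (F : Poly n) (a b : Fin n ⊕ Fin n → Poly n)
    (u : Fin n ⊕ Fin n) : flat (fun k => a k - C c * poisson (b k) F) u =
      flat a u - C c * poisson (flat b u) F := by
  rcases u with i | i
  · rfl
  · have h : poisson (-b (Sum.inl i)) F = -poisson (b (Sum.inl i)) F := by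
      simpa using poisson_smul_left (-1) (b (Sum.inl i)) F
    simp only [flat, Sum.elim_inr, h]
    ring

/-- The jets of a vector-valued map that is symplectic up to order two are generated by
Hamiltonians. -/
theorem exists_generators {g h : Fin n ⊕ Fin n → Poly n} (hg : ∀ a, (g a).IsHomogeneous 2)
    (hh : ∀ a, (h a).IsHomogeneous 3)
    (h1 : ∀ u v, pderiv v (flat g u) - pderiv u (flat g v) = 0)
    (h2 : ∀ u v, pderiv v (flat h u) - pderiv u (flat h v) +
      polySymplecticForm (fun c => pderiv u (g c)) (fun c => pderiv v (g c)) = 0) :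
    ∃ F G : Poly n, F.IsHomogeneous 3 ∧ G.IsHomogeneous 4 ∧
      ∀ a, X a + g a + h a = flowJet F G (X a) := by
  obtain ⟨F, hF, hgF⟩ := exists_poisson_of_closed hg fun u v => sub_eq_zero.1 (h1 u v)
  -- The generator F already accounts for half the double bracket in degree three. The curl of that
  -- term cancels the quadratic term of `h2`, so the remainder is closed.
  obtain ⟨G, hG, hhG⟩ := exists_poisson_of_closed (d := 3)
    (a := fun a => h a - C (1 / 2) * poisson (g a) F)
    (fun a => (hh a).sub ((poisson_isHomogeneous_right (b := 1) (hg a) hF).C_mul _)) (by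
      intro u v
      have hflat : ∀ u, flat g u = -pderiv u F := fun u => by
        rw [funext hgF, flat_poisson]
      have hneg : ∀ f : Poly n, poisson (-f) F = -poisson f F := fun f => by
        simpa using poisson_smul_left (-1) f F
      have h3 := h2 u v
      rw [funext hgF, polySymplecticForm_pderiv_poisson] at h3
      rw [flat_sub_C_mul_poisson, flat_sub_C_mul_poisson, hflat, hflat, hneg, hneg, map_sub, map_sub,
        pderiv_C_mul, pderiv_C_mul, map_neg, map_neg, pderiv_poisson, pderiv_poisson,
        pderiv_pderiv_comm v u, poisson_antisymm (pderiv v F)]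
      have h : (C (1 / 2) * 2 : Poly n) = 1 := by
        rw [← map_ofNat C 2, ← C_mul]
        norm_num
      linear_combination h3 + poisson (pderiv u F) (pderiv v F) * h)
  refine ⟨F, G, hF, hG, fun a => ?_⟩
  rw [flowJet, ← hhG, ← hgF]
  ring

theorem eval_polySymplecticForm (x : Phase n) (a b : Fin n ⊕ Fin n → Poly n) :
    eval x (polySymplecticForm a b) =
      symplecticForm (fun c => eval x (a c)) (fun c => eval x (b c)) := by
  simp [polySymplecticForm, symplecticForm]

theorem polySymplecticForm_add_left (a a' b : Fin n ⊕ Fin n → Poly n) :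
    polySymplecticForm (fun c => a c + a' c) b =
      polySymplecticForm a b + polySymplecticForm a' b := by
  simp only [polySymplecticForm, ← Finset.sum_add_distrib]
  exact Finset.sum_congr rfl fun i _ => by ring

theorem polySymplecticForm_add_right (a b b' : Fin n ⊕ Fin n → Poly n) :
    polySymplecticForm a (fun c => b c + b' c) =
      polySymplecticForm a b + polySymplecticForm a b' := by
  simp only [polySymplecticForm, ← Finset.sum_add_distrib]
  exact Finset.sum_congr rfl fun i _ => by ring

theorem polySymplecticForm_isHomogeneous {a b : Fin n ⊕ Fin n → Poly n} {d e : ℕ}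
    (ha : ∀ c, (a c).IsHomogeneous d) (hb : ∀ c, (b c).IsHomogeneous e) :
    (polySymplecticForm a b).IsHomogeneous (d + e) :=
  IsHomogeneous.sum _ _ _ fun _ _ => ((ha _).mul (hb _)).sub ((ha _).mul (hb _))

theorem pderiv_X_eq_C [DecidableEq (Fin n ⊕ Fin n)] (u a : Fin n ⊕ Fin n) :
    pderiv u (X a : Poly n) = C (Pi.single (M := fun _ => ℝ) u 1 a) := by
  rw [pderiv_X, Pi.single_apply, Pi.single_apply]
  by_cases h : u = a
  · simp [h]
  · simp [Ne.symm h]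

/-- A map whose partial derivatives are symplectic to second order has Hamiltonian jets. -/
theorem exists_generators_of_isBigO {g h : Fin n ⊕ Fin n → Poly n}
    (hg : ∀ a, (g a).IsHomogeneous 2) (hh : ∀ a, (h a).IsHomogeneous 3)
    (H : ∀ u v, (fun x => eval x (polySymplecticForm (fun a => pderiv u (X a + g a + h a))
      (fun a => pderiv v (X a + g a + h a))) - eval x (polySymplecticForm (fun a => pderiv u (X a))
      (fun a => pderiv v (X a)))) =O[𝓝 0] fun x : Phase n => ‖x‖ ^ 3) :
    ∃ F G : Poly n, F.IsHomogeneous 3 ∧ G.IsHomogeneous 4 ∧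
      ∀ a, X a + g a + h a = flowJet F G (X a) := by
  have hdg : ∀ u a, (pderiv u (g a)).IsHomogeneous 1 := fun u a => (hg a).pderiv
  have hdh : ∀ u a, (pderiv u (h a)).IsHomogeneous 2 := fun u a => (hh a).pderiv
  have h1 : ∀ u v, (pderiv v (flat g u) - pderiv u (flat g v)).IsHomogeneous 1 := fun u v =>
    (flat_isHomogeneous hg u).pderiv.sub (flat_isHomogeneous hg v).pderiv
  have h2 : ∀ u v, (pderiv v (flat h u) - pderiv u (flat h v) +
      polySymplecticForm (fun c => pderiv u (g c)) (fun c => pderiv v (g c))).IsHomogeneous 2 :=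
    fun u v => ((flat_isHomogeneous hh u).pderiv.sub (flat_isHomogeneous hh v).pderiv).add
      (polySymplecticForm_isHomogeneous (hdg u) (hdg v))
  have h3 : ∀ u v, (fun x => eval x (pderiv v (flat g u) - pderiv u (flat g v)) +
      eval x (pderiv v (flat h u) - pderiv u (flat h v) +
        polySymplecticForm (fun c => pderiv u (g c)) (fun c => pderiv v (g c)))) =O[𝓝 0]
      fun x : Phase n => ‖x‖ ^ 3 := by
    intro u v
    have h4 := isBigO_eval (polySymplecticForm_isHomogeneous (hdg u) (hdh v))
    have h5 := isBigO_eval (polySymplecticForm_isHomogeneous (hdh u) (hdg v))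
    have h6 := isBigO_eval_of_le (by norm_num : 3 ≤ 2 + 2)
      (polySymplecticForm_isHomogeneous (hdh u) (hdh v))
    refine ((H u v).sub ((h4.add h5).add h6)).congr_left fun x => ?_
    simp only [map_add (pderiv _), polySymplecticForm_add_left, polySymplecticForm_add_right]
    simp only [polySymplecticForm_X_left, polySymplecticForm_X_right, flat_pderiv, map_add (eval x),
      map_sub, map_neg]
    ring
  -- The symplectic defect is separated by degree: its linear part must vanish first, then its
  -- quadratic part.
  have h7 : ∀ u v, pderiv v (flat g u) - pderiv u (flat g v) = 0 := fun u v =>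
    eq_zero_of_isBigO (h1 u v) ((((h3 u v).trans (isBigO_pow_of_le (by norm_num))).sub
      (isBigO_eval (h2 u v))).congr_left fun x => by ring)
  refine exists_generators hg hh h7 fun u v => eq_zero_of_isBigO (h2 u v) ?_
  have h8 := h3 u v
  rw [h7] at h8
  simpa using h8


/-! ### Near-identity symplectic maps. -/

/-- A symplectic diffeomorphism of a neighbourhood of the origin which fixes the origin and is
tangent to the identity there. -/
structure IsNearIdentity (Φ : OpenPartialHomeomorph (Phase n) (Phase n)) : Prop where
  isSymplecticDiffeo : IsSymplecticDiffeo Φ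
  zero_mem_source : 0 ∈ Φ.source
  map_zero : Φ 0 = 0
  fderiv_zero : fderiv ℝ Φ 0 = ContinuousLinearMap.id ℝ (Phase n)

theorem eq_of_pderiv_eq {ι : Type*} [Fintype ι] {d : ℕ} {p q : MvPolynomial ι ℝ}
    (hp : p.IsHomogeneous (d + 1)) (hq : q.IsHomogeneous (d + 1))
    (h : ∀ i, pderiv i p = pderiv i q) : p = q := by
  have h1 := hp.sum_X_mul_pderiv
  rw [Finset.sum_congr rfl fun i _ => by rw [h i], hq.sum_X_mul_pderiv,
    ← Nat.cast_smul_eq_nsmul ℝ, ← Nat.cast_smul_eq_nsmul ℝ] at h1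
  exact (smul_right_injective _ (by positivity : ((d + 1 : ℕ) : ℝ) ≠ 0) h1).symm

theorem apply_zero_of_isBigO {ι : Type*} [Fintype ι] {f : (ι → ℝ) → ℝ} {m : ℕ}
    (h : f =O[𝓝 0] fun x => ‖x‖ ^ (m + 1)) : f 0 = 0 := by
  obtain ⟨c, hc⟩ := h.bound
  simpa using hc.self_of_nhds

theorem isBigO_symplecticForm_sub {A B A' B' : Fin n ⊕ Fin n → Phase n → ℝ} {m : ℕ}
    (hA : ∀ c, (fun x => A c x - A' c x) =O[𝓝 0] fun x => ‖x‖ ^ m)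
    (hB : ∀ c, (fun x => B c x - B' c x) =O[𝓝 0] fun x => ‖x‖ ^ m)
    (hA' : ∀ c, A' c =O[𝓝 0] fun _ => (1 : ℝ)) (hB' : ∀ c, B' c =O[𝓝 0] fun _ => (1 : ℝ)) :
    (fun x => symplecticForm (fun c => A c x) (fun c => B c x) -
      symplecticForm (fun c => A' c x) (fun c => B' c x)) =O[𝓝 0] fun x => ‖x‖ ^ m := by
  have h1 : (fun x : Phase n => ‖x‖ ^ m) =O[𝓝 0] fun _ => (1 : ℝ) := by
    simpa using isBigO_pow_of_le (ι := Fin n ⊕ Fin n) (Nat.zero_le m)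
  have key : ∀ c d, (fun x => A c x * B d x - A' c x * B' d x) =O[𝓝 0] fun x => ‖x‖ ^ m := by
    intro c d
    have hBd : B d =O[𝓝 0] fun _ => (1 : ℝ) :=
      (((hB d).trans h1).add (hB' d)).congr_left fun x => by ring
    have h2 := ((hA c).mul hBd).add (((hA' c).mul (hB d)).congr_right fun x => mul_comm _ _)
    refine h2.congr (fun x => by ring) fun x => by ring
  simp only [symplecticForm, ← Finset.sum_sub_distrib]
  refine IsBigO.fun_sum fun i _ => ?_
  exact ((key (Sum.inl i) (Sum.inr i)).sub (key (Sum.inr i) (Sum.inl i))).congr_left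
    fun x => by ring

/-- The Taylor polynomial approximates the derivative of Φ up to O(‖x‖³), so exact symplecticity of
Φ gives symplecticity of the jet to this order. -/
theorem IsNearIdentity.exists_flowJet {Φ : OpenPartialHomeomorph (Phase n) (Phase n)}
    (hΦ : IsNearIdentity Φ) : ∃ F G : Poly n, F.IsHomogeneous 3 ∧ G.IsHomogeneous 4 ∧
      ∀ a, (fun x => Φ x a - eval x (flowJet F G (X a))) =O[𝓝 0] fun x => ‖x‖ ^ 4 := by
  have hU := Φ.open_source
  have h0 := hΦ.zero_mem_source
  have hcd : ∀ a, ContDiffOn ℝ ∞ (fun x => Φ x a) Φ.source :=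
    contDiffOn_pi.1 hΦ.isSymplecticDiffeo.contDiffOn
  have hfd : ∀ x ∈ Φ.source, ∀ a v, fderiv ℝ (fun x => Φ x a) x v = fderiv ℝ Φ x v a := by
    intro x hx a v
    have h1 : DifferentiableAt ℝ Φ x := (hΦ.isSymplecticDiffeo.contDiffOn.contDiffAt
      (hU.mem_nhds hx)).differentiableAt (by simp)
    rw [(hasFDerivAt_pi'.1 h1.hasFDerivAt a).fderiv]
    rfl
  choose p hp hp' using fun a => exists_taylor 3 hU h0 (hcd a)
  have hcomp0 : ∀ a, homogeneousComponent 0 (p a) = 0 := by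
    intro a
    have h1 := apply_zero_of_isBigO (hp a)
    rw [hΦ.map_zero, Pi.zero_apply, zero_sub, neg_eq_zero, eval_zero, constantCoeff_eq] at h1
    rw [homogeneousComponent_zero, h1, C_0]
  have hcomp1 : ∀ a, homogeneousComponent 1 (p a) = X a := by
    intro a
    refine eq_of_pderiv_eq (d := 0) (homogeneousComponent_isHomogeneous _ _) (isHomogeneous_X _ a)
      fun u => ?_
    have h1 := apply_zero_of_isBigO (hp' a u)
    rw [hfd 0 h0, hΦ.fderiv_zero, ContinuousLinearMap.id_apply, eval_zero, constantCoeff_eq,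
      sub_eq_zero] at h1
    rw [← homogeneousComponent_pderiv, homogeneousComponent_zero, ← h1, pderiv_X_eq_C]
  have hq : ∀ a, ∑ k ∈ Finset.range 4, homogeneousComponent k (p a) =
      X a + homogeneousComponent 2 (p a) + homogeneousComponent 3 (p a) := by
    intro a
    rw [Finset.sum_range_succ, Finset.sum_range_succ, Finset.sum_range_succ,
      Finset.sum_range_one, hcomp0, hcomp1, zero_add]
  have hd : ∀ u a, (fun x => fderiv ℝ Φ x (Pi.single u 1) a - eval x (pderiv u
      (X a + homogeneousComponent 2 (p a) + homogeneousComponent 3 (p a)))) =O[𝓝 0]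
      fun x => ‖x‖ ^ 3 := by
    intro u a
    have h1 : pderiv u (X a + homogeneousComponent 2 (p a) + homogeneousComponent 3 (p a)) =
        ∑ k ∈ Finset.range 3, homogeneousComponent k (pderiv u (p a)) := by
      rw [Finset.sum_range_succ, Finset.sum_range_succ, Finset.sum_range_one, map_add, map_add,
        homogeneousComponent_pderiv, homogeneousComponent_pderiv, homogeneousComponent_pderiv,
        hcomp1]
    rw [h1]
    refine ((hp' a u).add (isBigO_sub_sum_homogeneousComponent (pderiv u (p a)) 3)).congr' ?_ .rfl
    filter_upwards [hU.mem_nhds h0] with x hx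
    rw [hfd x hx]
    ring
  obtain ⟨F, G, hF, hG, hFG⟩ := exists_generators_of_isBigO
    (fun a => homogeneousComponent_isHomogeneous 2 (p a))
    (fun a => homogeneousComponent_isHomogeneous 3 (p a)) (by
      intro u v
      have hb : ∀ q : Poly n, (fun x => eval x q) =O[𝓝 0] fun _ => (1 : ℝ) := fun q =>
        (continuous_eval q).continuousAt.isBigO_one ℝ
      refine (isBigO_symplecticForm_sub (hd u) (hd v) (fun c => hb _) fun c => hb _).neg_left.congr'
        ?_ .rfl
      filter_upwards [hU.mem_nhds h0] with x hx
      rw [eval_polySymplecticForm, eval_polySymplecticForm,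
        hΦ.isSymplecticDiffeo.symplectic x hx]
      simp only [pderiv_X_eq_C, eval_C]
      ring)
  refine ⟨F, G, hF, hG, fun a => ?_⟩
  rw [← hFG, ← hq]
  exact ((hp a).add (isBigO_sub_sum_homogeneousComponent (p a) 4)).congr_left fun x => by ring


theorem IsSymplecticDiffeo.differentiableAt {Φ : OpenPartialHomeomorph (Phase n) (Phase n)}
    (h : IsSymplecticDiffeo Φ) {x : Phase n} (hx : x ∈ Φ.source) : DifferentiableAt ℝ Φ x :=
  (h.contDiffOn.contDiffAt (Φ.open_source.mem_nhds hx)).differentiableAt (by simp)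

theorem IsSymplecticDiffeo.trans {Φ Ψ : OpenPartialHomeomorph (Phase n) (Phase n)}
    (hΦ : IsSymplecticDiffeo Φ) (hΨ : IsSymplecticDiffeo Ψ) : IsSymplecticDiffeo (Φ.trans Ψ) := by
  refine ⟨?_, ?_, fun x hx u v => ?_⟩
  · rw [OpenPartialHomeomorph.coe_trans, OpenPartialHomeomorph.trans_source]
    exact hΨ.contDiffOn.comp (hΦ.contDiffOn.mono Set.inter_subset_left) fun x hx => hx.2
  · rw [OpenPartialHomeomorph.coe_trans_symm, OpenPartialHomeomorph.trans_target]
    exact hΦ.contDiffOn_symm.comp (hΨ.contDiffOn_symm.mono Set.inter_subset_left) fun x hx => hx.2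
  · rw [OpenPartialHomeomorph.trans_source] at hx
    rw [OpenPartialHomeomorph.coe_trans, fderiv_comp x (hΨ.differentiableAt hx.2)
      (hΦ.differentiableAt hx.1), ContinuousLinearMap.comp_apply, ContinuousLinearMap.comp_apply,
      hΨ.symplectic _ hx.2, hΦ.symplectic _ hx.1]

theorem IsNearIdentity.trans {Φ Ψ : OpenPartialHomeomorph (Phase n) (Phase n)}
    (hΦ : IsNearIdentity Φ) (hΨ : IsNearIdentity Ψ) : IsNearIdentity (Φ.trans Ψ) := by
  have h0 : Φ 0 ∈ Ψ.source := by rw [hΦ.map_zero]; exact hΨ.zero_mem_source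
  refine ⟨hΦ.isSymplecticDiffeo.trans hΨ.isSymplecticDiffeo, ?_, ?_, ?_⟩
  · rw [OpenPartialHomeomorph.trans_source]
    exact ⟨hΦ.zero_mem_source, h0⟩
  · rw [OpenPartialHomeomorph.coe_trans, Function.comp_apply, hΦ.map_zero, hΨ.map_zero]
  · rw [OpenPartialHomeomorph.coe_trans, fderiv_comp 0 (hΨ.isSymplecticDiffeo.differentiableAt h0)
      (hΦ.isSymplecticDiffeo.differentiableAt hΦ.zero_mem_source), hΦ.map_zero, hΨ.fderiv_zero,
      hΦ.fderiv_zero, ContinuousLinearMap.comp_id]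

theorem IsNearIdentity.isBigO_norm {Φ : OpenPartialHomeomorph (Phase n) (Phase n)}
    (hΦ : IsNearIdentity Φ) : (fun x => Φ x) =O[𝓝 0] fun x => ‖x‖ := by
  have h := (hΦ.isSymplecticDiffeo.differentiableAt hΦ.zero_mem_source).isBigO_sub
  simpa [hΦ.map_zero] using h.norm_right

/-- The local inverse is smooth at images of points with invertible derivative. Restricting the
source to the open set of such points gives smoothness on the whole target. -/
theorem exists_localDiffeo {E : Type*} [NormedAddCommGroup E] [NormedSpace ℝ E] [CompleteSpace E]
    {f : E → E} (hf : ContDiff ℝ ∞ f) {x : E} (hx : fderiv ℝ f x = ContinuousLinearMap.id ℝ E) :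
    ∃ Φ : OpenPartialHomeomorph E E, (Φ : E → E) = f ∧ x ∈ Φ.source ∧
      ContDiffOn ℝ ∞ Φ.symm Φ.target := by
  have h1 : HasFDerivAt f ((ContinuousLinearEquiv.refl ℝ E : E ≃L[ℝ] E) : E →L[ℝ] E) x := by
    have h2 := (hf.differentiable (by simp) x).hasFDerivAt
    rw [hx] at h2
    exact h2
  let e := hf.contDiffAt.toOpenPartialHomeomorph f h1 (by simp)
  have hV : IsOpen (fderiv ℝ f ⁻¹' Set.range ((↑) : (E ≃L[ℝ] E) → E →L[ℝ] E)) :=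
    ContinuousLinearEquiv.isOpen.preimage (hf.continuous_fderiv (by simp))
  refine ⟨e.restrOpen _ hV, rfl, ?_, ?_⟩
  · rw [OpenPartialHomeomorph.restrOpen_source]
    exact ⟨hf.contDiffAt.mem_toOpenPartialHomeomorph_source h1 (by simp),
      ContinuousLinearEquiv.refl ℝ E, hx.symm⟩
  · intro y hy
    have h3 := (e.restrOpen _ hV).map_target hy
    rw [OpenPartialHomeomorph.restrOpen_source] at h3
    obtain ⟨L, hL⟩ := h3.2
    refine ((e.restrOpen _ hV).contDiffAt_symm (f₀' := L) hy ?_ hf.contDiffAt).contDiffWithinAt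
    rw [hL]
    exact (hf.differentiable (by simp) _).hasFDerivAt

/-- The perturbation of the identity by a polynomial vector field. -/
noncomputable def perturbation (a : Fin n ⊕ Fin n → Poly n) (x : Phase n) : Phase n :=
  fun c => x c + eval x (a c)

theorem contDiff_perturbation (a : Fin n ⊕ Fin n → Poly n) : ContDiff ℝ ∞ (perturbation a) :=
  contDiff_pi.2 fun c => (contDiff_apply ℝ ℝ c).add (contDiff_eval (a c))

theorem fderiv_perturbation (a : Fin n ⊕ Fin n → Poly n) (x v : Phase n) (c : Fin n ⊕ Fin n) :
    fderiv ℝ (perturbation a) x v c = v c + ∑ d, eval x (pderiv d (a c)) * v d := by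
  have h : HasFDerivAt (perturbation a) (ContinuousLinearMap.pi fun c =>
      ContinuousLinearMap.proj (R := ℝ) (φ := fun _ : Fin n ⊕ Fin n => ℝ) c +
        ∑ d, eval x (pderiv d (a c)) •
          ContinuousLinearMap.proj (R := ℝ) (φ := fun _ : Fin n ⊕ Fin n => ℝ) d) x :=
    hasFDerivAt_pi.2 fun c => (hasFDerivAt_apply c x).add (hasFDerivAt_eval (a c) x)
  rw [h.fderiv]
  simp

theorem eval_zero_of_isHomogeneous {ι : Type*} [Fintype ι] {d : ℕ} {p : MvPolynomial ι ℝ}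
    (hp : p.IsHomogeneous (d + 1)) : eval 0 p = 0 := by
  have h := eval_smul_of_isHomogeneous hp 0 0
  rwa [smul_zero, zero_pow (Nat.succ_ne_zero d), zero_mul] at h

theorem perturbation_zero {a : Fin n ⊕ Fin n → Poly n} {d : ℕ}
    (ha : ∀ c, (a c).IsHomogeneous (d + 2)) : perturbation a 0 = 0 := by
  ext c
  simp only [perturbation, eval_zero_of_isHomogeneous (ha c), Pi.zero_apply, add_zero]

theorem fderiv_perturbation_zero {a : Fin n ⊕ Fin n → Poly n} {d : ℕ}
    (ha : ∀ c, (a c).IsHomogeneous (d + 2)) :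
    fderiv ℝ (perturbation a) 0 = ContinuousLinearMap.id ℝ (Phase n) := by
  refine ContinuousLinearMap.ext fun v => funext fun c => ?_
  have h : ∀ u, eval 0 (pderiv u (a c)) = 0 := fun u =>
    eval_zero_of_isHomogeneous (d := d) (ha c).pderiv
  simp only [fderiv_perturbation, h, zero_mul, Finset.sum_const_zero, add_zero,
    ContinuousLinearMap.id_apply]

theorem isBigO_eval_comp_sub {φ : Phase n → Phase n}
    (hφ : ∀ c, (fun x => φ x c - x c) =O[𝓝 0] fun x => ‖x‖ ^ 2) {d : ℕ} {f : Poly n}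
    (hf : f.IsHomogeneous d) :
    (fun x => eval (φ x) f - eval x f) =O[𝓝 0] fun x => ‖x‖ ^ (d + 1) := by
  refine homogeneous_induction (P := fun d f => (fun x => eval (φ x) f - eval x f)
    =O[𝓝 0] fun x => ‖x‖ ^ (d + 1)) (fun d => ?_) (fun c => ?_) (fun d p q h1 h2 => ?_)
    (fun d p i hp h => ?_) hf
  · simpa using isBigO_zero _ _
  · simpa using isBigO_zero _ _
  · refine (h1.add h2).congr_left fun x => ?_
    rw [map_add, map_add]
    ring
  · have h1 : (fun x => eval (φ x) p) =O[𝓝 0] fun x => ‖x‖ ^ d :=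
      ((h.trans (isBigO_pow_of_le (Nat.le_add_right d 1))).add (isBigO_eval hp)).congr_left
        fun x => by ring
    have h2 := ((hφ i).mul h1).congr_right (g₂ := fun x => ‖x‖ ^ (d + 1 + 1)) fun x => by ring
    have h3 := ((isBigO_apply i).mul h).congr_right
      (g₂ := fun x => ‖x‖ ^ (d + 1 + 1)) fun x => by ring
    refine (h2.add h3).congr_left fun x => ?_
    simp only [map_mul, eval_X]
    ring

/-- The perturbation of `(q, p) ↦ (q, p + ∂S/∂q)`. -/
noncomputable def generatingLeft (S : Poly n) : Fin n ⊕ Fin n → Poly n :=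
  Sum.elim 0 fun i => pderiv (Sum.inl i) S

/-- The perturbation of `(q, p) ↦ (q + ∂S/∂p, p)`. -/
noncomputable def generatingRight (S : Poly n) : Fin n ⊕ Fin n → Poly n :=
  Sum.elim (fun i => pderiv (Sum.inr i) S) 0

/-- Up to sign, the two pullbacks of dq ∧ dp differ by ∑ dx_c ∧ d(∂_c S), which is zero because the
Hessian of S is symmetric. -/
theorem symplecticForm_fderiv_generating (S : Poly n) (x u v : Phase n) :
    symplecticForm (fderiv ℝ (perturbation (generatingRight S)) x u)
        (fderiv ℝ (perturbation (generatingRight S)) x v) =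
      symplecticForm (fderiv ℝ (perturbation (generatingLeft S)) x u)
        (fderiv ℝ (perturbation (generatingLeft S)) x v) := by
  have h1 : ∑ c, v c * ∑ d, eval x (pderiv d (pderiv c S)) * u d =
      ∑ c, u c * ∑ d, eval x (pderiv d (pderiv c S)) * v d := by
    simp_rw [Finset.mul_sum]
    rw [Finset.sum_comm]
    refine Finset.sum_congr rfl fun c _ => Finset.sum_congr rfl fun d _ => ?_
    rw [pderiv_pderiv_comm]
    ring
  simp only [symplecticForm, fderiv_perturbation, generatingLeft, generatingRight, Sum.elim_inl,
    Sum.elim_inr, Pi.zero_apply, map_zero, zero_mul, Finset.sum_const_zero, add_zero]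
  rw [Fintype.sum_sum_type, Fintype.sum_sum_type, ← Finset.sum_add_distrib,
    ← Finset.sum_add_distrib] at h1
  rw [← sub_eq_zero, ← Finset.sum_sub_distrib]
  rw [← sub_eq_zero, ← Finset.sum_sub_distrib] at h1
  rw [← h1]
  exact Finset.sum_congr rfl fun i _ => by ring

/-- The map `(q, p + ∂S/∂q) ↦ (q + ∂S/∂p, p)` is symplectic. -/
theorem exists_isNearIdentity {S : Poly n} {m : ℕ} (hS : S.IsHomogeneous (m + 3)) :
    ∃ Φ : OpenPartialHomeomorph (Phase n) (Phase n), IsNearIdentity Φ ∧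
      ∀ a, (fun x => Φ x a - (x a + eval x (poisson (X a) S))) =O[𝓝 0] fun x => ‖x‖ ^ (m + 3) := by
  have hl : ∀ c, (generatingLeft S c).IsHomogeneous (m + 2) := by
    rintro (i | i)
    · exact isHomogeneous_zero _ _ _
    · exact hS.pderiv
  have hr : ∀ c, (generatingRight S c).IsHomogeneous (m + 2) := by
    rintro (i | i)
    · exact hS.pderiv
    · exact isHomogeneous_zero _ _ _
  -- The required map is B ∘ A⁻¹: both factors pull the symplectic form back to the same form.
  obtain ⟨A, hA, hA0, hAs⟩ := exists_localDiffeo (contDiff_perturbation (generatingLeft S))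
    (fderiv_perturbation_zero hl)
  obtain ⟨B, hB, hB0, hBs⟩ := exists_localDiffeo (contDiff_perturbation (generatingRight S))
    (fderiv_perturbation_zero hr)
  have hAzero : A 0 = 0 := by rw [hA, perturbation_zero hl]
  have hBzero : B 0 = 0 := by rw [hB, perturbation_zero hr]
  have hAcd : ContDiff ℝ ∞ A := hA ▸ contDiff_perturbation _
  have hBcd : ContDiff ℝ ∞ B := hB ▸ contDiff_perturbation _
  have hA0t : (0 : Phase n) ∈ A.target := by
    have := A.map_source hA0
    rwa [hAzero] at this
  have hAs0 : A.symm 0 = 0 := by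
    have := A.left_inv hA0
    rwa [hAzero] at this
  have hAd : ∀ x ∈ A.target, DifferentiableAt ℝ A.symm x := fun x hx =>
    (hAs.contDiffAt (A.open_target.mem_nhds hx)).differentiableAt (by simp)
  have hinv : ∀ x ∈ A.target, ∀ v, fderiv ℝ A (A.symm x) (fderiv ℝ A.symm x v) = v := by
    intro x hx v
    have h1 : HasFDerivAt (fun y => A (A.symm y))
        ((fderiv ℝ A (A.symm x)).comp (fderiv ℝ A.symm x)) x :=
      ((hAcd.differentiable (by simp) _).hasFDerivAt).comp x (hAd x hx).hasFDerivAt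
    have h2 := h1.congr_of_eventuallyEq ((A.eventually_right_inverse hx).mono fun y hy => hy.symm)
    exact congrArg (fun L => L v) (h2.unique (hasFDerivAt_id x))
  have hfd : ∀ x ∈ A.target, ∀ v, fderiv ℝ (A.symm.trans B) x v =
      fderiv ℝ B (A.symm x) (fderiv ℝ A.symm x v) := by
    intro x hx v
    rw [OpenPartialHomeomorph.coe_trans, fderiv_comp x (hBcd.differentiable (by simp) _) (hAd x hx)]
    rfl
  refine ⟨A.symm.trans B, ⟨⟨?_, ?_, fun x hx u v => ?_⟩, ?_, ?_, ?_⟩, fun a => ?_⟩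
  · rw [OpenPartialHomeomorph.coe_trans, OpenPartialHomeomorph.trans_source]
    exact hBcd.comp_contDiffOn (hAs.mono Set.inter_subset_left)
  · rw [OpenPartialHomeomorph.coe_trans_symm, OpenPartialHomeomorph.trans_target]
    exact hAcd.comp_contDiffOn (hBs.mono Set.inter_subset_left)
  · rw [OpenPartialHomeomorph.trans_source] at hx
    rw [hfd x hx.1, hfd x hx.1, hB, symplecticForm_fderiv_generating, ← hA, hinv x hx.1,
      hinv x hx.1]
  · rw [OpenPartialHomeomorph.trans_source]
    refine ⟨hA0t, ?_⟩
    rw [Set.mem_preimage, hAs0]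
    exact hB0
  · rw [OpenPartialHomeomorph.coe_trans, Function.comp_apply, hAs0, hBzero]
  · refine ContinuousLinearMap.ext fun v => ?_
    have h1 := hinv 0 hA0t v
    rw [hAs0, hA, fderiv_perturbation_zero hl, ContinuousLinearMap.id_apply] at h1
    rw [hfd 0 hA0t, hAs0, hB, fderiv_perturbation_zero hr, ContinuousLinearMap.id_apply, h1,
      ContinuousLinearMap.id_apply]
  · have hx : ∀ᶠ x in 𝓝 0, ∀ c, x c = A.symm x c + eval (A.symm x) (generatingLeft S c) := by
      filter_upwards [A.open_target.mem_nhds hA0t] with x hx c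
      conv_lhs => rw [← A.right_inv hx, hA]
      rfl
    have hnorm : (fun x => A.symm x) =O[𝓝 0] fun x => ‖x‖ := by
      simpa [hAs0] using (hAd 0 hA0t).isBigO_sub.norm_right
    have hsub : ∀ c, (fun x => A.symm x c - x c) =O[𝓝 0] fun x => ‖x‖ ^ 2 := by
      intro c
      have htends : Filter.Tendsto A.symm (𝓝 0) (𝓝 0) := by
        simpa [hAs0, ContinuousAt] using (hAd 0 hA0t).continuousAt
      have h1 := (isBigO_eval_of_le (by omega : 2 ≤ m + 2) (hl c)).comp_tendsto htends
      refine (h1.neg_left.congr' ?_ .rfl).trans (hnorm.norm_left.pow 2)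
      filter_upwards [hx] with x hx
      rw [hx c]
      simp only [Function.comp_apply]
      ring
    have hP : (poisson (X a) S).IsHomogeneous (m + 2) := by
      have := poisson_isHomogeneous_right (b := m + 1) (isHomogeneous_X ℝ a) hS
      rwa [add_comm 1] at this
    -- The displacement is exactly the Hamiltonian field of S at A⁻¹x. As A⁻¹x = x + O(‖x‖²), moving
    -- the base point to x costs one order more than the degree of the field.
    refine (isBigO_eval_comp_sub hsub hP).congr' ?_ .rfl
    filter_upwards [hx] with x hx
    rw [OpenPartialHomeomorph.coe_trans, Function.comp_apply, hB]
    rcases a with i | i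
    · have h1 := hx (Sum.inl i)
      simp only [generatingLeft, Sum.elim_inl, Pi.zero_apply, map_zero, add_zero] at h1
      rw [perturbation, ← h1, poisson_X_inl_left]
      simp only [generatingRight, Sum.elim_inl]
      ring
    · have h1 := hx (Sum.inr i)
      simp only [generatingLeft, Sum.elim_inr] at h1
      rw [perturbation, h1, poisson_X_inr_left]
      simp only [generatingRight, Sum.elim_inr, Pi.zero_apply, map_zero, map_neg]
      ring


/-! ### Existence and uniqueness of the normal form. -/

theorem poisson_zero_right (f : Poly n) : poisson f 0 = 0 := by
  simpa using poisson_C_right f 0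

theorem poisson_neg_left (f g : Poly n) : poisson (-f) g = -poisson f g := by
  simpa using poisson_smul_left (-1) f g

theorem poisson_neg_right (f g : Poly n) : poisson f (-g) = -poisson f g := by
  simpa using poisson_smul_right (-1) f g

theorem poisson_sub_right (f g h : Poly n) : poisson f (g - h) = poisson f g - poisson f h := by
  rw [sub_eq_add_neg, poisson_add_right, poisson_neg_right, sub_eq_add_neg]

theorem poisson_C_mul_right (c : ℝ) (f g : Poly n) : poisson f (C c * g) = C c * poisson f g := by
  rw [poisson_mul_right, poisson_C_right, mul_zero, add_zero]

theorem eq_of_poisson_X_eq {d : ℕ} {F G : Poly n} (hF : F.IsHomogeneous (d + 1))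
    (hG : G.IsHomogeneous (d + 1)) (h : ∀ a, poisson (X a) F = poisson (X a) G) : F = G := by
  refine eq_of_pderiv_eq hF hG ?_
  rintro (i | i)
  · have := h (Sum.inr i)
    rwa [poisson_X_inr_left, poisson_X_inr_left, neg_inj] at this
  · have := h (Sum.inl i)
    rwa [poisson_X_inl_left, poisson_X_inl_left] at this

/-- The quartic part of the transformed Hamiltonian. -/
noncomputable def quarticPart (F G H₂ H₃ H₄ : Poly n) : Poly n :=
  H₄ + poisson H₃ F + C (1 / 2) * poisson (poisson H₂ F) F + poisson H₂ G

theorem quarticPart_isHomogeneous {F G H₂ H₃ H₄ : Poly n} (hF : F.IsHomogeneous 3)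
    (hG : G.IsHomogeneous 4) (h₂ : H₂.IsHomogeneous 2) (h₃ : H₃.IsHomogeneous 3)
    (h₄ : H₄.IsHomogeneous 4) : (quarticPart F G H₂ H₃ H₄).IsHomogeneous 4 :=
  ((h₄.add (poisson_isHomogeneous_right (b := 1) h₃ hF)).add
    ((poisson_isHomogeneous_right (b := 1) (poisson_isHomogeneous_right (b := 1) h₂ hF) hF).C_mul
      _)).add (poisson_isHomogeneous_right (b := 2) h₂ hG)

/-- Each homogeneous part is expanded by `flowJet` and the result sorted by degree; whatever the
stated polynomial omits has degree at least five. -/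
theorem isBigO_eval_comp_sub_normalForm {F G H₂ H₃ H₄ : Poly n} (hF : F.IsHomogeneous 3)
    (hG : G.IsHomogeneous 4) (h₂ : H₂.IsHomogeneous 2) (h₃ : H₃.IsHomogeneous 3)
    (h₄ : H₄.IsHomogeneous 4) {Φ : Phase n → Phase n}
    (hΦ : ∀ a, (fun x => Φ x a - eval x (flowJet F G (X a))) =O[𝓝 0] fun x => ‖x‖ ^ 4) :
    (fun x => eval (Φ x) (H₂ + H₃ + H₄) -
      eval x (H₂ + (H₃ + poisson H₂ F) + quarticPart F G H₂ H₃ H₄)) =O[𝓝 0]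
      fun x => ‖x‖ ^ 5 := by
  have h1 := isBigO_eval_comp_sub_flowJet hF hG hΦ h₂
  have h2 := (isBigO_eval_comp_sub_flowJet hF hG hΦ h₃).trans
    (isBigO_pow_of_le (by norm_num : 5 ≤ 3 + 3))
  have h3 := (isBigO_eval_comp_sub_flowJet hF hG hΦ h₄).trans
    (isBigO_pow_of_le (by norm_num : 5 ≤ 4 + 3))
  have h4 := isBigO_eval (flowJet_second_isHomogeneous hF hG h₃)
  have h5 := isBigO_eval (poisson_isHomogeneous_right (b := 1) h₄ hF)
  have h6 := isBigO_eval_of_le (by norm_num : 5 ≤ 4 + 2) (flowJet_second_isHomogeneous hF hG h₄)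
  refine (((((h1.add h2).add h3).add h4).add h5).add h6).congr_left fun x => ?_
  simp only [flowJet, quarticPart, map_add]
  ring

theorem quarticPart_eq {F G H₂ H₃ H₄ : Poly n} (h : poisson H₂ F = -H₃) :
    quarticPart F G H₂ H₃ H₄ = H₄ + C (1 / 2) * poisson H₃ F + poisson H₂ G := by
  have h2 : (C (1 / 2) * 2 : Poly n) = 1 := by
    rw [← map_ofNat C 2, ← C_mul]
    norm_num
  rw [quarticPart, h, poisson_neg_left]
  linear_combination -poisson H₃ F * h2

/-- The generating function fixes the map only through its quadratic terms. The cubic terms are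
still Hamiltonian, with some uncontrolled G that a second transformation has to correct. -/
theorem exists_isNearIdentity_cubic {F : Poly n} (hF : F.IsHomogeneous 3) :
    ∃ Φ : OpenPartialHomeomorph (Phase n) (Phase n), IsNearIdentity Φ ∧ ∃ G : Poly n,
      G.IsHomogeneous 4 ∧
      ∀ a, (fun x => Φ x a - eval x (flowJet F G (X a))) =O[𝓝 0] fun x => ‖x‖ ^ 4 := by
  obtain ⟨Φ, hΦ, hΦF⟩ := exists_isNearIdentity (m := 0) hF
  obtain ⟨F', G, hF', hG, hΦG⟩ := hΦ.exists_flowJet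
  have heq : F' = F := by
    refine eq_of_poisson_X_eq hF' hF fun a => sub_eq_zero.1 ?_
    have hX := isHomogeneous_X ℝ a
    refine eq_zero_of_isBigO (k := 2)
      ((poisson_isHomogeneous_right (b := 1) hX hF').sub
        (poisson_isHomogeneous_right (b := 1) hX hF)) ?_
    have h1 := ((hΦG a).trans (isBigO_pow_of_le (by norm_num : 3 ≤ 4)))
    have h2 := isBigO_eval (flowJet_second_isHomogeneous hF' hG hX)
    refine (((hΦF a).sub h1).sub h2).congr_left fun x => ?_
    simp only [flowJet, map_add, map_sub, eval_X]
    ring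
  exact ⟨Φ, hΦ, G, hG, heq ▸ hΦG⟩

theorem exists_isNearIdentity_quartic {G : Poly n} (hG : G.IsHomogeneous 4) :
    ∃ Φ : OpenPartialHomeomorph (Phase n) (Phase n), IsNearIdentity Φ ∧
      ∀ a, (fun x => Φ x a - eval x (flowJet 0 G (X a))) =O[𝓝 0] fun x => ‖x‖ ^ 4 := by
  obtain ⟨Φ, hΦ, hΦG⟩ := exists_isNearIdentity (m := 1) hG
  refine ⟨Φ, hΦ, fun a => (hΦG a).congr_left fun x => ?_⟩
  simp [flowJet, poisson_zero_right]

theorem hamiltonian_eq_totalEnergy (n : ℕ) (α β : ℝ) : hamiltonian n α β =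
    totalEnergy n + C (α / 6) * bondSum n 3 + C (β / 24) * bondSum n 4 := by
  rw [hamiltonian_eq, totalEnergy]

theorem exists_isBirkhoffNormalForm {α β : ℝ} {F₀ K₄ F₄ : Poly n} (hF₀ : F₀.IsHomogeneous 3)
    (hK₄ : K₄.IsHomogeneous 4) (hF₄ : F₄.IsHomogeneous 4)
    (h3 : poisson (totalEnergy n) F₀ = -(C (α / 6) * bondSum n 3))
    (h4 : C (β / 24) * bondSum n 4 + C (1 / 2) * poisson (C (α / 6) * bondSum n 3) F₀ =
      K₄ + poisson (totalEnergy n) F₄) (hK : poisson (totalEnergy n) K₄ = 0) :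
    IsBirkhoffNormalForm (hamiltonian n α β) 4 (totalEnergy n + K₄) := by
  have hE := totalEnergy_isHomogeneous (n := n)
  have hcomp : ∀ r, homogeneousComponent r (totalEnergy n + K₄) =
      (if r = 2 then totalEnergy n else 0) + if r = 4 then K₄ else 0 := fun r => by
    rw [map_add, homogeneousComponent_of_mem hE, homogeneousComponent_of_mem hK₄]
  have hH2 : homogeneousComponent 2 (hamiltonian n α β) = totalEnergy n :=
    homogeneousComponent_hamiltonian_two α β
  refine ⟨fun r hr => ?_, ?_, ?_, fun r hr hr' => ?_, ?_⟩
  · rw [hcomp, if_neg (by omega), if_neg (by omega), add_zero]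
  · rw [hcomp, if_pos rfl, if_neg (by norm_num), add_zero, hH2]
  · exact (totalDegree_add _ _).trans (max_le (hE.totalDegree_le.trans (by norm_num))
      hK₄.totalDegree_le)
  · rw [hcomp, hH2, if_neg (by omega), zero_add]
    split_ifs
    · exact hK
    · exact poisson_zero_right _
  -- Φ removes the cubic part but leaves {H₂, F₄ + G} beside K₄; Ψ, generated by −(F₄ + G), removes
  -- that, and Ψ acts first in the composition.
  obtain ⟨Φ, hΦ, G, hG, hΦG⟩ := exists_isNearIdentity_cubic hF₀
  have hW : (F₄ + G).IsHomogeneous 4 := hF₄.add hG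
  obtain ⟨Ψ, hΨ, hΨW⟩ := exists_isNearIdentity_quartic hW.neg
  have hE4 : (K₄ + poisson (totalEnergy n) (F₄ + G)).IsHomogeneous 4 :=
    hK₄.add (poisson_isHomogeneous_right (b := 2) hE hW)
  have h5 := isBigO_eval_comp_sub_normalForm hF₀ hG hE ((bondSum_isHomogeneous (n := n) 3).C_mul
    (α / 6)) ((bondSum_isHomogeneous (n := n) 4).C_mul (β / 24)) hΦG
  rw [quarticPart_eq h3, h3, add_neg_cancel, add_zero, h4, add_assoc K₄, ← poisson_add_right,
    ← hamiltonian_eq_totalEnergy] at h5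
  have h6 := isBigO_eval_comp_sub_normalForm (isHomogeneous_zero _ _ _) hW.neg hE
    (isHomogeneous_zero _ _ _) hE4 hΨW
  rw [quarticPart_eq (by rw [poisson_zero_right, neg_zero]), poisson_zero_right, poisson_zero_right,
    poisson_neg_right, mul_zero, add_zero, add_zero, add_zero, add_zero, add_neg_cancel_right] at h6
  refine ⟨Ψ.trans Φ, (hΨ.trans hΦ).isSymplecticDiffeo, (hΨ.trans hΦ).zero_mem_source,
    (hΨ.trans hΦ).map_zero, (hΨ.trans hΦ).fderiv_zero, ?_⟩
  have htends : Filter.Tendsto Ψ (𝓝 0) (𝓝 0) := by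
    have := (hΨ.isSymplecticDiffeo.differentiableAt hΨ.zero_mem_source).continuousAt
    rwa [ContinuousAt, hΨ.map_zero] at this
  have h7 := (h5.comp_tendsto htends).trans (hΨ.isBigO_norm.norm_left.pow 5)
  refine (h7.add h6).congr_left fun x => ?_
  simp only [Function.comp_apply, OpenPartialHomeomorph.coe_trans]
  ring

theorem IsBirkhoffNormalForm.eq_totalEnergy_add {α β : ℝ} {F₀ K₄ F₄ K : Poly n}
    (h3 : poisson (totalEnergy n) F₀ = -(C (α / 6) * bondSum n 3))
    (h4 : C (β / 24) * bondSum n 4 + C (1 / 2) * poisson (C (α / 6) * bondSum n 3) F₀ =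
      K₄ + poisson (totalEnergy n) F₄) (hK₄ : poisson (totalEnergy n) K₄ = 0)
    (hK : IsBirkhoffNormalForm (hamiltonian n α β) 4 K) :
    homogeneousComponent 3 K = 0 ∧ K = totalEnergy n + K₄ := by
  have hE := totalEnergy_isHomogeneous (n := n)
  have hB3 := (bondSum_isHomogeneous (n := n) 3).C_mul (α / 6)
  have hB4 := (bondSum_isHomogeneous (n := n) 4).C_mul (β / 24)
  have hH2 : homogeneousComponent 2 (hamiltonian n α β) = totalEnergy n :=
    homogeneousComponent_hamiltonian_two α β
  obtain ⟨Φ, hΦ, h0, hΦ0, hΦ1, hT⟩ := hK.transformed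
  obtain ⟨F, G, hF, hG, hFG⟩ := (IsNearIdentity.mk hΦ h0 hΦ0 hΦ1).exists_flowJet
  have h5 := isBigO_eval_comp_sub_normalForm hF hG hE hB3 hB4 hFG
  rw [← hamiltonian_eq_totalEnergy] at h5
  have hJ3 : (C (α / 6) * bondSum n 3 + poisson (totalEnergy n) F).IsHomogeneous 3 :=
    hB3.add (poisson_isHomogeneous_right (b := 1) hE hF)
  have hJ4 := quarticPart_isHomogeneous hF hG hE hB3 hB4
  have h6 : ∀ k < 5, homogeneousComponent k K = homogeneousComponent k (totalEnergy n +
      (C (α / 6) * bondSum n 3 + poisson (totalEnergy n) F) +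
      quarticPart F G (totalEnergy n) (C (α / 6) * bondSum n 3) (C (β / 24) * bondSum n 4)) := by
    intro k hk
    refine (sub_eq_zero.1 ?_).symm
    rw [← map_sub]
    refine homogeneousComponent_eq_zero_of_isBigO (m := 5) ((hT.sub h5).congr_left fun x => ?_) hk
    rw [map_sub]
    ring
  have hK3 := h6 3 (by norm_num)
  have hK4 := h6 4 (by norm_num)
  rw [map_add, map_add, homogeneousComponent_of_mem hE, homogeneousComponent_of_mem hJ3,
    homogeneousComponent_of_mem hJ4, if_neg (by norm_num), if_pos rfl, if_neg (by norm_num),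
    zero_add, add_zero] at hK3
  rw [map_add, map_add, homogeneousComponent_of_mem hE, homogeneousComponent_of_mem hJ3,
    homogeneousComponent_of_mem hJ4, if_neg (by norm_num), if_neg (by norm_num), if_pos rfl,
    zero_add, zero_add] at hK4
  have hc3 := hK.commutes 3 le_rfl (by norm_num)
  have hc4 := hK.commutes 4 (by norm_num) le_rfl
  rw [hH2] at hc3 hc4
  -- The cubic part is in the image of {H₂, ·} and, by the commutation requirement, in its kernel.
  have hD : homogeneousComponent 3 K = poisson (totalEnergy n) (F - F₀) := by
    rw [hK3, poisson_sub_right, h3]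
    ring
  have hz : poisson (totalEnergy n) (F - F₀) = 0 := by
    rw [hD] at hc3
    exact poisson_totalEnergy_eq_zero hc3
  have hK3z : homogeneousComponent 3 K = 0 := hD.trans hz
  refine ⟨hK3z, ?_⟩
  have hF3 : poisson (totalEnergy n) F = -(C (α / 6) * bondSum n 3) := by
    rw [poisson_sub_right, h3, sub_eq_zero] at hz
    exact hz
  -- Since F − F₀ commutes with H₂, {H₃, F − F₀} = −{H₂, {F₀, F − F₀}}. Another cubic generator thus
  -- moves the quartic part only inside the image of {H₂, ·}, where the difference of two normal
  -- forms must vanish.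
  have hjac := poisson_jacobi (totalEnergy n) F₀ (F - F₀)
  rw [h3, hz, poisson_zero_right, poisson_neg_left, add_zero] at hjac
  have hD4 : homogeneousComponent 4 K - K₄ = poisson (totalEnergy n)
      (F₄ + G - C (1 / 2) * poisson F₀ (F - F₀)) := by
    rw [hK4, quarticPart_eq hF3, poisson_sub_right, poisson_C_mul_right, hjac, poisson_add_right,
      poisson_sub_right]
    linear_combination h4
  have hz4 : homogeneousComponent 4 K = K₄ := by
    refine sub_eq_zero.1 (hD4.trans (poisson_totalEnergy_eq_zero ?_))
    rw [← hD4, poisson_sub_right, hc4, hK₄, sub_zero]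
  have hsum : ∑ k ∈ Finset.range 5, homogeneousComponent k K = K := by
    conv_rhs => rw [← sum_homogeneousComponent K]
    refine (Finset.sum_subset (Finset.range_subset_range.2 ?_) fun k _ hk => ?_).symm
    · have := hK.totalDegree_le
      omega
    · exact homogeneousComponent_eq_zero _ _ (by simpa using hk)
  rw [← hsum, Finset.sum_range_succ, Finset.sum_range_succ, Finset.sum_range_succ,
    Finset.sum_range_succ, Finset.sum_range_one, hK.component_lt_two 0 (by norm_num),
    hK.component_lt_two 1 (by norm_num), hK.component_two, hH2, hK3z, hz4]
  ring

theorem isIntegrableWith_totalEnergy_add {K₄ : Poly n}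
    (h : ∀ k, poisson K₄ (modeEnergy n k) = 0) :
    IsIntegrableWith (totalEnergy n + K₄) (modeEnergy n) := by
  refine ⟨fun k => ?_, poisson_modeEnergy_modeEnergy, independent_modeEnergy n⟩
  rw [poisson_add_left, h, add_zero, totalEnergy, poisson_sum_left]
  exact Finset.sum_eq_zero fun l _ => poisson_modeEnergy_modeEnergy l k

end FPU

theorem mainTheorem2 (n : ℕ) (α β : ℝ) :
    (∃! K : FPU.Poly n, FPU.IsBirkhoffNormalForm (FPU.hamiltonian n α β) 4 K) ∧
    ∀ K : FPU.Poly n, FPU.IsBirkhoffNormalForm (FPU.hamiltonian n α β) 4 K →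
      MvPolynomial.homogeneousComponent 3 K = 0 ∧
      FPU.IsIntegrableWith K (FPU.modeEnergy n) := by
  obtain ⟨F₀, K₄, F₄, hF₀, hK₄, hF₄, h3, h4, hc, hE⟩ := FPU.exists_normalization n (α / 6) (β / 24)
  refine ⟨⟨FPU.totalEnergy n + K₄,
    FPU.exists_isBirkhoffNormalForm hF₀ hK₄ hF₄ h3 h4 hc,
    fun K hK => (hK.eq_totalEnergy_add h3 h4 hc).2⟩, fun K hK => ?_⟩
  obtain ⟨h0, rfl⟩ := hK.eq_totalEnergy_add h3 h4 hc
  exact ⟨h0, FPU.isIntegrableWith_totalEnergy_add hE⟩
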